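/- Let $D=(d_1,\dots,d_n)$ be the degree sequence of a tree (the order of the entries is irrelevant). For a graph $G$ with $n$ vertices, let $\lambda_1,\dots,\lambda_n$ be the eigenvalues of its adjacency matrix, let $M_k(G)=\sum_{i=1}^n\lambda_i^k$, and let $C(k;G)$ be the number of closed walks of length $k$ in $G$, i.e. of sequences $w_1w_2\cdots w_{k+1}$ of vertices with $w_{k+1}=w_1$ such that $w_iw_{i+1}$ is an edge for $1\le i\le k$. A tree is called greedy if a root can be chosen in it, and the vertices at distance $h-1$ from the root (level $h$) can be labelled $g^h_1,\dots,g^h_{k_h}$ for each $h\ge 1$, such that - on each level the degrees are non-increasing: $\deg g^h_1\ge\dots\ge\deg g^h_{k_h}$; - with $c^h_j$ the number of children of $g^h_j$ (so $c^1_1=\deg g^1_1$, and $c^h_j=\deg g^h_j-1$ for $h\ge2$), the children of $g^h_j$ are the vertices $g^{h+1}_l$ with $\sum_{m<j}c^h_m<l\le\sum_{m\le j}c^h_m$; - every degree on level $h$ is at least as large as every degree on level $h+1$, for all $h\ge 1$. Up to isomorphism, there is exactly one greedy tree with degree sequence $D$; denote it by $G(D)$. Theorem. For every tree $T$ with degree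 sequence $D$ and every integer $k\ge 0$, $$M_k(T)=C(k;T)\le C(k;G(D))=M_k(G(D)).$$ Moreover, if $T$ is not isomorphic to $G(D)$, then there is an integer $K$ such that the inequality is strict for all even $k\ge K$. -/

import Mathlib

open Classical in
/-- `G` has degree sequence `D`: the list of the degrees of all vertices of `G` is `D`,
up to the order of the entries. -/
def HasDegreeSequence {V : Type*} [Fintype V] (G : SimpleGraph V) (D : List ℕ) : Prop :=
  (Finset.univ : Finset V).val.map (fun v => G.degree v) = (D : Multiset ℕ)

open Classical in
/-- The `k`-th spectral moment: the sum of the `k`-th powers of the eigenvalues (with multiplicity)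
of the adjacency matrix. -/
noncomputable def spectralMoment {V : Type*} [Fintype V] (G : SimpleGraph V) (k : ℕ) : ℝ :=
  ∑ i, ((show (G.adjMatrix ℝ).IsHermitian from
    (Matrix.conjTranspose_eq_transpose_of_trivial _).trans G.transpose_adjMatrix).eigenvalues i) ^ k

open Classical in
/-- The number of closed walks of length `k` (walks with a marked start, which is also the end). -/
noncomputable def numClosedWalks {V : Type*} [Fintype V] (G : SimpleGraph V) (k : ℕ) : ℕ :=
  ∑ v : V, (G.finsetWalkLength k v v).card

open Classical in
/-- The leveled degree sequence of a connected graph `G` with root `r`: entry `i` is the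
non-increasing list of the degrees of the vertices at distance `i` from the root.
It is `[]` for all `i` beyond the height. -/
noncomputable def leveledDegreeSequence {V : Type*} [Fintype V] (G : SimpleGraph V) (r : V)
    (i : ℕ) : List ℕ :=
  (((Finset.univ : Finset V).filter (fun v => G.dist r v = i)).val.map
    (fun v => G.degree v)).sort (fun a b => b ≤ a)

/-- The number of children of a vertex of degree `d` on level `i`. Levels are counted from `0`;
a root (level `0`) has only children as neighbors, every other vertex also has its parent. -/
def numChildren (i d : ℕ) : ℕ := if i = 0 then d else d - 1

/-- The total number of children of the first `j` vertices on level `i`, for a leveled degree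
sequence `D`. -/
def childBlockStart (D : ℕ → List ℕ) (i j : ℕ) : ℕ :=
  (((D i).take j).map (numChildren i)).sum

/-- The vertex `x = ⟨i, j⟩` is the `j`-th vertex on level `i` (both counted from `0`). Its children
are the vertices of the next level that form the block following the blocks of the
children of the vertices `⟨i, 0⟩, …, ⟨i, j - 1⟩`. -/
def IsGreedyChild (D : ℕ → List ℕ) (x y : Σ i : ℕ, Fin (D i).length) : Prop :=
  y.1 = x.1 + 1 ∧ childBlockStart D x.1 x.2 ≤ (y.2 : ℕ) ∧
    (y.2 : ℕ) < childBlockStart D x.1 ((x.2 : ℕ) + 1)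

/-- The level greedy forest with leveled degree sequence `D`. -/
def levelGreedyForest (D : ℕ → List ℕ) : SimpleGraph (Σ i : ℕ, Fin (D i).length) where
  Adj x y := IsGreedyChild D x y ∨ IsGreedyChild D y x
  symm := ⟨fun _ _ h => h.symm⟩
  loopless := ⟨fun x h => by
    rcases h with h | h <;> exact absurd h.1 (Nat.succ_ne_self _).symm⟩

/-- A greedy tree: a tree in which a root `r` can be chosen such that, as a rooted tree, it is
the level greedy tree of its leveled degree sequence, and such that no degree on a level is
smaller than a degree on the next level. -/
def IsGreedyTree {V : Type*} [Fintype V] (G : SimpleGraph V) : Prop :=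
  G.IsTree ∧ ∃ r : V,
    (∃ e : G ≃g levelGreedyForest (leveledDegreeSequence G r), (e r).1 = 0) ∧
    ∀ i : ℕ, ∀ a ∈ leveledDegreeSequence G r i, ∀ b ∈ leveledDegreeSequence G r (i + 1), b ≤ a

/-! Trees on a fixed vertex set with fixed vertex degrees are strictly ordered by `WalkLT`: never
fewer closed walks, and more of every large even length. The set is finite, so every tree is maximal
or lies below a maximal one (`SimpleGraph.IsTree.exists_isGreedyTree`). It remains to show that
maximal trees are greedy and that the degree sequence determines a greedy tree
(`IsGreedyTree.nonempty_iso`).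

Maximality is tested by rooting the tree at a vertex or at an edge and rearranging it into a sorted
forest, with every vertex keeping its level and its number of children. On each level, the walk
counts of the sorted forest weakly majorize the original ones (`majorized_rootedWalks`). This
follows by induction along the first-return recurrence, because majorization survives sums, products
(`Majorized.mul`) and the passage from children to parents (`majorized_sum_children`). Factoring
det(1 - XA) (`det_parGraph`) expresses all closed walks through these counts with nonnegative
coefficients. For an edge root, the extra term is monotone in the product of the two root series,
which `resolvent_mul_le_of_majorized` compares.

So rearranging never loses walks, and for a maximal tree it gains none. Equality makes the vertices
on a level totally ordered by the walk counts of their branches (`walkDominates_total`), and this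
order is inherited by children (`WalkDominates.children`). Counts of length 0 are numbers of
children, so degrees compare depth by depth: branches at a common vertex are comparable, and so are
the two sides of an edge (`HasComparableBranches`).

Moving along edges toward the larger side ends at a root (`HasComparableBranches.exists_root`), from
which degrees decrease level by level (`HasComparableBranches.degree_le_of_dist`). Ordering siblings
by their branches yields the level order of a greedy tree (`HasComparableBranches.isLevelOrder`). -/

/-! ### Weak majorization of functions on a finite ordered set -/

section Majorization

open Finset

/-- Layer-cake formula: `b v` is the number of thresholds `s` below it. -/
theorem sum_mul_eq_sum_sum_filter {V : Type*} (S : Finset V) (a b : V → ℕ) {N : ℕ} (hN : ∀ v ∈ S, b v ≤ N) :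
    ∑ v ∈ S, a v * b v = ∑ s ∈ range N, ∑ v ∈ S.filter (s < b ·), a v := by
  simp only [sum_filter]
  rw [sum_comm]
  refine sum_congr rfl fun v hv => ?_
  rw [← sum_filter, sum_const, smul_eq_mul, mul_comm]
  congr 1
  have : (range N).filter (· < b v) = range (b v) := by
    ext x; simp only [mem_filter, mem_range]; have := hN v hv; omega
  rw [this, card_range]

theorem sum_eq_sum_card_filter {V : Type*} (S : Finset V) (b : V → ℕ) {N : ℕ} (hN : ∀ v ∈ S, b v ≤ N) :
    ∑ v ∈ S, b v = ∑ s ∈ range N, (S.filter (s < b ·)).card := by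
  simpa using sum_mul_eq_sum_sum_filter S (fun _ => 1) b hN

/-- `I` is an initial segment of `L`. -/
def IsInitialIn {V : Type*} [LinearOrder V] (L I : Finset V) : Prop :=
  I ⊆ L ∧ ∀ x ∈ I, ∀ y ∈ L, y ≤ x → y ∈ I

/-- `b` is non-increasing on `L`, and the sum of `a` over any subset of `L` is at most the sum of
`b` over any initial segment of `L` that is at least as large: weak majorization of `a` by `b`. -/
def Majorized {V : Type*} [LinearOrder V] (L : Finset V) (a b : V → ℕ) : Prop :=
  AntitoneOn b L ∧ ∀ S ⊆ L, ∀ I, IsInitialIn L I → S.card ≤ I.card → ∑ v ∈ S, a v ≤ ∑ v ∈ I, b v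

variable {V : Type*} [LinearOrder V] {L : Finset V} {a a' b b' : V → ℕ}

theorem isInitialIn_self (L : Finset V) : IsInitialIn L L :=
  ⟨subset_rfl, fun _ _ _ hy _ => hy⟩

theorem Majorized.sum_le (h : Majorized L a b) : ∑ v ∈ L, a v ≤ ∑ v ∈ L, b v :=
  h.2 L subset_rfl L (isInitialIn_self L) le_rfl

theorem Majorized.add (h : Majorized L a b) (h' : Majorized L a' b') :
    Majorized L (fun v => a v + a' v) (fun v => b v + b' v) := by
  refine ⟨fun x hx y hy hxy => add_le_add (h.1 hx hy hxy) (h'.1 hx hy hxy), ?_⟩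
  intro S hS I hI hc
  rw [sum_add_distrib, sum_add_distrib]
  exact add_le_add (h.2 S hS I hI hc) (h'.2 S hS I hI hc)

theorem Majorized.const (c : ℕ) : Majorized L (fun _ => c) (fun _ => c) := by
  refine ⟨fun x hx y hy hxy => le_rfl, ?_⟩
  intro S hS I hI hc
  simpa using Nat.mul_le_mul_right c hc

theorem Majorized.sum {ι : Type*} (s : Finset ι) {a b : ι → V → ℕ}
    (h : ∀ i ∈ s, Majorized L (a i) (b i)) :
    Majorized L (fun v => ∑ i ∈ s, a i v) (fun v => ∑ i ∈ s, b i v) := by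
  classical
  induction s using Finset.induction_on with
  | empty => simpa using Majorized.const (L := L) 0
  | insert i s hi ih =>
    simp only [sum_insert hi]
    exact (h i (mem_insert_self _ _)).add (ih fun j hj => h j (mem_insert_of_mem hj))

/-- Discarding an element with minimal `b` until `m` remain keeps the largest values, so a
superlevel set shrinks only as far as the size bound forces. -/
theorem exists_subset_card_filter_ge (S : Finset V) (b : V → ℕ) (m : ℕ) :
    ∃ S' ⊆ S, S'.card ≤ m ∧ ∀ s : ℕ, min m (S.filter (s < b ·)).card ≤ (S'.filter (s < b ·)).card := by
  induction h : S.card using Nat.strong_induction_on generalizing S with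
  | _ n ih =>
    by_cases hm : S.card ≤ m
    · exact ⟨S, subset_rfl, hm, fun s => min_le_right _ _⟩
    · push Not at hm
      obtain ⟨v, hv, hmin⟩ := S.exists_min_image b (card_pos.1 (by omega))
      have hc : (S.erase v).card = S.card - 1 := card_erase_of_mem hv
      obtain ⟨S', hS', hS'm, hS'f⟩ := ih (S.erase v).card (by omega) (S.erase v) rfl
      refine ⟨S', hS'.trans (erase_subset _ _), hS'm, fun s => le_trans ?_ (hS'f s)⟩
      by_cases hs : s < b v
      · have : (S.erase v).filter (s < b ·) = S.erase v :=
          filter_true_of_mem fun x hx => hs.trans_le (hmin x (mem_of_mem_erase hx))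
        rw [this]
        exact le_trans (min_le_left _ _) (le_min le_rfl (by omega))
      · have : (S.erase v).filter (s < b ·) = S.filter (s < b ·) := by
          ext x
          simp only [mem_filter, mem_erase]
          constructor
          · exact fun hx => ⟨hx.1.2, hx.2⟩
          · exact fun hx => ⟨⟨fun e => hs (e ▸ hx.2), hx.1⟩, hx.2⟩
        rw [this]

theorem exists_initial_card (I : Finset V) {m : ℕ} (hm : m ≤ I.card) :
    ∃ J, IsInitialIn I J ∧ J.card = m := by
  induction h : I.card - m generalizing m with
  | zero => exact ⟨I, isInitialIn_self I, by omega⟩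
  | succ d ih =>
    obtain ⟨J, hJ, hJc⟩ := ih (m := m + 1) (by omega) (by omega)
    have hne : J.Nonempty := card_pos.1 (by omega)
    refine ⟨J.erase (J.max' hne), ⟨(erase_subset _ _).trans hJ.1, ?_⟩, ?_⟩
    · intro x hx y hy hyx
      rw [mem_erase] at hx ⊢
      refine ⟨?_, hJ.2 x hx.2 y hy hyx⟩
      rintro rfl
      exact hx.1 (le_antisymm (J.le_max' _ hx.2) hyx)
    · rw [card_erase_of_mem (J.max'_mem hne)]; omega

theorem IsInitialIn.trans {I J : Finset V} (h : IsInitialIn L I) (h' : IsInitialIn I J) :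
    IsInitialIn L J :=
  ⟨h'.1.trans h.1, fun x hx y hy hyx => h'.2 x hx y (h.2 x (h'.1 hx) y hy hyx) hyx⟩

theorem IsInitialIn.subset_or_subset {I J : Finset V} (h : IsInitialIn L I) (h' : IsInitialIn L J) :
    I ⊆ J ∨ J ⊆ I := by
  by_contra hc
  push Not at hc
  obtain ⟨x, hx, hxJ⟩ := not_subset.1 hc.1
  obtain ⟨y, hy, hyI⟩ := not_subset.1 hc.2
  rcases le_total x y with hxy | hxy
  · exact hxJ (h'.2 y hy x (h.1 hx) hxy)
  · exact hyI (h.2 x hx y (h'.1 hy) hxy)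

theorem IsInitialIn.card_inter {I J : Finset V} (h : IsInitialIn L I) (h' : IsInitialIn L J) :
    (I ∩ J).card = min I.card J.card := by
  rcases h.subset_or_subset h' with hs | hs
  · rw [inter_eq_left.2 hs, min_eq_left (card_le_card hs)]
  · rw [inter_eq_right.2 hs, min_eq_right (card_le_card hs)]

/-- Exchange `S \ I` for `I \ S`: the latter is at least as large, and each of its values is at
least every value on the former. -/
theorem Majorized.of_antitoneOn (h : AntitoneOn b L) : Majorized L b b := by
  refine ⟨h, fun S hS I hI hc => ?_⟩
  rw [← sum_inter_add_sum_sdiff S I b, ← sum_inter_add_sum_sdiff I S b, inter_comm I S]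
  refine Nat.add_le_add_left ?_ _
  have hcard : (S \ I).card ≤ (I \ S).card := by
    have h1 := card_sdiff_add_card_inter S I
    have h2 := card_sdiff_add_card_inter I S
    rw [inter_comm] at h2
    omega
  rcases (S \ I).eq_empty_or_nonempty with he | hne
  · simp [he]
  · obtain ⟨d, hd, hmax⟩ := exists_max_image _ b hne
    rw [mem_sdiff] at hd
    refine (sum_le_card_nsmul _ _ _ hmax).trans ((Nat.mul_le_mul_right _ hcard).trans
      (card_nsmul_le_sum _ _ _ fun c hc => ?_))
    rw [mem_sdiff] at hc
    refine h (hI.1 hc.1) (hS hd.1) ?_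
    by_contra hcd
    push Not at hcd
    exact hd.2 (hI.2 c hc.1 d (hS hd.1) hcd.le)

/-- Cut `a'` and `b` into layers. Majorization of `a` replaces the layers of `a'` by initial
segments; these meet the layers of `b` in nested sets, so only cardinalities matter, and
majorization of `a'` bounds the resulting count. -/
theorem Majorized.mul (h : Majorized L a b) (h' : Majorized L a' b') :
    Majorized L (fun v => a v * a' v) (fun v => b v * b' v) := by
  refine ⟨fun x hx y hy hxy => Nat.mul_le_mul (h.1 hx hy hxy) (h'.1 hx hy hxy), ?_⟩
  intro S hS I hI hc
  obtain ⟨N, hN⟩ : ∃ N, ∀ v ∈ L, a v ≤ N ∧ a' v ≤ N ∧ b v ≤ N ∧ b' v ≤ N := by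
    refine ⟨∑ v ∈ L, (a v + a' v + b v + b' v), fun v hv => ?_⟩
    have := single_le_sum (f := fun v => a v + a' v + b v + b' v) (fun _ _ => Nat.zero_le _) hv
    omega
  -- `J s` is the initial segment of `I` with as many elements as the layer of `a'` at height `s`.
  have hJ : ∀ s, ∃ J, IsInitialIn I J ∧ J.card = (S.filter (s < a' ·)).card := fun s =>
    exists_initial_card I ((card_le_card (filter_subset _ _)).trans hc)
  choose J hJI hJc using hJ
  have hinit : ∀ t, IsInitialIn I (I.filter (t < b ·)) := fun t =>
    ⟨filter_subset _ _, fun x hx y hy hyx => by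
      rw [mem_filter] at hx ⊢
      exact ⟨hy, hx.2.trans_le (h.1 (hI.1 hy) (hI.1 hx.1) hyx)⟩⟩
  calc ∑ v ∈ S, a v * a' v
      = ∑ s ∈ range N, ∑ v ∈ S.filter (s < a' ·), a v :=
        sum_mul_eq_sum_sum_filter S a a' fun v hv => (hN v (hS hv)).2.1
    _ ≤ ∑ s ∈ range N, ∑ v ∈ J s, b v := sum_le_sum fun s _ =>
        h.2 _ ((filter_subset _ _).trans hS) _ (hI.trans (hJI s)) (hJc s).ge
    _ = ∑ s ∈ range N, ∑ t ∈ range N, ((I.filter (t < b ·)) ∩ J s).card := by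
        refine sum_congr rfl fun s _ => ?_
        rw [sum_eq_sum_card_filter (J s) b fun v hv => (hN v (hI.1 ((hJI s).1 hv))).2.2.1]
        refine sum_congr rfl fun t _ => congrArg card ?_
        ext x
        simp only [mem_filter, mem_inter]
        exact ⟨fun hx => ⟨⟨(hJI s).1 hx.1, hx.2⟩, hx.1⟩, fun hx => ⟨hx.2, hx.1.2⟩⟩
    _ = ∑ t ∈ range N, ∑ s ∈ range N,
          min (I.filter (t < b ·)).card (S.filter (s < a' ·)).card := by
        rw [sum_comm]
        refine sum_congr rfl fun t _ => sum_congr rfl fun s _ => ?_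
        rw [(hinit t).card_inter (hJI s), hJc]
    _ ≤ ∑ t ∈ range N, ∑ v ∈ I.filter (t < b ·), b' v := by
        refine sum_le_sum fun t _ => ?_
        -- `S'` collects the largest values of `a'`, at most as many as the layer of `b` has
        -- elements.
        obtain ⟨S', hS', hc', hf'⟩ :=
          exists_subset_card_filter_ge S a' (I.filter (t < b ·)).card
        refine le_trans ?_ (h'.2 S' (hS'.trans hS) _ (hI.trans (hinit t)) hc')
        rw [sum_eq_sum_card_filter S' a' fun v hv => (hN v (hS (hS' hv))).2.1]
        exact sum_le_sum fun s _ => hf' s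
    _ = ∑ v ∈ I, b v * b' v := by
        rw [← sum_mul_eq_sum_sum_filter I b' b fun v hv => (hN v (hI.1 hv)).2.2.1]
        exact sum_congr rfl fun v _ => mul_comm _ _

/-- On the side of `a` all subsets of `L` compete, so permuting `a` within `L` is harmless. -/
theorem Majorized.comp_swap (h : Majorized L a b) {v w : V} (hv : v ∈ L) (hw : w ∈ L) :
    Majorized L (fun x => a (Equiv.swap v w x)) b := by
  refine ⟨h.1, fun S hS I hI hc => ?_⟩
  have := h.2 (S.map (Equiv.swap v w).toEmbedding) ?_ I hI (by rwa [card_map])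
  · rwa [sum_map] at this
  · intro x hx
    obtain ⟨y, hy, rfl⟩ := mem_map.1 hx
    have hyL := hS hy
    simp only [Equiv.coe_toEmbedding]
    rw [Equiv.swap_apply_def]
    split_ifs <;> assumption

/-- If `∑ a * a'` attains the largest value that majorization allows, then `a` and `a'` are
similarly ordered. -/
theorem Majorized.monovary_of_sum_mul_eq (h : Majorized L a b) (h' : Majorized L a' b')
    (heq : ∑ v ∈ L, a v * a' v = ∑ v ∈ L, b v * b' v) {v w : V} (hv : v ∈ L) (hw : w ∈ L)
    (hvw : a v < a w) : a' v ≤ a' w := by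
  by_contra hc
  push Not at hc
  have hne : v ≠ w := by rintro rfl; exact lt_irrefl _ hvw
  -- If `a` and `a'` were oppositely ordered at `v` and `w`, exchanging the two values of `a'` would
  -- push the sum above its bound.
  have hle := (h.mul (h'.comp_swap hv hw)).sum_le
  rw [← heq] at hle
  have split : ∀ f : V → ℕ, ∑ x ∈ L, f x = f v + (f w + ∑ x ∈ (L.erase v).erase w, f x) := fun f => by
    rw [← add_sum_erase _ f hv, ← add_sum_erase (L.erase v) f (mem_erase.2 ⟨hne.symm, hw⟩)]
  rw [split, split (fun v => a v * a' v)] at hle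
  have hrest : ∑ x ∈ (L.erase v).erase w, a x * a' (Equiv.swap v w x)
      = ∑ x ∈ (L.erase v).erase w, a x * a' x := sum_congr rfl fun x hx => by
    simp only [mem_erase] at hx
    rw [Equiv.swap_apply_of_ne_of_ne hx.2.1 hx.1]
  rw [hrest, Equiv.swap_apply_left, Equiv.swap_apply_right] at hle
  nlinarith

end Majorization

/-! ### Walk counts in rooted forests and their sorted rearrangements -/

section RootedForests

open Finset

variable {V : Type*} [Fintype V]

open Classical in
/-- The children of `v` in the rooted forest with parent map `par`, whose roots are the fixed
points of `par`. -/
noncomputable def forestChildren (par : V → V) (v : V) : Finset V :=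
  univ.filter fun c => c ≠ v ∧ par c = v

/-- The number of closed walks of length `k` that start at `v` and only visit descendants of `v`,
in the rooted forest with parent map `par`. -/
noncomputable def rootedWalks (par : V → V) : ℕ → V → ℕ
  | 0, _ => 1
  | 1, _ => 0
  | k + 2, v => ∑ i : Fin (k + 1),
      (∑ c ∈ forestChildren par v, rootedWalks par i c) * rootedWalks par (k - i) v
termination_by k => k
decreasing_by
  all_goals have := i.2; omega

/-- The total number of closed walks of length `k` that start at a child of `v` and only visit
descendants of this child. -/
noncomputable def childWalks (par : V → V) (k : ℕ) (v : V) : ℕ :=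
  ∑ c ∈ forestChildren par v, rootedWalks par k c

/-- The vertices on level `i`. -/
def levelSet (lev : V → ℕ) (i : ℕ) : Finset V :=
  univ.filter fun v => lev v = i

/-- `lev` is the level function of the rooted forest with parent map `par`. -/
structure IsLeveled (par : V → V) (lev : V → ℕ) : Prop where
  root : ∀ v, lev v = 0 → par v = v
  up : ∀ v, lev v ≠ 0 → lev (par v) + 1 = lev v

/-- On each level, the vertices are ordered by their number of children, and blocks of children
are ordered as their parents. -/
structure IsSortedForest [LinearOrder V] (par : V → V) (lev : V → ℕ) : Prop
    extends IsLeveled par lev where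
  mono : ∀ c d, lev c = lev d → lev c ≠ 0 → c ≤ d → par c ≤ par d
  card_anti : ∀ v w, lev v = lev w → v ≤ w → (forestChildren par w).card ≤ (forestChildren par v).card

/-- Every family of branches below `v` has at least as many closed walks as the one below `w`. -/
def WalkDominates (par : V → V) (v w : V) : Prop :=
  ∀ k, childWalks par k w ≤ childWalks par k v

@[simp] theorem mem_levelSet {lev : V → ℕ} {i : ℕ} {v : V} : v ∈ levelSet lev i ↔ lev v = i := by
  simp [levelSet]

theorem mem_forestChildren {par : V → V} {c v : V} :
    c ∈ forestChildren par v ↔ c ≠ v ∧ par c = v := by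
  simp [forestChildren]

theorem IsLeveled.mem_forestChildren {par : V → V} {lev : V → ℕ} (h : IsLeveled par lev) {c v : V} :
    c ∈ forestChildren par v ↔ lev c ≠ 0 ∧ par c = v := by
  rw [_root_.mem_forestChildren]
  constructor
  · rintro ⟨h1, h2⟩
    exact ⟨fun h0 => h1 ((h.root c h0).symm.trans h2), h2⟩
  · rintro ⟨h1, h2⟩
    refine ⟨fun e => ?_, h2⟩
    have := h.up c h1
    rw [h2, ← e] at this
    omega

theorem IsLeveled.lev_of_mem {par : V → V} {lev : V → ℕ} (h : IsLeveled par lev) {c v : V}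
    (hc : c ∈ forestChildren par v) : lev c = lev v + 1 := by
  obtain ⟨h1, h2⟩ := h.mem_forestChildren.1 hc
  rw [← h.up c h1, h2]

section
variable (par : V → V)

@[simp] theorem rootedWalks_zero (v : V) : rootedWalks par 0 v = 1 := by rw [rootedWalks]

@[simp] theorem rootedWalks_one (v : V) : rootedWalks par 1 v = 0 := by rw [rootedWalks]

/-- First-return decomposition: step to a child, make an excursion of length `p.1` below it, step
back, and continue with a closed walk of length `p.2`. -/
theorem rootedWalks_add_two (k : ℕ) (v : V) : rootedWalks par (k + 2) v =
    ∑ p ∈ antidiagonal k, childWalks par p.1 v * rootedWalks par p.2 v := by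
  rw [rootedWalks, Finset.Nat.sum_antidiagonal_eq_sum_range_succ
    (fun i j => childWalks par i v * rootedWalks par j v), Finset.sum_range]
  rfl

/-- This parity makes any length at which two counts differ even, which is what strictness at all
large even lengths needs. -/
theorem rootedWalks_odd (k : ℕ) (hk : Odd k) (v : V) : rootedWalks par k v = 0 := by
  induction k using Nat.strong_induction_on generalizing v with
  | _ k ih =>
    match k, hk with
    | 1, _ => simp
    | k + 2, hk =>
      rw [rootedWalks_add_two]
      refine sum_eq_zero fun p hp => ?_
      rw [HasAntidiagonal.mem_antidiagonal] at hp
      rcases Nat.even_or_odd p.1 with h1 | h1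
      · have h2 : Odd p.2 := by
          rw [Nat.odd_iff] at hk ⊢; rw [Nat.even_iff] at h1; omega
        rw [ih p.2 (by omega) h2, mul_zero]
      · rw [childWalks, sum_eq_zero fun c _ => ih p.1 (by omega) h1 c, zero_mul]

theorem childWalks_odd (k : ℕ) (hk : Odd k) (v : V) : childWalks par k v = 0 :=
  sum_eq_zero fun c _ => rootedWalks_odd par k hk c

theorem childWalks_zero (v : V) : childWalks par 0 v = (forestChildren par v).card := by
  simp [childWalks]

end

theorem IsLeveled.sum_levelSet_sum_children {par : V → V} {lev : V → ℕ} (h : IsLeveled par lev)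
    (i : ℕ) (f : V → ℕ) :
    ∑ v ∈ levelSet lev i, ∑ c ∈ forestChildren par v, f c = ∑ c ∈ levelSet lev (i + 1), f c := by
  classical
  rw [← sum_fiberwise_of_maps_to (s := levelSet lev (i + 1)) (t := levelSet lev i) (g := par)]
  · refine sum_congr rfl fun v hv => sum_congr ?_ fun _ _ => rfl
    ext c
    rw [mem_filter, h.mem_forestChildren, mem_levelSet]
    rw [mem_levelSet] at hv
    constructor
    · rintro ⟨h1, h2⟩
      exact ⟨by rw [← h.up c h1, h2, hv], h2⟩
    · rintro ⟨h1, h2⟩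
      exact ⟨by omega, h2⟩
  · intro c hc
    rw [mem_levelSet] at hc ⊢
    have := h.up c (by omega)
    omega

theorem WalkDominates.rootedWalks_le {par : V → V} {v w : V} (h : WalkDominates par v w) (k : ℕ) :
    rootedWalks par k w ≤ rootedWalks par k v := by
  induction k using Nat.strong_induction_on with
  | _ k ih =>
    match k with
    | 0 => simp
    | 1 => simp
    | k + 2 =>
      rw [rootedWalks_add_two, rootedWalks_add_two]
      refine sum_le_sum fun p hp => Nat.mul_le_mul (h _) (ih _ ?_)
      rw [HasAntidiagonal.mem_antidiagonal] at hp
      omega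

theorem WalkDominates.rootedWalks_lt {par : V → V} {v w : V} (h : WalkDominates par v w) {k : ℕ}
    (hk : childWalks par k w < childWalks par k v) :
    rootedWalks par (k + 2) w < rootedWalks par (k + 2) v := by
  rw [rootedWalks_add_two, rootedWalks_add_two]
  refine sum_lt_sum (fun p _ => Nat.mul_le_mul (h _) (h.rootedWalks_le _)) ⟨(k, 0), ?_, ?_⟩
  · simp
  · simpa using hk

section Comparison

variable [LinearOrder V] {P Q : V → V} {lev : V → ℕ}

/-- In the sorted forest the children of an initial segment form an initial segment of the next
level. It is at least as large as the set of `P`-children of any `S` that is no larger, as child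
numbers are non-increasing. -/
theorem majorized_sum_children (hP : IsLeveled P lev) (hQ : IsSortedForest Q lev)
    (hcard : ∀ v, (forestChildren P v).card = (forestChildren Q v).card) {i : ℕ} {a b : V → ℕ}
    (h : Majorized (levelSet lev (i + 1)) a b) :
    Majorized (levelSet lev i) (fun v => ∑ c ∈ forestChildren P v, a c)
      (fun v => ∑ c ∈ forestChildren Q v, b c) := by
  have hmem : ∀ {R : V → V}, IsLeveled R lev → ∀ v ∈ levelSet lev i, ∀ c ∈ forestChildren R v,
      c ∈ levelSet lev (i + 1) := fun hR v hv c hc => by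
    rw [mem_levelSet] at hv ⊢
    rw [hR.lev_of_mem hc, hv]
  constructor
  · intro v hv w hw hvw
    rcases hvw.eq_or_lt with rfl | hlt
    · exact le_rfl
    have hle : ∀ c ∈ forestChildren Q v, ∀ d ∈ forestChildren Q w, b d ≤ b c := fun c hc d hd => by
      have hc' := hmem hQ.toIsLeveled v hv c hc
      have hd' := hmem hQ.toIsLeveled w hw d hd
      refine h.1 hc' hd' ?_
      by_contra hcd
      push Not at hcd
      rw [mem_levelSet] at hc' hd'
      have := hQ.mono d c (by omega) (by omega) hcd.le
      rw [(hQ.mem_forestChildren.1 hc).2, (hQ.mem_forestChildren.1 hd).2] at this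
      exact absurd hlt (not_lt.2 this)
    rw [mem_coe, mem_levelSet] at hv hw
    have hc := hQ.card_anti v w (by omega) hvw
    rcases (forestChildren Q w).eq_empty_or_nonempty with he | hne
    · simp [he]
    · obtain ⟨d, hd, hmax⟩ := exists_max_image _ b hne
      calc ∑ c ∈ forestChildren Q w, b c ≤ (forestChildren Q w).card * b d :=
            sum_le_card_nsmul _ _ _ hmax
        _ ≤ (forestChildren Q v).card * b d := Nat.mul_le_mul_right _ hc
        _ ≤ ∑ c ∈ forestChildren Q v, b c := card_nsmul_le_sum _ _ _ fun c hc => hle c hc d hd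
  · intro S hS I hI hc
    have hdisj : ∀ {R : V → V} (s : Finset V),
        (s : Set V).PairwiseDisjoint (forestChildren R) := fun s x _ y _ hxy => by
      rw [Function.onFun, disjoint_left]
      intro c hc hc'
      exact hxy ((mem_forestChildren.1 hc).2.symm.trans (mem_forestChildren.1 hc').2)
    rw [← sum_biUnion (hdisj S), ← sum_biUnion (hdisj I)]
    refine h.2 _ (fun c hc => ?_) _ ⟨fun c hc => ?_, ?_⟩ ?_
    · obtain ⟨v, hv, hcv⟩ := mem_biUnion.1 hc
      exact hmem hP v (hS hv) c hcv
    · obtain ⟨v, hv, hcv⟩ := mem_biUnion.1 hc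
      exact hmem hQ.toIsLeveled v (hI.1 hv) c hcv
    · intro c hc d hd hdc
      obtain ⟨v, hv, hcv⟩ := mem_biUnion.1 hc
      have hc' := hmem hQ.toIsLeveled v (hI.1 hv) c hcv
      rw [mem_levelSet] at hc' hd
      have hpar := hQ.mono d c (by omega) (by omega) hdc
      rw [(hQ.mem_forestChildren.1 hcv).2] at hpar
      have hup := hQ.up d (by omega)
      refine mem_biUnion.2 ⟨Q d, hI.2 v hv _ ?_ hpar, hQ.mem_forestChildren.2 ⟨by omega, rfl⟩⟩
      rw [mem_levelSet]; omega
    · rw [card_biUnion (hdisj S), card_biUnion (hdisj I), sum_congr rfl fun v _ => hcard v]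
      refine (Majorized.of_antitoneOn fun v hv w hw hvw => ?_).2 S hS I hI hc
      rw [mem_coe, mem_levelSet] at hv hw
      exact hQ.card_anti v w (by omega) hvw

theorem majorized_rootedWalks (hP : IsLeveled P lev) (hQ : IsSortedForest Q lev)
    (hcard : ∀ v, (forestChildren P v).card = (forestChildren Q v).card) (k i : ℕ) :
    Majorized (levelSet lev i) (rootedWalks P k) (rootedWalks Q k) := by
  induction k using Nat.strong_induction_on generalizing i with
  | _ k ih =>
    match k with
    | 0 =>
      rw [funext (rootedWalks_zero P), funext (rootedWalks_zero Q)]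
      exact Majorized.const 1
    | 1 =>
      rw [funext (rootedWalks_one P), funext (rootedWalks_one Q)]
      exact Majorized.const 0
    | k + 2 =>
      have e : ∀ R : V → V, rootedWalks R (k + 2) = fun v =>
          ∑ p ∈ antidiagonal k, childWalks R p.1 v * rootedWalks R p.2 v := fun R =>
        funext fun v => rootedWalks_add_two R k v
      rw [e, e]
      refine Majorized.sum _ fun p hp => ?_
      rw [HasAntidiagonal.mem_antidiagonal] at hp
      exact (majorized_sum_children hP hQ hcard (ih p.1 (by omega) (i + 1))).mul
        (ih p.2 (by omega) i)

theorem majorized_childWalks (hP : IsLeveled P lev) (hQ : IsSortedForest Q lev)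
    (hcard : ∀ v, (forestChildren P v).card = (forestChildren Q v).card) (k i : ℕ) :
    Majorized (levelSet lev i) (childWalks P k) (childWalks Q k) :=
  majorized_sum_children hP hQ hcard (majorized_rootedWalks hP hQ hcard k (i + 1))

/-- The total for length `k + l + 2` splits into products each bounded by its sorted counterpart, so
equality of totals forces equality of each product sum. -/
theorem sum_childWalks_mul_rootedWalks_eq (hP : IsLeveled P lev) (hQ : IsSortedForest Q lev)
    (hcard : ∀ v, (forestChildren P v).card = (forestChildren Q v).card) {i : ℕ}
    (h : ∀ k, ∑ v ∈ levelSet lev i, rootedWalks P k v = ∑ v ∈ levelSet lev i, rootedWalks Q k v)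
    (k l : ℕ) : ∑ v ∈ levelSet lev i, childWalks P k v * rootedWalks P l v =
      ∑ v ∈ levelSet lev i, childWalks Q k v * rootedWalks Q l v := by
  have h2 := h (k + l + 2)
  simp only [rootedWalks_add_two] at h2
  rw [sum_comm, sum_comm (s := levelSet lev i)] at h2
  exact (sum_eq_sum_iff_of_le fun p _ => ((majorized_childWalks hP hQ hcard p.1 i).mul
    (majorized_rootedWalks hP hQ hcard p.2 i)).sum_le).1 h2 (k, l) (by simp)

/-- Expand the second factor at length `l + 2` once more and compare the summand `(l, 0)`, where the
last factor is 1. -/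
theorem sum_childWalks_mul_childWalks_eq (hP : IsLeveled P lev) (hQ : IsSortedForest Q lev)
    (hcard : ∀ v, (forestChildren P v).card = (forestChildren Q v).card) {i : ℕ}
    (h : ∀ k, ∑ v ∈ levelSet lev i, rootedWalks P k v = ∑ v ∈ levelSet lev i, rootedWalks Q k v)
    (k l : ℕ) : ∑ v ∈ levelSet lev i, childWalks P k v * childWalks P l v =
      ∑ v ∈ levelSet lev i, childWalks Q k v * childWalks Q l v := by
  have h2 := sum_childWalks_mul_rootedWalks_eq hP hQ hcard h k (l + 2)
  simp only [rootedWalks_add_two, mul_sum] at h2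
  rw [sum_comm, sum_comm (s := levelSet lev i)] at h2
  simpa using (sum_eq_sum_iff_of_le fun p _ => ((majorized_childWalks hP hQ hcard k i).mul
    ((majorized_childWalks hP hQ hcard p.1 i).mul
      (majorized_rootedWalks hP hQ hcard p.2 i))).sum_le).1 h2 (l, 0) (by simp)

/-- Equality moves down one level at a time: the case `l = 0` above equates the child sums, which
are the totals on the next level. -/
theorem sum_rootedWalks_eq_of_le (hP : IsLeveled P lev) (hQ : IsSortedForest Q lev)
    (hcard : ∀ v, (forestChildren P v).card = (forestChildren Q v).card) {i j : ℕ} (hij : i ≤ j)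
    (h : ∀ k, ∑ v ∈ levelSet lev i, rootedWalks P k v = ∑ v ∈ levelSet lev i, rootedWalks Q k v)
    (k : ℕ) : ∑ v ∈ levelSet lev j, rootedWalks P k v = ∑ v ∈ levelSet lev j, rootedWalks Q k v := by
  induction j, hij using Nat.le_induction generalizing k with
  | base => exact h k
  | succ j _ ih =>
    rw [← hP.sum_levelSet_sum_children, ← hQ.sum_levelSet_sum_children]
    simpa [childWalks] using sum_childWalks_mul_rootedWalks_eq hP hQ hcard ih k 0

/-- Incomparable vertices would be ordered oppositely at two lengths, which extremality of the
product sum excludes. -/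
theorem walkDominates_total (hP : IsLeveled P lev) (hQ : IsSortedForest Q lev)
    (hcard : ∀ v, (forestChildren P v).card = (forestChildren Q v).card) {i : ℕ}
    (h : ∀ k l, ∑ v ∈ levelSet lev i, childWalks P k v * childWalks P l v =
      ∑ v ∈ levelSet lev i, childWalks Q k v * childWalks Q l v)
    {v w : V} (hv : lev v = i) (hw : lev w = i) : WalkDominates P v w ∨ WalkDominates P w v := by
  by_contra hc
  push Not at hc
  obtain ⟨h1, h2⟩ := hc
  simp only [WalkDominates, not_forall, not_le] at h1 h2
  obtain ⟨k, hk⟩ := h1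
  obtain ⟨l, hl⟩ := h2
  have := (majorized_childWalks hP hQ hcard k i).monovary_of_sum_mul_eq
    (majorized_childWalks hP hQ hcard l i) (h k l) (mem_levelSet.2 hv) (mem_levelSet.2 hw) hk
  omega

/-- If `d` were ahead of `c` at some length, exchanging their counts would move weight from the
smaller child sum to the larger one and raise the sum of squares, already as large as majorization
allows. -/
theorem WalkDominates.children (hP : IsLeveled P lev) (hQ : IsSortedForest Q lev)
    (hcard : ∀ v, (forestChildren P v).card = (forestChildren Q v).card) {i : ℕ}
    (h : ∀ k l, ∑ v ∈ levelSet lev i, childWalks P k v * childWalks P l v =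
      ∑ v ∈ levelSet lev i, childWalks Q k v * childWalks Q l v)
    (htot : ∀ c d, lev c = i + 1 → lev d = i + 1 → WalkDominates P c d ∨ WalkDominates P d c)
    {v w c d : V} (hv : lev v = i) (hw : lev w = i) (hvw : v ≠ w) (hdom : WalkDominates P v w)
    (hc : c ∈ forestChildren P v) (hd : d ∈ forestChildren P w) : WalkDominates P c d := by
  have hci : lev c = i + 1 := by rw [hP.lev_of_mem hc, hv]
  have hdi : lev d = i + 1 := by rw [hP.lev_of_mem hd, hw]
  by_contra hcd
  have hdc := (htot c d hci hdi).resolve_left hcd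
  simp only [WalkDominates, not_forall, not_le] at hcd
  obtain ⟨j, hj⟩ := hcd
  have hlt := hdc.rootedWalks_lt hj
  set W := rootedWalks P (j + 2) with hW
  have hmaj := majorized_sum_children hP hQ hcard ((majorized_rootedWalks hP hQ hcard (j + 2)
    (i + 1)).comp_swap (mem_levelSet.2 hci) (mem_levelSet.2 hdi))
  have hle := (hmaj.mul hmaj).sum_le
  rw [← hW] at hle
  set A' : V → ℕ := fun x => ∑ y ∈ forestChildren P x, W (Equiv.swap c d y) with hA'
  have hle2 : ∑ x ∈ levelSet lev i, A' x * A' x ≤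
      ∑ x ∈ levelSet lev i, childWalks P (j + 2) x * childWalks P (j + 2) x := hle.trans_eq (h _ _).symm
  have hpc := (mem_forestChildren.1 hc).2
  have hpd := (mem_forestChildren.1 hd).2
  have hcw : c ∉ forestChildren P w := fun h' => hvw (hpc.symm.trans (mem_forestChildren.1 h').2)
  have hdv : d ∉ forestChildren P v := fun h' =>
    hvw ((mem_forestChildren.1 h').2.symm.trans hpd)
  have hA1 : A' v + W c = childWalks P (j + 2) v + W d := by
    simp only [hA', childWalks, ← hW]
    rw [← add_sum_erase _ _ hc, ← add_sum_erase _ W hc, Equiv.swap_apply_left]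
    have : ∑ y ∈ (forestChildren P v).erase c, W (Equiv.swap c d y) =
        ∑ y ∈ (forestChildren P v).erase c, W y := sum_congr rfl fun y hy => by
      rw [mem_erase] at hy
      rw [Equiv.swap_apply_of_ne_of_ne hy.1 (ne_of_mem_of_not_mem hy.2 hdv)]
    omega
  have hA2 : A' w + W d = childWalks P (j + 2) w + W c := by
    simp only [hA', childWalks, ← hW]
    rw [← add_sum_erase _ _ hd, ← add_sum_erase _ W hd, Equiv.swap_apply_right]
    have : ∑ y ∈ (forestChildren P w).erase d, W (Equiv.swap c d y) =
        ∑ y ∈ (forestChildren P w).erase d, W y := sum_congr rfl fun y hy => by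
      rw [mem_erase] at hy
      rw [Equiv.swap_apply_of_ne_of_ne (ne_of_mem_of_not_mem hy.2 hcw) hy.1]
    omega
  have split : ∀ f : V → ℕ, ∑ x ∈ levelSet lev i, f x =
      f v + (f w + ∑ x ∈ ((levelSet lev i).erase v).erase w, f x) := fun f => by
    rw [← add_sum_erase _ f (mem_levelSet.2 hv), ← add_sum_erase _ f
      (mem_erase.2 ⟨hvw.symm, mem_levelSet.2 hw⟩)]
  have hrest : ∑ x ∈ ((levelSet lev i).erase v).erase w, A' x * A' x =
      ∑ x ∈ ((levelSet lev i).erase v).erase w,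
        childWalks P (j + 2) x * childWalks P (j + 2) x := sum_congr rfl fun x hx => by
    simp only [mem_erase] at hx
    have : A' x = childWalks P (j + 2) x := sum_congr rfl fun y hy => by
      have hy' := (mem_forestChildren.1 hy).2
      rw [Equiv.swap_apply_of_ne_of_ne]
      · rintro rfl; exact hx.2.1 (hy'.symm.trans hpc)
      · rintro rfl; exact hx.1 (hy'.symm.trans hpd)
    rw [this]
  rw [split, split (fun x => childWalks P (j + 2) x * childWalks P (j + 2) x), hrest] at hle2
  -- With δ the positive gap of `W` between `d` and `c`, the sum of squares grows by 2δ(δ + A(v) -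
  -- A(w)), where A counts the child walks of length `j + 2` and A(v) ≥ A(w).
  have hvw2 := hdom (j + 2)
  nlinarith

end Comparison

end RootedForests

/-! ### Closed walks through determinants -/

section TraceFormula

open Finset PowerSeries Matrix

variable {V : Type*} [Fintype V]

open Classical in
theorem spectralMoment_eq_numClosedWalks (G : SimpleGraph V) (k : ℕ) :
    spectralMoment G k = (numClosedWalks G k : ℝ) := by
  have hA : (G.adjMatrix ℝ).IsHermitian :=
    (Matrix.conjTranspose_eq_transpose_of_trivial _).trans G.transpose_adjMatrix
  have h1 : ((G.adjMatrix ℝ) ^ k).trace = (numClosedWalks G k : ℝ) := by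
    simp only [Matrix.trace, Matrix.diag, numClosedWalks]
    push_cast
    refine sum_congr rfl fun v _ => ?_
    rw [SimpleGraph.adjMatrix_pow_apply_eq_card_walk, SimpleGraph.card_set_walk_length_eq]
  rw [← h1]
  have h2 := congrArg (fun M => (M ^ k).trace) hA.spectral_theorem
  rw [← map_pow, Unitary.conjStarAlgAut_apply, mul_assoc, Matrix.trace_mul_comm, mul_assoc] at h2
  rw [h2, Unitary.coe_star_mul_self, mul_one, Matrix.diagonal_pow, Matrix.trace_diagonal]
  simp [spectralMoment]

/-- Logarithmic derivative of a product, with denominators cleared. -/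
theorem prod_mul_sum_eq_neg_X_mul_derivative {ι : Type*} (s : Finset ι) (q m : ι → ℝ⟦X⟧)
    (h : ∀ i ∈ s, q i * m i = -(X * d⁄dX ℝ (q i))) :
    (∏ i ∈ s, q i) * ∑ i ∈ s, m i = -(X * d⁄dX ℝ (∏ i ∈ s, q i)) := by
  classical
  induction s using Finset.induction_on with
  | empty => simp
  | insert i s hi ih =>
    rw [prod_insert hi, sum_insert hi, Derivation.leibniz, smul_eq_mul, smul_eq_mul]
    linear_combination (∏ i ∈ s, q i) * h i (mem_insert_self _ _) +
      q i * ih fun j hj => h j (mem_insert_of_mem hj)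

open Classical in
theorem det_one_sub_X_smul_eq_prod_eigenvalues {A : Matrix V V ℝ} (hA : A.IsHermitian) :
    (1 - (X : ℝ⟦X⟧) • A.map C).det = ∏ i, (1 - C (hA.eigenvalues i) * X) := by
  set U : Matrix V V ℝ := (hA.eigenvectorUnitary : Matrix V V ℝ) with hU
  set W : Matrix V V ℝ := star U with hW
  have hUW : U * W = 1 := Unitary.coe_mul_star_self hA.eigenvectorUnitary
  have hA' : A = U * diagonal hA.eigenvalues * W := by
    have h2 := hA.spectral_theorem
    rw [Unitary.conjStarAlgAut_apply] at h2
    exact h2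
  have hUW' : U.map (C : ℝ →+* ℝ⟦X⟧) * W.map C = 1 := by
    rw [← Matrix.map_mul, hUW]
    simp
  have : (1 - (X : ℝ⟦X⟧) • A.map C) = U.map C *
      diagonal (fun i => 1 - C (hA.eigenvalues i) * (X : ℝ⟦X⟧)) * W.map C := by
    have hd : diagonal (fun i => 1 - C (hA.eigenvalues i) * (X : ℝ⟦X⟧)) =
        1 - (X : ℝ⟦X⟧) • (diagonal hA.eigenvalues).map C := by
      ext i j : 1
      by_cases hij : i = j
      · subst hij; simp [mul_comm]
      · simp [hij]
    rw [hd, mul_sub, sub_mul, mul_one, hUW', mul_smul_comm, smul_mul_assoc, ← Matrix.map_mul,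
      ← Matrix.map_mul, ← hA']
  rw [this, det_mul, det_mul, mul_right_comm, ← det_mul, hUW', det_one, one_mul, det_diagonal]

-- The determinant is the product of the factors 1 - λX, and -X times the logarithmic derivative of
-- one factor is the series of λ^k over k ≥ 1. Subtracting the number of vertices removes the terms
-- k = 0.
open Classical in
theorem det_mul_spectralMoment_series (G : SimpleGraph V) :
    (1 - (X : ℝ⟦X⟧) • (G.adjMatrix ℝ).map C).det *
      (PowerSeries.mk (spectralMoment G) - (Fintype.card V : ℝ⟦X⟧)) =
    -(X * d⁄dX ℝ (1 - (X : ℝ⟦X⟧) • (G.adjMatrix ℝ).map C).det) := by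
  have hA : (G.adjMatrix ℝ).IsHermitian :=
    (Matrix.conjTranspose_eq_transpose_of_trivial _).trans G.transpose_adjMatrix
  rw [det_one_sub_X_smul_eq_prod_eigenvalues hA]
  have hgeom : ∀ c : ℝ, (1 - C c * (X : ℝ⟦X⟧)) * PowerSeries.mk (fun k => c ^ k) = 1 := fun c => by
    ext n
    rw [sub_mul, one_mul, mul_assoc, map_sub, coeff_C_mul]
    cases n with
    | zero => simp
    | succ n => rw [coeff_succ_X_mul]; simp [coeff_one, pow_succ']
  rw [← prod_mul_sum_eq_neg_X_mul_derivative univ _ (fun i => PowerSeries.mk (fun k => hA.eigenvalues i ^ k) - 1)]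
  · congr 1
    rw [sum_sub_distrib]
    congr 1
    · ext k
      simp [spectralMoment, map_sum]
    · simp
  · intro i _
    rw [mul_sub, hgeom, map_sub, Derivation.leibniz]
    simp [mul_comm]

/-- The generating function of `rootedWalks`. -/
noncomputable def walkSeries (par : V → V) (v : V) : ℝ⟦X⟧ :=
  PowerSeries.mk fun k => (rootedWalks par k v : ℝ)

/-- The generating function of `childWalks`. -/
noncomputable def childSeries (par : V → V) (v : V) : ℝ⟦X⟧ :=
  PowerSeries.mk fun k => (childWalks par k v : ℝ)

theorem childSeries_eq_sum (par : V → V) (v : V) :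
    childSeries par v = ∑ c ∈ forestChildren par v, walkSeries par c := by
  ext k
  simp [childSeries, walkSeries, childWalks, map_sum]

theorem walkSeries_eq (par : V → V) (v : V) :
    walkSeries par v = 1 + X ^ 2 * (childSeries par v * walkSeries par v) := by
  ext k
  match k with
  | 0 => simp [walkSeries]
  | 1 => simp [walkSeries, coeff_X_pow_mul', coeff_one]
  | k + 2 =>
    rw [map_add, coeff_X_pow_mul, coeff_mul, walkSeries, coeff_mk, rootedWalks_add_two, coeff_one]
    simp [childSeries]

theorem one_sub_mul_walkSeries (par : V → V) (v : V) :
    (1 - X ^ 2 * childSeries par v) * walkSeries par v = 1 := by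
  linear_combination walkSeries_eq par v

/-- The graph of the rooted forest with parent map `par`. -/
def parGraph (par : V → V) : SimpleGraph V where
  Adj v w := v ≠ w ∧ (par v = w ∨ par w = v)
  symm := ⟨fun _ _ h => ⟨h.1.symm, h.2.symm⟩⟩
  loopless := ⟨fun _ h => h.1 rfl⟩

theorem parGraph_adj {par : V → V} {v w : V} :
    (parGraph par).Adj v w ↔ v ∈ forestChildren par w ∨ w ∈ forestChildren par v := by
  simp only [parGraph, mem_forestChildren]
  tauto

-- Gaussian elimination from the leaves upward gives 1 - XA = LΔLᵀ, with L unitriangular along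
-- `rank` and Δ carrying the pivots.
open Classical in
theorem det_parGraph {par : V → V} {rank : V → ℕ} (hr : ∀ v, par v ≠ v → rank (par v) < rank v) :
    (1 - (X : ℝ⟦X⟧) • ((parGraph par).adjMatrix ℝ).map C).det =
      ∏ v, (1 - X ^ 2 * childSeries par v) := by
  have hrank : ∀ {c v}, c ∈ forestChildren par v → rank v < rank c := fun {c v} h => by
    obtain ⟨h1, h2⟩ := mem_forestChildren.1 h
    have := hr c (by rw [h2]; exact h1.symm)
    rwa [h2] at this
  set P : Matrix V V ℝ⟦X⟧ := Matrix.of fun v w => if v ∈ forestChildren par w then 1 else 0 with hP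
  set F : Matrix V V ℝ⟦X⟧ := diagonal (walkSeries par) with hF
  set Δ : Matrix V V ℝ⟦X⟧ := diagonal (fun v => 1 - X ^ 2 * childSeries par v) with hΔ
  have hA : ((parGraph par).adjMatrix ℝ).map C = P + Pᵀ := by
    ext v w : 1
    simp only [Matrix.map_apply, SimpleGraph.adjMatrix_apply, parGraph_adj, Matrix.add_apply, hP,
      Matrix.of_apply, Matrix.transpose_apply]
    by_cases h1 : v ∈ forestChildren par w
    · have h2 : w ∉ forestChildren par v := fun h2 => absurd (hrank h1) (hrank h2).le.not_gt
      simp [h1, h2]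
    · by_cases h2 : w ∈ forestChildren par v <;> simp [h1, h2]
  have hΔF : Δ * F = 1 := by
    rw [hΔ, hF, diagonal_mul_diagonal, ← diagonal_one]
    exact congrArg diagonal (funext fun v => one_sub_mul_walkSeries par v)
  have hFΔ : F * Δ = 1 := by
    rw [hΔ, hF, diagonal_mul_diagonal, ← diagonal_one]
    exact congrArg diagonal (funext fun v => by rw [mul_comm]; exact one_sub_mul_walkSeries par v)
  -- Distinct vertices have no child in common, so the off-diagonal entries vanish.
  have hPFP : Pᵀ * F * P = diagonal (childSeries par) := by
    ext v w : 1
    rw [hF, Matrix.mul_apply]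
    simp only [Matrix.mul_diagonal, Matrix.transpose_apply, hP, Matrix.of_apply, diagonal_apply]
    split_ifs with hvw
    · subst hvw
      rw [childSeries_eq_sum]
      simp
    · refine sum_eq_zero fun x _ => ?_
      by_cases h1 : x ∈ forestChildren par v
      · have h2 : x ∉ forestChildren par w := fun h2 =>
          hvw ((mem_forestChildren.1 h1).2.symm.trans (mem_forestChildren.1 h2).2)
        simp [h2]
      · simp [h1]
  set L : Matrix V V ℝ⟦X⟧ := 1 - (X : ℝ⟦X⟧) • (Pᵀ * F) with hL
  have hLT : Lᵀ = 1 - (X : ℝ⟦X⟧) • (F * P) := by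
    rw [hL, transpose_sub, transpose_one, transpose_smul, transpose_mul, transpose_transpose, hF,
      diagonal_transpose]
  have hfac : 1 - (X : ℝ⟦X⟧) • (P + Pᵀ) = L * Δ * Lᵀ := by
    have hΔ' : Δ = 1 - (X : ℝ⟦X⟧) • ((X : ℝ⟦X⟧) • (Pᵀ * F * P)) := by
      rw [hPFP, hΔ]
      ext v w : 1
      by_cases hvw : v = w
      · subst hvw; simp; ring
      · simp [hvw]
    have e : L * Δ * Lᵀ = Δ - (X : ℝ⟦X⟧) • (P + Pᵀ) + (X : ℝ⟦X⟧) • ((X : ℝ⟦X⟧) • (Pᵀ * F * P)) := by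
      rw [hLT, hL]
      simp only [sub_mul, mul_sub, one_mul, mul_one, smul_mul_assoc, mul_smul_comm, smul_add, smul_sub]
      have e1 : Pᵀ * F * Δ = Pᵀ := by rw [mul_assoc, hFΔ, mul_one]
      have e2 : Δ * (F * P) = P := by rw [← mul_assoc, hΔF, one_mul]
      rw [e1, e2, ← mul_assoc (Pᵀ) F P]
      abel
    rw [e]
    nth_rewrite 1 [hΔ']
    abel
  have hdetL : L.det = 1 := by
    have hentry : ∀ v w, (Pᵀ * F) v w = if w ∈ forestChildren par v then walkSeries par w else 0 :=
      fun v w => by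
        rw [hF]; simp [Matrix.mul_diagonal, hP]
    have hbt : L.BlockTriangular rank := fun v w hwv => by
      have hne : v ≠ w := by rintro rfl; exact lt_irrefl _ hwv
      have : w ∉ forestChildren par v := fun h => absurd (hrank h) hwv.le.not_gt
      rw [hL, Matrix.sub_apply, Matrix.smul_apply, hentry, if_neg this, Matrix.one_apply_ne hne]
      simp
    rw [hbt.det]
    refine prod_eq_one fun a _ => ?_
    have : L.toSquareBlock rank a = 1 := by
      ext ⟨v, hv⟩ ⟨w, hw⟩ : 1
      have : w ∉ forestChildren par v := fun h => by have := hrank h; omega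
      rw [toSquareBlock_def, Matrix.of_apply, hL, Matrix.sub_apply, Matrix.smul_apply, hentry,
        if_neg this]
      simp [Matrix.one_apply]
    rw [this, det_one]
  rw [hA, hfac, det_mul, det_mul, det_transpose, hdetL, one_mul, mul_one, hΔ, det_diagonal]

/-- Closed walks in a rooted forest, sorted by the highest vertex that they visit. -/
theorem spectralMoment_series_parGraph {par : V → V} {rank : V → ℕ}
    (hr : ∀ v, par v ≠ v → rank (par v) < rank v) :
    PowerSeries.mk (spectralMoment (parGraph par)) = (Fintype.card V : ℝ⟦X⟧) +
      ∑ v, X * d⁄dX ℝ (X ^ 2 * childSeries par v) * walkSeries par v := by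
  have h1 := det_mul_spectralMoment_series (parGraph par)
  rw [det_parGraph hr] at h1
  have h2 := prod_mul_sum_eq_neg_X_mul_derivative univ (fun v => 1 - X ^ 2 * childSeries par v)
    (fun v => X * d⁄dX ℝ (X ^ 2 * childSeries par v) * walkSeries par v) (fun v _ => by
      rw [map_sub, Derivation.map_one_eq_zero]
      linear_combination X * d⁄dX ℝ (X ^ 2 * childSeries par v) * one_sub_mul_walkSeries par v)
  have hne : (∏ v, (1 - X ^ 2 * childSeries par v)) ≠ 0 :=
    prod_ne_zero_iff.2 fun v _ h0 => by
      have := one_sub_mul_walkSeries par v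
      rw [h0, zero_mul] at this
      exact zero_ne_one this
  have h3 := mul_left_cancel₀ hne (h1.trans h2.symm)
  rw [← h3]
  ring

end TraceFormula

/-! ### Coefficientwise inequalities between resolvents -/

section CoefficientwiseOrder

open Finset PowerSeries

/-- The coefficientwise order on power series. -/
def CoeffLE (P Q : ℝ⟦X⟧) : Prop := ∀ n, coeff n P ≤ coeff n Q

namespace CoeffLE

variable {P P' Q Q' R S Z : ℝ⟦X⟧}

theorem refl (P : ℝ⟦X⟧) : CoeffLE P P := fun _ => le_rfl

theorem trans (h : CoeffLE P Q) (h' : CoeffLE Q R) : CoeffLE P R := fun n => (h n).trans (h' n)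

theorem antisymm (h : CoeffLE P Q) (h' : CoeffLE Q P) : P = Q :=
  PowerSeries.ext fun n => le_antisymm (h n) (h' n)

theorem sub_nonneg : CoeffLE 0 (Q - P) ↔ CoeffLE P Q := by
  simp [CoeffLE]

theorem add (h : CoeffLE P Q) (h' : CoeffLE P' Q') : CoeffLE (P + P') (Q + Q') := fun n => by
  rw [map_add, map_add]; exact add_le_add (h n) (h' n)

theorem mul (hP : CoeffLE 0 P) (h : CoeffLE P P') (hQ : CoeffLE 0 Q) (h' : CoeffLE Q Q') :
    CoeffLE (P * Q) (P' * Q') := fun n => by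
  rw [coeff_mul, coeff_mul]
  exact sum_le_sum fun p _ => mul_le_mul (h _) (h' _) (by simpa using hQ p.2)
    ((by simpa using hP p.1 : (0 : ℝ) ≤ coeff p.1 P).trans (h _))

theorem mul_nonneg (hP : CoeffLE 0 P) (hQ : CoeffLE 0 Q) : CoeffLE 0 (P * Q) := by
  simpa using mul (refl 0) hP (refl 0) hQ

theorem one_nonneg : CoeffLE 0 1 := fun n => by
  rw [coeff_one]; split_ifs <;> simp

theorem X_nonneg : CoeffLE 0 X := fun n => by
  rw [coeff_X]; split_ifs <;> simp

theorem X_pow_nonneg (k : ℕ) : CoeffLE 0 (X ^ k) := fun n => by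
  rw [coeff_X_pow]; split_ifs <;> simp

theorem derivative (h : CoeffLE P Q) : CoeffLE (d⁄dX ℝ P) (d⁄dX ℝ Q) := fun n => by
  rw [coeff_derivative, coeff_derivative]
  exact mul_le_mul_of_nonneg_right (h _) (by positivity)

theorem derivative_nonneg (h : CoeffLE 0 P) : CoeffLE 0 (d⁄dX ℝ P) := by
  simpa using h.derivative

theorem le_mul_of_one_le_left (hQ : CoeffLE 0 Q) (h : CoeffLE 1 P) : CoeffLE Q (P * Q) := by
  simpa using mul one_nonneg h hQ (refl Q)

theorem le_mul_of_one_le_right (hQ : CoeffLE 0 Q) (h : CoeffLE 1 P) : CoeffLE Q (Q * P) := by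
  rw [mul_comm]; exact le_mul_of_one_le_left hQ h

/-- The factor `X ^ 2` makes each coefficient of `S` depend only on earlier ones. -/
theorem nonneg_of_eq_add (h : S = R + X ^ 2 * (Z * S)) (hR : CoeffLE 0 R) (hZ : CoeffLE 0 Z) :
    CoeffLE 0 S := fun n => by
  induction n using Nat.strong_induction_on with
  | _ n ih =>
    rw [h, map_add, coeff_X_pow_mul', map_zero]
    refine add_nonneg (by simpa using hR n) ?_
    split_ifs with hn
    · rw [coeff_mul]
      refine sum_nonneg fun p hp => _root_.mul_nonneg (by simpa using hZ p.1) ?_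
      rw [HasAntidiagonal.mem_antidiagonal] at hp
      simpa using ih p.2 (by omega)
    · exact le_rfl

theorem le_of_eq_add (h : S = R + X ^ 2 * (Z * S)) (hR : CoeffLE 0 R) (hZ : CoeffLE 0 Z) :
    CoeffLE R S := by
  have h1 := nonneg_of_eq_add h hR hZ
  rw [← sub_nonneg]
  have e : S - R = X ^ 2 * (Z * S) := by linear_combination h
  rw [e]
  exact mul_nonneg (X_pow_nonneg 2) (mul_nonneg hZ h1)

end CoeffLE

section Resolvent

variable {A A' F F' : ℝ⟦X⟧}

theorem CoeffLE.one_le_resolvent (hA : CoeffLE 0 A) (hF : (1 - X ^ 2 * A) * F = 1) :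
    CoeffLE 1 F :=
  CoeffLE.le_of_eq_add (Z := A) (by linear_combination hF) CoeffLE.one_nonneg hA

/-- The difference D = F' - F satisfies D = X²(A' - A)F + X²A'D, and F is at least 1. -/
theorem CoeffLE.resolvent_sub (hA : CoeffLE 0 A) (h : CoeffLE A A')
    (hF : (1 - X ^ 2 * A) * F = 1) (hF' : (1 - X ^ 2 * A') * F' = 1) :
    CoeffLE (X ^ 2 * (A' - A)) (F' - F) := by
  have h0 := CoeffLE.sub_nonneg.2 h
  have h1 := CoeffLE.one_le_resolvent hA hF
  have h2 := CoeffLE.one_nonneg.trans h1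
  have h3 := CoeffLE.le_of_eq_add (S := F' - F) (R := X ^ 2 * ((A' - A) * F)) (Z := A')
    (by linear_combination hF' - hF)
    (CoeffLE.mul_nonneg (CoeffLE.X_pow_nonneg 2) (CoeffLE.mul_nonneg h0 h2)) (hA.trans h)
  exact (CoeffLE.mul (CoeffLE.X_pow_nonneg 2) (CoeffLE.refl _) h0
    (CoeffLE.le_mul_of_one_le_right h0 h1)).trans h3

theorem CoeffLE.resolvent_le (hA : CoeffLE 0 A) (h : CoeffLE A A')
    (hF : (1 - X ^ 2 * A) * F = 1) (hF' : (1 - X ^ 2 * A') * F' = 1) : CoeffLE F F' :=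
  CoeffLE.sub_nonneg.1 ((CoeffLE.mul_nonneg (CoeffLE.X_pow_nonneg 2)
    (CoeffLE.sub_nonneg.2 h)).trans (CoeffLE.resolvent_sub hA h hF hF'))

theorem exists_resolvent (A : ℝ⟦X⟧) : ∃ F, (1 - X ^ 2 * A) * F = 1 :=
  ⟨(1 - X ^ 2 * A)⁻¹, PowerSeries.mul_inv_cancel _ (by simp)⟩

theorem resolvent_mul_sub {A₁ A₂ A₁' A₂' F₁ F₂ F₁' F₂' : ℝ⟦X⟧} (h₁ : CoeffLE 0 A₁)
    (h₂ : CoeffLE 0 A₂) (h₁' : CoeffLE A₁ A₁') (h₂' : CoeffLE A₂ A₂')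
    (hF₁ : (1 - X ^ 2 * A₁) * F₁ = 1) (hF₂ : (1 - X ^ 2 * A₂) * F₂ = 1)
    (hF₁' : (1 - X ^ 2 * A₁') * F₁' = 1) (hF₂' : (1 - X ^ 2 * A₂') * F₂' = 1) :
    CoeffLE (X ^ 2 * (A₁' + A₂' - A₁ - A₂)) (F₁' * F₂' - F₁ * F₂) := by
  have e1 := CoeffLE.resolvent_sub h₁ h₁' hF₁ hF₁'
  have e2 := CoeffLE.resolvent_sub h₂ h₂' hF₂ hF₂'
  have p1 := CoeffLE.sub_nonneg.2 (CoeffLE.resolvent_le h₁ h₁' hF₁ hF₁')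
  have p2 := CoeffLE.sub_nonneg.2 (CoeffLE.resolvent_le h₂ h₂' hF₂ hF₂')
  have g1 := e1.trans (CoeffLE.le_mul_of_one_le_right p1 (CoeffLE.one_le_resolvent h₂ hF₂))
  have g2 := e2.trans (CoeffLE.le_mul_of_one_le_right p2
    (CoeffLE.one_le_resolvent (h₁.trans h₁') hF₁'))
  convert! g1.add g2 using 1 <;> ring

/-- Of two pairs of series with the same sum `2 * s`, the one that is farther apart has the larger
product of resolvents. -/
theorem resolvent_mul_spread {s e e' H H' : ℝ⟦X⟧} (hs : CoeffLE 0 s)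
    (he : ∀ n, |coeff n e| ≤ coeff n e') (hH0 : CoeffLE 1 H)
    (hH : (1 - X ^ 2 * (s + e)) * (1 - X ^ 2 * (s - e)) * H = 1)
    (hH' : (1 - X ^ 2 * (s + e')) * (1 - X ^ 2 * (s - e')) * H' = 1) :
    CoeffLE (X ^ 4 * (e' * e' - e * e)) (H' - H) := by
  obtain ⟨K, hK⟩ := exists_resolvent s
  have hK1 := CoeffLE.one_le_resolvent hs hK
  have hK0 := CoeffLE.one_nonneg.trans hK1
  have he0 : CoeffLE 0 e' := fun n => by simpa using (abs_nonneg _).trans (he n)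
  have hsq : CoeffLE 0 (e' * e' - e * e) := CoeffLE.sub_nonneg.2 fun n => by
    rw [coeff_mul, coeff_mul]
    refine sum_le_sum fun p _ => (le_abs_self _).trans ?_
    rw [abs_mul]
    exact mul_le_mul (he _) (he _) (abs_nonneg _) (by simpa using he0 p.1)
  have hK2 : CoeffLE 1 (K * K) := hK1.trans (CoeffLE.le_mul_of_one_le_left hK0 hK1)
  have hK20 := CoeffLE.one_nonneg.trans hK2
  -- The product of the two factors is (1 - X²s)² - X⁴e², and `K` inverts 1 - X²s.
  have e1 : H = K * K + K * K * X ^ 4 * (e * e) * H := by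
    linear_combination (K * K) * hH - H * (K * (1 - X ^ 2 * s) + 1) * hK
  have e1' : H' = K * K + K * K * X ^ 4 * (e' * e') * H' := by
    linear_combination (K * K) * hH' - H' * (K * (1 - X ^ 2 * s) + 1) * hK
  have h1 := CoeffLE.le_of_eq_add (S := H' - H) (R := K * K * (X ^ 4 * (e' * e' - e * e) * H))
    (Z := X ^ 2 * (K * K * (e' * e'))) (by linear_combination e1' - e1) ?_ ?_
  · have h2 := CoeffLE.mul_nonneg (CoeffLE.X_pow_nonneg 4) hsq
    have h3 := CoeffLE.le_mul_of_one_le_right h2 hH0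
    exact (h3.trans (CoeffLE.le_mul_of_one_le_left (h2.trans h3) hK2)).trans h1
  · exact CoeffLE.mul_nonneg hK20 (CoeffLE.mul_nonneg (CoeffLE.mul_nonneg (CoeffLE.X_pow_nonneg 4)
      hsq) (CoeffLE.one_nonneg.trans hH0))
  · exact CoeffLE.mul_nonneg (CoeffLE.X_pow_nonneg 2) (CoeffLE.mul_nonneg hK20
      (CoeffLE.mul_nonneg he0 he0))

theorem exists_intermediate_pair {a₁ a₂ b₁ b₂ : ℝ} (h₁ : a₁ ≤ b₁) (h₂ : a₂ ≤ b₁)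
    (hs : a₁ + a₂ ≤ b₁ + b₂) (hb : b₂ ≤ b₁) :
    ∃ e : ℝ, a₁ ≤ (b₁ + b₂) / 2 + e ∧ a₂ ≤ (b₁ + b₂) / 2 - e ∧ |e| ≤ (b₁ - b₂) / 2 := by
  rcases le_total a₁ b₂ with h | h
  -- The dominating pair is (b₂, b₁) here, and (a₁, b₁ + b₂ - a₁) in the other case.
  · exact ⟨-((b₁ - b₂) / 2), by linarith, by linarith, by
      rw [abs_neg, abs_of_nonneg (by linarith)]⟩
  · exact ⟨a₁ - (b₁ + b₂) / 2, by linarith, by linarith, abs_le.2 ⟨by linarith, by linarith⟩⟩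

/-- Pass from (A₁, A₂) to (B₁, B₂) through a pair `s + e`, `s - e`, chosen coefficient by
coefficient: it dominates the first pair and is a less spread pair with the sum of the second. Both
steps increase the product of resolvents with an explicit lower bound, so equality annihilates both
increments. -/
theorem resolvent_mul_le_of_majorized {A₁ A₂ B₁ B₂ F₁ F₂ G₁ G₂ : ℝ⟦X⟧} (h₁ : CoeffLE 0 A₁)
    (h₂ : CoeffLE 0 A₂) (h₁' : CoeffLE A₁ B₁) (h₂' : CoeffLE A₂ B₁)
    (hs : CoeffLE (A₁ + A₂) (B₁ + B₂)) (hB : CoeffLE B₂ B₁)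
    (hF₁ : (1 - X ^ 2 * A₁) * F₁ = 1) (hF₂ : (1 - X ^ 2 * A₂) * F₂ = 1)
    (hG₁ : (1 - X ^ 2 * B₁) * G₁ = 1) (hG₂ : (1 - X ^ 2 * B₂) * G₂ = 1) :
    CoeffLE (F₁ * F₂) (G₁ * G₂) ∧ (F₁ * F₂ = G₁ * G₂ → A₁ + A₂ = B₁ + B₂ ∧
      ∀ k l, coeff k A₁ * coeff l A₁ + coeff k A₂ * coeff l A₂ =
        coeff k B₁ * coeff l B₁ + coeff k B₂ * coeff l B₂) := by
  have hex : ∀ n, ∃ e : ℝ, coeff n A₁ ≤ (coeff n B₁ + coeff n B₂) / 2 + e ∧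
      coeff n A₂ ≤ (coeff n B₁ + coeff n B₂) / 2 - e ∧ |e| ≤ (coeff n B₁ - coeff n B₂) / 2 :=
    fun n => exists_intermediate_pair (h₁' n) (h₂' n) (by simpa using hs n) (hB n)
  choose c hc₁ hc₂ hc using hex
  set s : ℝ⟦X⟧ := PowerSeries.mk fun n => (coeff n B₁ + coeff n B₂) / 2 with hs_def
  set e : ℝ⟦X⟧ := PowerSeries.mk c with he_def
  set e' : ℝ⟦X⟧ := PowerSeries.mk fun n => (coeff n B₁ - coeff n B₂) / 2 with he'_def
  have hB₁ : B₁ = s + e' := PowerSeries.ext fun n => by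
    rw [map_add, hs_def, he'_def, coeff_mk, coeff_mk]; ring
  have hB₂ : B₂ = s - e' := PowerSeries.ext fun n => by
    rw [map_sub, hs_def, he'_def, coeff_mk, coeff_mk]; ring
  have hA₁ : CoeffLE A₁ (s + e) := fun n => by
    rw [map_add, hs_def, he_def, coeff_mk, coeff_mk]; exact hc₁ n
  have hA₂ : CoeffLE A₂ (s - e) := fun n => by
    rw [map_sub, hs_def, he_def, coeff_mk, coeff_mk]; exact hc₂ n
  have hs0 : CoeffLE 0 s := fun n => by
    have i1 := hc₁ n
    have i2 := hc₂ n
    have i3 := h₁ n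
    have i4 := h₂ n
    rw [map_zero] at i3 i4 ⊢
    rw [hs_def, coeff_mk]
    linarith
  have hee : ∀ n, |coeff n e| ≤ coeff n e' := fun n => by
    rw [he_def, he'_def, coeff_mk, coeff_mk]; exact hc n
  obtain ⟨J₁, hJ₁⟩ := exists_resolvent (s + e)
  obtain ⟨J₂, hJ₂⟩ := exists_resolvent (s - e)
  have i1 := resolvent_mul_sub h₁ h₂ hA₁ hA₂ hF₁ hF₂ hJ₁ hJ₂
  have hJ1 := CoeffLE.one_le_resolvent (h₁.trans hA₁) hJ₁
  have hJ2 := CoeffLE.one_le_resolvent (h₂.trans hA₂) hJ₂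
  have hJ : CoeffLE 1 (J₁ * J₂) :=
    hJ2.trans (CoeffLE.le_mul_of_one_le_left (CoeffLE.one_nonneg.trans hJ2) hJ1)
  rw [hB₁] at hG₁
  rw [hB₂] at hG₂
  have i2 := resolvent_mul_spread (H := J₁ * J₂) (H' := G₁ * G₂) hs0 hee hJ
    (by linear_combination (1 - X ^ 2 * (s - e)) * J₂ * hJ₁ + hJ₂)
    (by linear_combination (1 - X ^ 2 * (s - e')) * G₂ * hG₁ + hG₂)
  have he0 : ∀ n, 0 ≤ coeff n e' := fun n => (abs_nonneg _).trans (hee n)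
  have hterm : ∀ k l, coeff k e * coeff l e ≤ coeff k e' * coeff l e' := fun k l => by
    refine (le_abs_self _).trans ?_
    rw [abs_mul]
    exact mul_le_mul (hee _) (hee _) (abs_nonneg _) (he0 k)
  have p1 : CoeffLE 0 (X ^ 2 * (s + e + (s - e) - A₁ - A₂)) := by
    refine CoeffLE.mul_nonneg (CoeffLE.X_pow_nonneg 2) ?_
    convert! CoeffLE.sub_nonneg.2 (hA₁.add hA₂) using 1
    ring
  have p2 : CoeffLE 0 (X ^ 4 * (e' * e' - e * e)) := by
    refine CoeffLE.mul_nonneg (CoeffLE.X_pow_nonneg 4) (CoeffLE.sub_nonneg.2 fun n => ?_)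
    rw [coeff_mul, coeff_mul]
    exact sum_le_sum fun p _ => hterm _ _
  have q1 := CoeffLE.sub_nonneg.1 (p1.trans i1)
  have q2 := CoeffLE.sub_nonneg.1 (p2.trans i2)
  refine ⟨q1.trans q2, fun heq => ?_⟩
  have f1 : J₁ * J₂ = F₁ * F₂ := CoeffLE.antisymm (by rw [heq]; exact q2) q1
  have f2 : G₁ * G₂ = J₁ * J₂ := by rw [f1, heq]
  rw [f1, sub_self] at i1
  rw [f2, sub_self] at i2
  have g1 := CoeffLE.antisymm i1 p1
  have g2 := CoeffLE.antisymm i2 p2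
  have hX : (X : ℝ⟦X⟧) ≠ 0 := PowerSeries.X_ne_zero
  have g1' := (mul_eq_zero.1 g1).resolve_left (pow_ne_zero 2 hX)
  have g2' := (mul_eq_zero.1 g2).resolve_left (pow_ne_zero 4 hX)
  have hsum : A₁ + A₂ = s + e + (s - e) := by linear_combination -g1'
  have k1 : A₁ = s + e := CoeffLE.antisymm hA₁ fun n => by
    have := congrArg (coeff n) hsum
    have := hA₂ n
    simp only [map_add, map_sub] at *
    linarith
  have k2 : A₂ = s - e := by linear_combination hsum - k1
  refine ⟨by rw [hsum, hB₁, hB₂]; ring, fun k l => ?_⟩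
  -- `e * e` and `e' * e'` agree in degree `k + l`, and the summands are ordered termwise, so each
  -- pair of summands agrees.
  have hdd : coeff k e * coeff l e = coeff k e' * coeff l e' := by
    have := congrArg (coeff (k + l)) g2'
    rw [map_sub, map_zero, coeff_mul, coeff_mul, sub_eq_zero] at this
    exact (sum_eq_sum_iff_of_le fun p _ => hterm p.1 p.2).1 this.symm (k, l) (by simp)
  rw [k1, k2, hB₁, hB₂]
  simp only [map_add, map_sub]
  linear_combination 2 * hdd

end Resolvent

/-! ### The contribution of an edge between two roots -/

section EdgeTerm

/-- The contribution of an edge between two roots to the generating function of closed walks,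
where `H` counts the walks that use this edge exactly once. -/
noncomputable def edgeSeries (H : ℝ⟦X⟧) : ℝ⟦X⟧ :=
  X * d⁄dX ℝ (X ^ 2 * H) * (1 - X ^ 2 * H)⁻¹

variable {H H' : ℝ⟦X⟧}

theorem edgeSeries_inv (H : ℝ⟦X⟧) : (1 - X ^ 2 * H) * (1 - X ^ 2 * H)⁻¹ = 1 :=
  PowerSeries.mul_inv_cancel _ (by simp)

theorem edgeSeries_le (hH : CoeffLE 0 H) (h : CoeffLE H H') :
    CoeffLE (edgeSeries H) (edgeSeries H') := by
  have hX2 := CoeffLE.X_pow_nonneg 2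
  have hY1 := CoeffLE.one_le_resolvent hH (edgeSeries_inv H)
  have hd0 := (CoeffLE.mul_nonneg hX2 hH).derivative_nonneg
  exact CoeffLE.mul (CoeffLE.mul_nonneg CoeffLE.X_nonneg hd0)
    (CoeffLE.mul CoeffLE.X_nonneg (CoeffLE.refl _) hd0
      (CoeffLE.mul hX2 (CoeffLE.refl _) hH h).derivative)
    (CoeffLE.one_nonneg.trans hY1)
    (CoeffLE.resolvent_le hH h (edgeSeries_inv H) (edgeSeries_inv H'))

/-- Multiplying by the summand `X ^ 2` of `X ^ 2 * A` carries one even coefficient to the next. -/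
theorem coeff_even_resolvent_ge_one {A F : ℝ⟦X⟧} (hA : CoeffLE 0 A) (hA0 : 1 ≤ coeff 0 A)
    (hF : (1 - X ^ 2 * A) * F = 1) (t : ℕ) : 1 ≤ coeff (2 * t) F := by
  have hF1 := CoeffLE.one_le_resolvent hA hF
  have hF0 := CoeffLE.one_nonneg.trans hF1
  induction t with
  | zero => simpa using hF1 0
  | succ t ih =>
    have e : F = 1 + X ^ 2 * (A * F) := by linear_combination hF
    rw [e, map_add, show 2 * (t + 1) = 2 * t + 2 by ring, coeff_X_pow_mul, coeff_mul, coeff_one,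
      if_neg (by omega), zero_add]
    have h1 : coeff 0 A * coeff (2 * t) F ≤
        ∑ p ∈ antidiagonal (2 * t), coeff p.1 A * coeff p.2 F :=
      single_le_sum (f := fun p : ℕ × ℕ => coeff p.1 A * coeff p.2 F)
        (fun p _ => mul_nonneg (by simpa using hA p.1) (by simpa using hF0 p.2))
        (show ((0, 2 * t) : ℕ × ℕ) ∈ antidiagonal (2 * t) by simp)
    nlinarith

/-- The strict gap in degree `j` appears in the derivative factor at `j + 2`, scaled by `j + 2`, and
meets a positive coefficient of `F'`. -/
theorem coeff_X_mul_derivative_mul_lt {A A' F F' : ℝ⟦X⟧} (hA : CoeffLE 0 A) (h : CoeffLE A A')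
    (hF : CoeffLE 0 F) (h' : CoeffLE F F') {j m : ℕ} (hj : coeff j A < coeff j A')
    (hm : 0 < coeff m F') :
    coeff (j + 2 + m) (X * d⁄dX ℝ (X ^ 2 * A) * F) <
      coeff (j + 2 + m) (X * d⁄dX ℝ (X ^ 2 * A') * F') := by
  have hX2 := CoeffLE.X_pow_nonneg 2
  have hd0 := (CoeffLE.mul_nonneg hX2 hA).derivative_nonneg
  have hd0' := CoeffLE.mul_nonneg CoeffLE.X_nonneg hd0
  have hdle := CoeffLE.mul CoeffLE.X_nonneg (CoeffLE.refl X) hd0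
    (CoeffLE.mul hX2 (CoeffLE.refl _) hA h).derivative
  have hcoeff : ∀ B : ℝ⟦X⟧, coeff (j + 2) (X * d⁄dX ℝ (X ^ 2 * B)) = coeff j B * (j + 2) := fun B => by
    rw [show j + 2 = (j + 1) + 1 by ring, coeff_succ_X_mul, coeff_derivative,
      show j + 1 + 1 = j + 2 by ring, coeff_X_pow_mul]
    push_cast; ring
  rw [coeff_mul, coeff_mul]
  refine sum_lt_sum (fun p _ => ?_) ⟨(j + 2, m), by simp, ?_⟩
  · exact mul_le_mul (hdle _) (h' _) (by simpa using hF p.2)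
      ((by simpa using hd0' p.1 : (0 : ℝ) ≤ _).trans (hdle _))
  · dsimp only
    rw [hcoeff, hcoeff]
    have h1 := h' m
    have h2 : (0 : ℝ) ≤ coeff j A := by simpa using hA j
    refine lt_of_le_of_lt (mul_le_mul_of_nonneg_left h1 (by positivity)) ?_
    exact mul_lt_mul_of_pos_right (mul_lt_mul_of_pos_right hj (by positivity)) hm

theorem edgeSeries_lt (hH : CoeffLE 0 H) (h : CoeffLE H H') (hH0 : 1 ≤ coeff 0 H') {j : ℕ}
    (hj : coeff j H < coeff j H') (t : ℕ) :
    coeff (j + 2 + 2 * t) (edgeSeries H) < coeff (j + 2 + 2 * t) (edgeSeries H') :=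
  coeff_X_mul_derivative_mul_lt hH h
    (CoeffLE.one_nonneg.trans (CoeffLE.one_le_resolvent hH (edgeSeries_inv H)))
    (CoeffLE.resolvent_le hH h (edgeSeries_inv H) (edgeSeries_inv H')) hj
    (lt_of_lt_of_le one_pos
      (coeff_even_resolvent_ge_one (hH.trans h) hH0 (edgeSeries_inv H') t))

end EdgeTerm

end CoefficientwiseOrder

/-! ### Closed walks of a tree and of its sorted rearrangement -/

section ForestComparison

open Finset PowerSeries

variable {V : Type*} [Fintype V]

theorem IsLeveled.rank_lt {V : Type*} {P : V → V} {lev : V → ℕ} (h : IsLeveled P lev) {v : V} (hv : P v ≠ v) :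
    lev (P v) < lev v := by
  have := h.up v fun h0 => hv (h.root v h0)
  omega

/-- The generating function of closed walks whose highest vertex is `v`. -/
noncomputable def topSeries (par : V → V) (v : V) : ℝ⟦X⟧ :=
  X * d⁄dX ℝ (X ^ 2 * childSeries par v) * walkSeries par v

theorem X_mul_derivative_X_sq_mul (A : ℝ⟦X⟧) :
    X * d⁄dX ℝ (X ^ 2 * A) = X ^ 2 * PowerSeries.mk fun n => (n + 2) * coeff n A := by
  ext k
  match k with
  | 0 => simp
  | 1 =>
    have h1 := coeff_succ_X_mul 0 (d⁄dX ℝ (X ^ 2 * A))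
    rw [coeff_derivative, coeff_X_pow_mul', if_neg (by norm_num), zero_mul] at h1
    rw [coeff_X_pow_mul', if_neg (by norm_num)]
    exact h1
  | k + 2 =>
    rw [coeff_X_pow_mul, coeff_succ_X_mul, coeff_derivative, show k + 1 + 1 = k + 2 from rfl,
      coeff_X_pow_mul, coeff_mk]
    push_cast
    ring

/-- The weights `p.1 + 2` are natural numbers that do not depend on the vertex, so majorization
applies summand by summand. -/
theorem coeff_topSeries (par : V → V) (v : V) (k : ℕ) : coeff (k + 2) (topSeries par v) =
    ((∑ p ∈ antidiagonal k, (p.1 + 2) * (childWalks par p.1 v * rootedWalks par p.2 v) : ℕ) : ℝ) := by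
  rw [topSeries, X_mul_derivative_X_sq_mul, mul_assoc, coeff_X_pow_mul, coeff_mul]
  push_cast
  refine sum_congr rfl fun p _ => ?_
  simp only [coeff_mk, childSeries, walkSeries]
  ring

theorem coeff_topSeries_of_lt_two (par : V → V) (v : V) {k : ℕ} (hk : k < 2) :
    coeff k (topSeries par v) = 0 := by
  rw [topSeries, X_mul_derivative_X_sq_mul, mul_assoc, coeff_X_pow_mul', if_neg (by omega)]

theorem childSeries_nonneg (par : V → V) (v : V) : CoeffLE 0 (childSeries par v) := fun n => by
  simp [childSeries]

theorem walkSeries_nonneg (par : V → V) (v : V) : CoeffLE 0 (walkSeries par v) := fun n => by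
  simp [walkSeries]

section
variable [LinearOrder V] {P Q : V → V} {lev : V → ℕ}

theorem sum_levelSet_topSeries_le (hP : IsLeveled P lev) (hQ : IsSortedForest Q lev)
    (hcard : ∀ v, (forestChildren P v).card = (forestChildren Q v).card) (i k : ℕ) :
    ∑ v ∈ levelSet lev i, coeff k (topSeries P v) ≤ ∑ v ∈ levelSet lev i, coeff k (topSeries Q v) := by
  match k with
  | 0 => simp [coeff_topSeries_of_lt_two]
  | 1 => simp [coeff_topSeries_of_lt_two]
  | k + 2 =>
    simp only [coeff_topSeries]
    have := (Majorized.sum (antidiagonal k) fun p _ => (Majorized.const (p.1 + 2)).mul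
      ((majorized_childWalks hP hQ hcard p.1 i).mul (majorized_rootedWalks hP hQ hcard p.2 i))).sum_le
    exact_mod_cast this

theorem sum_topSeries_le (hP : IsLeveled P lev) (hQ : IsSortedForest Q lev)
    (hcard : ∀ v, (forestChildren P v).card = (forestChildren Q v).card) (k : ℕ) :
    ∑ v, coeff k (topSeries P v) ≤ ∑ v, coeff k (topSeries Q v) := by
  rw [← sum_fiberwise_of_maps_to (s := univ) (t := univ.image lev) (g := lev)
    (fun v hv => mem_image_of_mem _ hv), ← sum_fiberwise_of_maps_to (s := univ)
    (t := univ.image lev) (g := lev) (fun v hv => mem_image_of_mem _ hv)]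
  exact sum_le_sum fun i _ => sum_levelSet_topSeries_le hP hQ hcard i k

theorem sum_topSeries_lt (hP : IsLeveled P lev) (hQ : IsSortedForest Q lev)
    (hcard : ∀ v, (forestChildren P v).card = (forestChildren Q v).card) {k : ℕ} {r : V}
    (hr : ∀ v, lev v = 0 ↔ v = r) (hlt : coeff k (topSeries P r) < coeff k (topSeries Q r)) :
    ∑ v, coeff k (topSeries P v) < ∑ v, coeff k (topSeries Q v) := by
  rw [← sum_fiberwise_of_maps_to (s := univ) (t := univ.image lev) (g := lev)
    (fun v hv => mem_image_of_mem _ hv), ← sum_fiberwise_of_maps_to (s := univ)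
    (t := univ.image lev) (g := lev) (fun v hv => mem_image_of_mem _ hv)]
  refine sum_lt_sum (fun i _ => sum_levelSet_topSeries_le hP hQ hcard i k)
    ⟨0, mem_image.2 ⟨r, mem_univ _, (hr r).2 rfl⟩, ?_⟩
  have : univ.filter (fun v => lev v = 0) = {r} := by ext v; simp [hr]
  rw [this, sum_singleton, sum_singleton]
  exact hlt

end

open Classical in
/-- The parent map in which the root `s` becomes a child of `r`. -/
noncomputable def attachRoot {V : Type*} (P : V → V) (s r : V) (v : V) : V :=
  if v = s then r else P v

theorem attachRoot_self {V : Type*} {P : V → V} {s r : V} : attachRoot P s r s = r := if_pos rfl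

theorem attachRoot_of_ne {V : Type*} {P : V → V} {s r v : V} (h : v ≠ s) :
    attachRoot P s r v = P v := if_neg h

theorem numClosedWalks_parGraph {par : V → V} {rank : V → ℕ}
    (hr : ∀ v, par v ≠ v → rank (par v) < rank v) (k : ℕ) :
    (numClosedWalks (parGraph par) k : ℝ) =
      coeff k (Fintype.card V : ℝ⟦X⟧) + ∑ v, coeff k (topSeries par v) := by
  rw [← spectralMoment_eq_numClosedWalks]
  have := congrArg (coeff k) (spectralMoment_series_parGraph hr)
  rw [coeff_mk, map_add, map_sum] at this
  exact this

/-- Every level contributes at most its sorted counterpart. Level 0 is a single vertex, and one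
discrepancy between its child counts makes all larger even lengths strict. -/
theorem numClosedWalks_rooted_le [LinearOrder V] {P Q : V → V} {lev : V → ℕ}
    (hP : IsLeveled P lev) (hQ : IsSortedForest Q lev)
    (hcard : ∀ v, (forestChildren P v).card = (forestChildren Q v).card) {r : V}
    (hr : ∀ v, lev v = 0 ↔ v = r) :
    (∀ k, numClosedWalks (parGraph P) k ≤ numClosedWalks (parGraph Q) k) ∧
    ((∃ K, ∀ k, K ≤ k → Even k → numClosedWalks (parGraph P) k < numClosedWalks (parGraph Q) k) ∨
      ∀ k, childWalks P k r = childWalks Q k r) := by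
  have eP := numClosedWalks_parGraph fun v hv => hP.rank_lt (v := v) hv
  have eQ := numClosedWalks_parGraph fun v hv => hQ.toIsLeveled.rank_lt (v := v) hv
  have h0 : levelSet lev 0 = {r} := by ext v; simp [hr]
  refine ⟨fun k => ?_, ?_⟩
  · have : (numClosedWalks (parGraph P) k : ℝ) ≤ numClosedWalks (parGraph Q) k := by
      rw [eP, eQ]; exact add_le_add le_rfl (sum_topSeries_le hP hQ hcard k)
    exact_mod_cast this
  · by_cases hall : ∀ k, childWalks P k r = childWalks Q k r
    · exact Or.inr hall
    left
    push Not at hall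
    obtain ⟨j, hj⟩ := hall
    have hA : ∀ k, childWalks P k r ≤ childWalks Q k r := fun k => by
      simpa [h0] using (majorized_childWalks hP hQ hcard k 0).sum_le
    have hW : ∀ k, rootedWalks P k r ≤ rootedWalks Q k r := fun k => by
      simpa [h0] using (majorized_rootedWalks hP hQ hcard k 0).sum_le
    have hjlt : childWalks P j r < childWalks Q j r := lt_of_le_of_ne (hA j) hj
    have hjeven : Even j := by
      by_contra ho
      rw [Nat.not_even_iff_odd] at ho
      rw [childWalks_odd P j ho, childWalks_odd Q j ho] at hj
      exact hj rfl
    -- The root has a child, so the even coefficients of its walk series are positive.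
    have hpos : 1 ≤ coeff 0 (childSeries Q r) := by
      rw [childSeries, coeff_mk, childWalks_zero]
      have : (forestChildren Q r).card ≠ 0 := fun h => by
        rw [card_eq_zero] at h
        simp [childWalks, h] at hjlt
      exact_mod_cast Nat.one_le_iff_ne_zero.2 this
    refine ⟨j + 2, fun k hk hke => ?_⟩
    obtain ⟨t, ht⟩ : ∃ t, k = j + 2 + 2 * t := by
      obtain ⟨a, ha⟩ := hjeven
      obtain ⟨b, hb⟩ := hke
      exact ⟨b - a - 1, by omega⟩
    have : (numClosedWalks (parGraph P) k : ℝ) < numClosedWalks (parGraph Q) k := by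
      rw [eP, eQ, ht]
      refine add_lt_add_of_le_of_lt le_rfl (sum_topSeries_lt hP hQ hcard hr ?_)
      refine coeff_X_mul_derivative_mul_lt (childSeries_nonneg P r) (fun n => ?_)
        (walkSeries_nonneg P r) (fun n => ?_) ?_ ?_
      · simp only [childSeries, coeff_mk]; exact_mod_cast hA n
      · simp only [walkSeries, coeff_mk]; exact_mod_cast hW n
      · simp only [childSeries, coeff_mk]; exact_mod_cast hjlt
      · exact lt_of_lt_of_le one_pos (coeff_even_resolvent_ge_one (childSeries_nonneg Q r) hpos
          (one_sub_mul_walkSeries Q r) t)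
    exact_mod_cast this

section EdgeRooted

variable {P : V → V} {lev : V → ℕ} {r s : V}

theorem forestChildren_attachRoot_of_ne (hs : P s = s) {w : V} (hw : w ≠ r) :
    forestChildren (attachRoot P s r) w = forestChildren P w := by
  ext c
  rw [mem_forestChildren, mem_forestChildren]
  by_cases hc : c = s
  · subst hc
    simp only [attachRoot_self, hs]
    exact ⟨fun h => absurd h.2.symm hw, fun h => absurd h.2 h.1⟩
  · rw [attachRoot_of_ne hc]

theorem forestChildren_attachRoot_self [DecidableEq V] (hs : P s = s) (hrs : r ≠ s) :
    s ∉ forestChildren P r ∧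
      forestChildren (attachRoot P s r) r = insert s (forestChildren P r) := by
  constructor
  · rw [mem_forestChildren, hs]
    exact fun h => hrs h.2.symm
  · ext c
    rw [mem_insert, mem_forestChildren, mem_forestChildren]
    by_cases hc : c = s
    · subst hc
      simp [attachRoot_self, hrs.symm]
    · rw [attachRoot_of_ne hc]
      simp [hc]

theorem rootedWalks_attachRoot_of_ne (hs : P s = s) (hr : P r = r) (k : ℕ) {w : V} (hw : w ≠ r) :
    rootedWalks (attachRoot P s r) k w = rootedWalks P k w := by
  induction k using Nat.strong_induction_on generalizing w with
  | _ k ih =>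
    match k with
    | 0 => simp
    | 1 => simp
    | k + 2 =>
      rw [rootedWalks_add_two, rootedWalks_add_two]
      refine sum_congr rfl fun p hp => ?_
      rw [HasAntidiagonal.mem_antidiagonal] at hp
      rw [ih p.2 (by omega) hw, childWalks, childWalks, forestChildren_attachRoot_of_ne hs hw]
      congr 1
      refine sum_congr rfl fun c hc => ih p.1 (by omega) ?_
      rintro rfl
      rw [mem_forestChildren, hr] at hc
      exact hc.1 hc.2

theorem walkSeries_attachRoot_of_ne (hs : P s = s) (hr : P r = r) {w : V} (hw : w ≠ r) :
    walkSeries (attachRoot P s r) w = walkSeries P w := by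
  ext k
  rw [walkSeries, walkSeries, coeff_mk, coeff_mk, rootedWalks_attachRoot_of_ne hs hr k hw]

theorem childSeries_attachRoot_of_ne (hs : P s = s) (hr : P r = r) {w : V} (hw : w ≠ r) :
    childSeries (attachRoot P s r) w = childSeries P w := by
  rw [childSeries_eq_sum, childSeries_eq_sum, forestChildren_attachRoot_of_ne hs hw]
  refine sum_congr rfl fun c hc => walkSeries_attachRoot_of_ne hs hr ?_
  rintro rfl
  rw [mem_forestChildren, hr] at hc
  exact hc.1 hc.2

theorem childSeries_attachRoot_self (hs : P s = s) (hr : P r = r) (hrs : r ≠ s) :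
    childSeries (attachRoot P s r) r = childSeries P r + walkSeries P s := by
  classical
  obtain ⟨h1, h2⟩ := forestChildren_attachRoot_self hs hrs
  rw [childSeries_eq_sum, childSeries_eq_sum, h2, sum_insert h1, add_comm,
    walkSeries_attachRoot_of_ne hs hr hrs.symm]
  congr 1
  refine sum_congr rfl fun c hc => walkSeries_attachRoot_of_ne hs hr ?_
  rintro rfl
  rw [mem_forestChildren, hr] at hc
  exact hc.1 hc.2

/-- With A and F the child and walk series of `r` and E the walk series of `s`, one has 1 - X²(A +
E) = (1 - X²A)(1 - X²FE). Taking -X times logarithmic derivatives turns the second factor into the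
edge term. -/
theorem sum_topSeries_attachRoot (hs : P s = s) (hr : P r = r) (hrs : r ≠ s) :
    ∑ w, topSeries (attachRoot P s r) w =
      ∑ w, topSeries P w + edgeSeries (walkSeries P r * walkSeries P s) := by
  classical
  have hmain : topSeries (attachRoot P s r) r =
      topSeries P r + edgeSeries (walkSeries P r * walkSeries P s) := by
    have e1 := one_sub_mul_walkSeries (attachRoot P s r) r
    have e2 := one_sub_mul_walkSeries P r
    have e3 := edgeSeries_inv (walkSeries P r * walkSeries P s)
    rw [topSeries, topSeries, edgeSeries]
    rw [childSeries_attachRoot_self hs hr hrs] at e1 ⊢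
    set F' := walkSeries (attachRoot P s r) r
    set F := walkSeries P r
    set Y := (1 - X ^ 2 * (F * walkSeries P s))⁻¹
    have hF' : F' = F * Y := by
      linear_combination F * Y * e1 - F' * (Y * e2 + e3)
    have hda : d⁄dX ℝ (X ^ 2 * childSeries P r) * F ^ 2 = d⁄dX ℝ F := by
      have := congrArg (d⁄dX ℝ) e2
      rw [Derivation.leibniz, map_sub, Derivation.map_one_eq_zero, smul_eq_mul, smul_eq_mul] at this
      linear_combination -F * this + (d⁄dX ℝ F) * e2
    have hdH : d⁄dX ℝ (X ^ 2 * (F * walkSeries P s)) =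
        F * d⁄dX ℝ (X ^ 2 * walkSeries P s) + X ^ 2 * walkSeries P s * d⁄dX ℝ F := by
      rw [show X ^ 2 * (F * walkSeries P s) = F * (X ^ 2 * walkSeries P s) by ring,
        Derivation.leibniz, smul_eq_mul, smul_eq_mul]
    rw [mul_add, map_add, hdH, hF', ← hda]
    linear_combination (X * d⁄dX ℝ (X ^ 2 * childSeries P r) * F) * e3
  rw [← add_sum_erase univ _ (mem_univ r), ← add_sum_erase univ (topSeries P) (mem_univ r), hmain]
  have : ∑ w ∈ univ.erase r, topSeries (attachRoot P s r) w =
      ∑ w ∈ univ.erase r, topSeries P w := sum_congr rfl fun w hw => by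
    rw [topSeries, topSeries, childSeries_attachRoot_of_ne hs hr (ne_of_mem_erase hw),
      walkSeries_attachRoot_of_ne hs hr (ne_of_mem_erase hw)]
  rw [this]
  ring

theorem IsLeveled.exists_rank_attachRoot {V : Type*} {P : V → V} {lev : V → ℕ} {r s : V}
    (hP : IsLeveled P lev) (hr : lev r = 0) (hrs : r ≠ s) :
    ∃ rank : V → ℕ, ∀ v, attachRoot P s r v ≠ v →
      rank (attachRoot P s r v) < rank v := by
  classical
  -- Shifting all other ranks by one places `s` strictly after `r`.
  refine ⟨fun w => if w = r then 0 else lev w + 1, fun v hv => ?_⟩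
  by_cases hvs : v = s
  · subst hvs
    simp [attachRoot_self, hrs.symm]
  · rw [attachRoot_of_ne hvs] at hv ⊢
    have h1 := hP.rank_lt hv
    have h2 : v ≠ r := by rintro rfl; exact hv (hP.root v hr)
    dsimp only
    rw [if_neg h2]
    split_ifs <;> omega

theorem numClosedWalks_attachRoot (hP : IsLeveled P lev) (hr : lev r = 0) (hs : lev s = 0)
    (hrs : r ≠ s) (k : ℕ) : (numClosedWalks (parGraph (attachRoot P s r)) k : ℝ) =
      coeff k (Fintype.card V : ℝ⟦X⟧) + (∑ v, coeff k (topSeries P v) +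
        coeff k (edgeSeries (walkSeries P r * walkSeries P s))) := by
  obtain ⟨rank, hrank⟩ := hP.exists_rank_attachRoot hr hrs
  rw [numClosedWalks_parGraph hrank, ← map_sum, sum_topSeries_attachRoot (hP.root s hs)
    (hP.root r hr) hrs, map_add, map_sum]

end EdgeRooted

/-- The forest part is handled level by level as before. On level 0, majorization of the two root
child series gives the inequality of resolvent products on which the edge term depends. -/
theorem numClosedWalks_edge_rooted_le [LinearOrder V] {P Q : V → V} {lev : V → ℕ}
    (hP : IsLeveled P lev) (hQ : IsSortedForest Q lev)
    (hcard : ∀ v, (forestChildren P v).card = (forestChildren Q v).card) {r s : V}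
    (hrs : r ≠ s) (h0 : ∀ v, lev v = 0 ↔ v = r ∨ v = s) :
    (∀ k, numClosedWalks (parGraph (attachRoot P s r)) k ≤
      numClosedWalks (parGraph (attachRoot Q s r)) k) ∧
    ((∃ K, ∀ k, K ≤ k → Even k → numClosedWalks (parGraph (attachRoot P s r)) k <
      numClosedWalks (parGraph (attachRoot Q s r)) k) ∨
      (∀ k, ∑ v ∈ levelSet lev 0, childWalks P k v = ∑ v ∈ levelSet lev 0, childWalks Q k v) ∧
      ∀ k l, ∑ v ∈ levelSet lev 0, childWalks P k v * childWalks P l v =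
        ∑ v ∈ levelSet lev 0, childWalks Q k v * childWalks Q l v) := by
  have hr0 : lev r = 0 := (h0 r).2 (Or.inl rfl)
  have hs0 : lev s = 0 := (h0 s).2 (Or.inr rfl)
  have eP := numClosedWalks_attachRoot hP hr0 hs0 hrs
  have eQ := numClosedWalks_attachRoot hQ.toIsLeveled hr0 hs0 hrs
  have hset : levelSet lev 0 = {r, s} := by ext v; simp [h0]
  -- The sorted order may list either root first; the edge term is symmetric in them.
  obtain ⟨b₁, b₂, hb, hb12, hbset⟩ : ∃ b₁ b₂, b₁ < b₂ ∧ (b₁ = r ∧ b₂ = s ∨ b₁ = s ∧ b₂ = r) ∧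
      levelSet lev 0 = {b₁, b₂} := by
    rcases lt_or_gt_of_ne hrs with h | h
    · exact ⟨r, s, h, Or.inl ⟨rfl, rfl⟩, hset⟩
    · exact ⟨s, r, h, Or.inr ⟨rfl, rfl⟩, by rw [hset, pair_comm]⟩
  have hwQ : walkSeries Q b₁ * walkSeries Q b₂ = walkSeries Q r * walkSeries Q s := by
    rcases hb12 with ⟨rfl, rfl⟩ | ⟨rfl, rfl⟩
    · rfl
    · exact mul_comm _ _
  have hsumset : ∀ f : V → ℕ, ∑ v ∈ levelSet lev 0, f v = f r + f s := fun f => by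
    rw [hset, sum_pair hrs]
  have hsumset' : ∀ f : V → ℕ, ∑ v ∈ levelSet lev 0, f v = f b₁ + f b₂ := fun f => by
    rw [hbset, sum_pair hb.ne]
  have hmaj := fun k => majorized_childWalks hP hQ hcard k 0
  have hinit : IsInitialIn (levelSet lev 0) {b₁} := by
    rw [hbset]
    refine ⟨by simp, fun x hx y hy hyx => ?_⟩
    rw [mem_singleton] at hx ⊢
    subst hx
    rcases mem_insert.1 hy with h | h
    · exact h
    · rw [mem_singleton] at h
      subst h
      exact absurd hb hyx.not_gt
  have htop : ∀ x, lev x = 0 → CoeffLE (childSeries P x) (childSeries Q b₁) := fun x hx n => by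
    have := (hmaj n).2 {x} (by simpa using hx) {b₁} hinit (by simp)
    rw [sum_singleton, sum_singleton] at this
    simp only [childSeries, coeff_mk]
    exact_mod_cast this
  have hsum : CoeffLE (childSeries P r + childSeries P s) (childSeries Q b₁ + childSeries Q b₂) :=
    fun n => by
      have := (hmaj n).sum_le
      rw [hsumset, hsumset'] at this
      simp only [childSeries, coeff_mk, map_add]
      exact_mod_cast this
  have hb21 : CoeffLE (childSeries Q b₂) (childSeries Q b₁) := fun n => by
    have hanti := (hmaj n).1
    have := @hanti b₁ (by rw [hbset]; simp) b₂ (by rw [hbset]; simp) hb.le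
    simp only [childSeries, coeff_mk]
    exact_mod_cast this
  obtain ⟨hle, heq⟩ := resolvent_mul_le_of_majorized (childSeries_nonneg P r)
    (childSeries_nonneg P s) (htop r hr0) (htop s hs0) hsum hb21 (one_sub_mul_walkSeries P r)
    (one_sub_mul_walkSeries P s) (one_sub_mul_walkSeries Q b₁) (one_sub_mul_walkSeries Q b₂)
  have hnn := CoeffLE.mul_nonneg (walkSeries_nonneg P r) (walkSeries_nonneg P s)
  refine ⟨fun k => ?_, ?_⟩
  · have : (numClosedWalks (parGraph (attachRoot P s r)) k : ℝ) ≤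
        numClosedWalks (parGraph (attachRoot Q s r)) k := by
      rw [eP, eQ, ← hwQ]
      exact add_le_add le_rfl (add_le_add (sum_topSeries_le hP hQ hcard k) (edgeSeries_le hnn hle k))
    exact_mod_cast this
  · by_cases hH : walkSeries P r * walkSeries P s = walkSeries Q b₁ * walkSeries Q b₂
    · right
      obtain ⟨g1, g2⟩ := heq hH
      refine ⟨fun k => ?_, fun k l => ?_⟩
      · rw [hsumset, hsumset']
        have := congrArg (coeff k) g1
        simp only [childSeries, coeff_mk, map_add] at this
        exact_mod_cast this
      · rw [hsumset, hsumset']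
        have := g2 k l
        simp only [childSeries, coeff_mk] at this
        exact_mod_cast this
    · left
      obtain ⟨j, hj⟩ : ∃ j, coeff j (walkSeries P r * walkSeries P s) ≠
          coeff j (walkSeries Q b₁ * walkSeries Q b₂) := by
        by_contra hc
        push Not at hc
        exact hH (PowerSeries.ext hc)
      have hodd : ∀ (R : V → V) (x y : V), Odd j → coeff j (walkSeries R x * walkSeries R y) = 0 :=
        fun R x y ho => by
          rw [coeff_mul]
          refine sum_eq_zero fun p hp => ?_
          rw [HasAntidiagonal.mem_antidiagonal] at hp
          rw [walkSeries, walkSeries, coeff_mk, coeff_mk]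
          rcases Nat.even_or_odd p.1 with h1 | h1
          · have h2 : Odd p.2 := by
              rw [Nat.odd_iff] at ho ⊢; rw [Nat.even_iff] at h1; omega
            rw [rootedWalks_odd R p.2 h2, Nat.cast_zero, mul_zero]
          · rw [rootedWalks_odd R p.1 h1, Nat.cast_zero, zero_mul]
      have hjeven : Even j := by
        by_contra ho
        rw [Nat.not_even_iff_odd] at ho
        exact hj (by rw [hodd P r s ho, hodd Q b₁ b₂ ho])
      refine ⟨j + 2, fun k hk hke => ?_⟩
      obtain ⟨t, ht⟩ : ∃ t, k = j + 2 + 2 * t := by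
        obtain ⟨a, ha⟩ := hjeven
        obtain ⟨b, hb⟩ := hke
        exact ⟨b - a - 1, by omega⟩
      have : (numClosedWalks (parGraph (attachRoot P s r)) k : ℝ) <
          numClosedWalks (parGraph (attachRoot Q s r)) k := by
        rw [eP, eQ, ← hwQ, ht]
        refine add_lt_add_of_le_of_lt le_rfl (add_lt_add_of_le_of_lt
          (sum_topSeries_le hP hQ hcard _) (edgeSeries_lt hnn hle ?_ (lt_of_le_of_ne (hle j) hj) t))
        simp [walkSeries]
      exact_mod_cast this

end ForestComparison

/-! ### Existence of the sorted rearrangement -/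

section SortedForestExistence

open Finset

variable {V : Type*} [Fintype V]

/-- Sort the list of parents and hand it out to the vertices in order: each vertex occurs as a
parent as often as before. -/
theorem exists_isSortedForest_of_monotone [LinearOrder V] {P : V → V} {lev : V → ℕ}
    (hP : IsLeveled P lev) (hmono : Monotone lev)
    (hanti : ∀ v w, lev v = lev w → v ≤ w → (forestChildren P w).card ≤ (forestChildren P v).card) :
    ∃ Q, IsSortedForest Q lev ∧ ∀ v, (forestChildren P v).card = (forestChildren Q v).card := by
  set φ : Fin (Fintype.card V) ≃o V := Fintype.orderIsoFinOfCardEq V rfl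
  set f : Fin (Fintype.card V) → WithBot V := fun i =>
    if lev (φ i) = 0 then ⊥ else ((P (φ i) : V) : WithBot V) with hf
  set σ := Tuple.sort f
  have hσ : Monotone (f ∘ σ) := Tuple.monotone_sort f
  -- `ℓ` recovers the level from the sorting key, so sorting parents also sorts levels. These were
  -- sorted already, hence the permutation preserves them.
  set ℓ : WithBot V → ℕ := fun x => WithBot.recBotCoe 0 (fun v => lev v + 1) x with hℓ
  have hℓm : Monotone ℓ := fun x y hxy => by
    induction x with
    | bot => exact Nat.zero_le _
    | coe x =>
      induction y with
      | bot => simp at hxy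
      | coe y => exact Nat.succ_le_succ (hmono (WithBot.coe_le_coe.1 hxy))
  have hℓf : ∀ i, ℓ (f i) = lev (φ i) := fun i => by
    simp only [hf]
    split_ifs with h
    · exact h.symm
    · exact hP.up _ h
  have hlevσ : ∀ i, lev (φ (σ i)) = lev (φ i) := by
    have h1 : Monotone ((lev ∘ φ) ∘ σ) := fun i j hij => by
      simp only [Function.comp]
      rw [← hℓf, ← hℓf]
      exact hℓm (hσ hij)
    have h2 : Monotone ((lev ∘ φ) ∘ (Equiv.refl _)) := fun i j hij => hmono (φ.monotone hij)
    exact fun i => congrFun (Tuple.unique_monotone h1 h2) i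
  set τ : Equiv.Perm V := (φ.symm.toEquiv.trans σ).trans φ.toEquiv with hτ
  have hlev : ∀ v, lev (τ v) = lev v := fun v => by
    have := hlevσ (φ.symm v)
    rwa [φ.apply_symm_apply] at this
  set Q : V → V := fun v => if lev v = 0 then v else P (τ v) with hQ
  have hQL : IsLeveled Q lev := by
    refine ⟨fun v hv => if_pos hv, fun v hv => ?_⟩
    simp only [hQ, if_neg hv]
    rw [hP.up _ (by rwa [hlev]), hlev]
  have hcard : ∀ v, (forestChildren P v).card = (forestChildren Q v).card := fun v => by
    symm
    refine card_bij (fun c _ => τ c) (fun c hc => ?_) (fun c _ d _ h => τ.injective h)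
      (fun c hc => ⟨τ.symm c, ?_, τ.apply_symm_apply c⟩)
    · rw [hQL.mem_forestChildren] at hc
      rw [hP.mem_forestChildren, hlev]
      exact ⟨hc.1, by simpa only [hQ, if_neg hc.1] using hc.2⟩
    · rw [hP.mem_forestChildren] at hc
      have h0 : lev (τ.symm c) ≠ 0 := by rw [← hlev, τ.apply_symm_apply]; exact hc.1
      rw [hQL.mem_forestChildren]
      refine ⟨h0, ?_⟩
      simp only [hQ, if_neg h0, τ.apply_symm_apply]
      exact hc.2
  refine ⟨Q, ⟨hQL, fun c d hcd hc0 hle => ?_, fun v w hvw hle => ?_⟩, hcard⟩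
  · have h1 : f (σ (φ.symm c)) ≤ f (σ (φ.symm d)) := hσ (φ.symm.monotone hle)
    have hc' : lev (φ (σ (φ.symm c))) ≠ 0 := by rw [hlevσ, φ.apply_symm_apply]; exact hc0
    have hd' : lev (φ (σ (φ.symm d))) ≠ 0 := by
      rw [hlevσ, φ.apply_symm_apply, ← hcd]; exact hc0
    simp only [hf, if_neg hc', if_neg hd'] at h1
    simp only [hQ, if_neg hc0, if_neg (hcd ▸ hc0)]
    exact WithBot.coe_le_coe.1 h1
  · rw [← hcard, ← hcard]
    exact hanti v w hvw hle

theorem IsLeveled.exists_isSortedForest {P : V → V} {lev : V → ℕ} (hP : IsLeveled P lev) :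
    ∃ (_ : LinearOrder V) (Q : V → V), IsSortedForest Q lev ∧
      ∀ v, (forestChildren P v).card = (forestChildren Q v).card := by
  -- Level first, then decreasing number of children, then an arbitrary tie-break.
  set key : V → ℕ ×ₗ (ℕᵒᵈ ×ₗ Fin (Fintype.card V)) := fun v =>
    toLex (lev v, toLex (OrderDual.toDual (forestChildren P v).card, Fintype.equivFin V v)) with hkey
  have hinj : Function.Injective key := fun v w h => by
    simp only [hkey, EmbeddingLike.apply_eq_iff_eq, Prod.mk.injEq] at h
    exact h.2.2
  let _ : LinearOrder V := LinearOrder.lift' key hinj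
  refine ⟨inferInstance, exists_isSortedForest_of_monotone hP (fun v w hvw => ?_)
    fun v w hlev hvw => ?_⟩
  · have h : key v ≤ key w := hvw
    rw [Prod.Lex.le_iff] at h
    rcases h with h | h
    · exact h.le
    · exact h.1.le
  · have h : key v ≤ key w := hvw
    rw [Prod.Lex.le_iff] at h
    rcases h with h | h
    · exact absurd hlev h.ne
    · have h2 := h.2
      simp only [hkey, ofLex_toLex] at h2
      rw [Prod.Lex.le_iff] at h2
      rcases h2 with h2 | h2
      · exact (OrderDual.toDual_lt_toDual.1 h2).le
      · exact (OrderDual.toDual.injective h2.1).ge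

end SortedForestExistence

/-! ### Trees as rooted forests -/

section Trees

open Finset

variable {V : Type*} {G : SimpleGraph V}

open Classical in
/-- A neighbor of `v` that is closer to `r`, if there is one, and `v` otherwise. -/
noncomputable def stepToward (G : SimpleGraph V) (r v : V) : V :=
  if h : ∃ w, G.Adj v w ∧ G.dist r w + 1 = G.dist r v then h.choose else v

theorem exists_adj_dist (hG : G.Connected) {r v : V} (hv : v ≠ r) :
    ∃ w, G.Adj v w ∧ G.dist r w + 1 = G.dist r v := by
  obtain ⟨p, hp⟩ := hG.exists_walk_length_eq_dist v r
  cases p with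
  | nil => exact absurd rfl hv
  | cons h q =>
    rename_i w
    refine ⟨w, h, ?_⟩
    rw [SimpleGraph.Walk.length_cons, G.dist_comm] at hp
    have h1 : G.dist r w ≤ q.length := by rw [G.dist_comm]; exact SimpleGraph.dist_le q
    have h2 : G.dist r v ≤ G.dist r w + 1 := by
      refine (hG.dist_triangle (v := w)).trans ?_
      rw [SimpleGraph.dist_eq_one_iff_adj.2 h.symm]
    omega

/-- Each such neighbor is the penultimate vertex of the unique path from `r` to `v`. -/
theorem SimpleGraph.IsTree.eq_of_adj_of_dist (hG : G.IsTree) {r v w w' : V} (h : G.Adj v w)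
    (h' : G.Adj v w') (hd : G.dist r w + 1 = G.dist r v) (hd' : G.dist r w' + 1 = G.dist r v) :
    w = w' := by
  obtain ⟨p, hp, hpl⟩ := hG.1.exists_path_of_dist r v
  have key : ∀ x, G.Adj v x → G.dist r x + 1 = G.dist r v → x = p.penultimate := fun x hx hxd => by
    refine hG.2.eq_penultimate_of_adj_end hp hx ?_
    by_contra hmem
    obtain ⟨q, hq, hql⟩ := hG.1.exists_path_of_dist r x
    have hcons : (q.concat hx.symm).length = G.dist r v := by
      rw [SimpleGraph.Walk.length_concat, hql, hxd]
    have hpath := (q.concat hx.symm).isPath_of_length_eq_dist hcons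
    have := (hG.2.subsingleton_path r v).elim ⟨p, hp⟩ ⟨_, hpath⟩
    rw [Subtype.mk.injEq] at this
    rw [this] at hmem
    exact hmem (by simp [SimpleGraph.Walk.support_concat])
  rw [key w h hd, key w' h' hd']

theorem stepToward_spec (hG : G.Connected) {r v : V} (hv : v ≠ r) :
    G.Adj v (stepToward G r v) ∧ G.dist r (stepToward G r v) + 1 = G.dist r v := by
  have h := exists_adj_dist hG hv
  rw [stepToward, dif_pos h]
  exact h.choose_spec

theorem stepToward_self (r : V) : stepToward G r r = r := by
  rw [stepToward, dif_neg]
  rintro ⟨w, -, h⟩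
  rw [SimpleGraph.dist_self] at h
  omega

theorem SimpleGraph.IsTree.eq_stepToward (hG : G.IsTree) {r v w : V} (h : G.Adj v w)
    (hd : G.dist r w + 1 = G.dist r v) : w = stepToward G r v := by
  have hv : v ≠ r := by rintro rfl; rw [SimpleGraph.dist_self] at hd; omega
  obtain ⟨h1, h2⟩ := stepToward_spec hG.1 hv
  exact hG.eq_of_adj_of_dist h h1 hd h2

theorem isLeveled_stepToward (hG : G.Connected) (r : V) :
    IsLeveled (stepToward G r) (G.dist r) := by
  refine ⟨fun v hv => ?_, fun v hv => (stepToward_spec hG ?_).2⟩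
  · rw [hG.dist_eq_zero_iff] at hv
    subst hv
    exact stepToward_self r
  · rintro rfl
    exact hv SimpleGraph.dist_self

theorem SimpleGraph.IsTree.parGraph_stepToward (hG : G.IsTree) (r : V) :
    parGraph (stepToward G r) = G := by
  ext v w
  have hstep : ∀ x y, x ≠ y → stepToward G r x = y → G.Adj x y := fun x y hxy h => by
    have hx : x ≠ r := by rintro rfl; exact hxy ((stepToward_self x).symm.trans h)
    rw [← h]
    exact (stepToward_spec hG.1 hx).1
  constructor
  · rintro ⟨hne, h | h⟩
    · exact hstep v w hne h
    · exact (hstep w v hne.symm h).symm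
  · intro h
    refine ⟨h.ne, ?_⟩
    rcases hG.dist_eq_dist_add_one_of_adj r h with h1 | h1
    · exact Or.inl (hG.eq_stepToward h h1.symm).symm
    · exact Or.inr (hG.eq_stepToward h.symm h1.symm).symm

theorem connected_parGraph {par : V → V} {rank : V → ℕ} {r : V}
    (hrank : ∀ v, par v ≠ v → rank (par v) < rank v) (hr : ∀ v, par v = v → v = r) :
    (parGraph par).Connected := by
  have hreach : ∀ n v, rank v = n → (parGraph par).Reachable v r := by
    intro n
    induction n using Nat.strong_induction_on with
    | _ n ih =>
      intro v hv
      by_cases h : par v = v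
      · rw [hr v h]
      · have hadj : (parGraph par).Adj v (par v) := ⟨fun e => h e.symm, Or.inl rfl⟩
        exact hadj.reachable.trans (ih _ (hv ▸ hrank v h) _ rfl)
  have : Nonempty V := ⟨r⟩
  exact ⟨fun v w => (hreach _ v rfl).trans (hreach _ w rfl).symm⟩

variable [Fintype V]

-- Equal degrees mean equally many edges, and a connected graph with as many edges as a tree on the
-- same vertices is a tree.
open Classical in
theorem SimpleGraph.IsTree.of_degree_eq {H : SimpleGraph V} (hG : G.IsTree) (hH : H.Connected)
    (hdeg : ∀ v, H.degree v = G.degree v) : H.IsTree := by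
  rw [SimpleGraph.isTree_iff_connected_and_card] at hG ⊢
  refine ⟨hH, ?_⟩
  rw [← hG.2]
  have h1 := H.sum_degrees_eq_twice_card_edges
  have h2 := G.sum_degrees_eq_twice_card_edges
  rw [Finset.sum_congr rfl fun v _ => hdeg v, h2] at h1
  rw [Nat.card_eq_fintype_card, Nat.card_eq_fintype_card, ← SimpleGraph.edgeFinset_card,
    ← SimpleGraph.edgeFinset_card]
  omega

open Classical in
theorem degree_parGraph {par : V → V} {rank : V → ℕ}
    (hrank : ∀ v, par v ≠ v → rank (par v) < rank v) (v : V) :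
    (parGraph par).degree v = (forestChildren par v).card + if par v = v then 0 else 1 := by
  have hN : (parGraph par).neighborFinset v =
      forestChildren par v ∪ (if par v = v then ∅ else {par v}) := by
    ext w
    rw [SimpleGraph.mem_neighborFinset, parGraph_adj, mem_union, mem_forestChildren, or_comm]
    refine or_congr_right ?_
    split_ifs with h
    · simp [h]
    · simp only [mem_singleton, ne_eq]
      exact ⟨fun h => h.2.symm, fun e => ⟨fun e' => h (e ▸ e'.symm), e.symm⟩⟩
  rw [← SimpleGraph.card_neighborFinset_eq_degree, hN, card_union_of_disjoint]
  · split_ifs <;> simp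
  · split_ifs with h
    · simp
    · rw [disjoint_singleton_right, mem_forestChildren]
      rintro ⟨h1, h2⟩
      have e1 := hrank v h
      have e2 := hrank (par v) (by rw [h2]; exact h1.symm)
      rw [h2] at e2
      omega

end Trees

/-! ### Walk-maximal trees have comparable branches -/

section BranchComparison

open Finset

variable {V : Type*} {G : SimpleGraph V}

/-- `w` is at depth `j` in the branch that starts with the edge from `u` to `v`. -/
def InBranch (G : SimpleGraph V) (u v : V) (j : ℕ) (w : V) : Prop :=
  G.dist v w = j ∧ G.dist u w = j + 1

open Classical in
/-- At each depth, no degree in the branch from `u` to `v` is smaller than a degree in the branch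
from `u'` to `v'`. -/
def BranchGE [Fintype V] (G : SimpleGraph V) (u v u' v' : V) : Prop :=
  ∀ j a b, InBranch G u v j a → InBranch G u' v' j b → G.degree b ≤ G.degree a

/-- `H` never has fewer closed walks than `G`, and has more of every large even length. -/
def WalkLT {W : Type*} [Fintype V] [Fintype W] (G : SimpleGraph V) (H : SimpleGraph W) : Prop :=
  (∀ k, numClosedWalks G k ≤ numClosedWalks H k) ∧
    ∃ K, ∀ k, K ≤ k → Even k → numClosedWalks G k < numClosedWalks H k

open Classical in
/-- No tree with the same vertex degrees has more closed walks. -/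
def IsWalkMaximal [Fintype V] (G : SimpleGraph V) : Prop :=
  ∀ H : SimpleGraph V, H.IsTree → (∀ v, H.degree v = G.degree v) → ¬ WalkLT G H

theorem dist_stepToward_of_dist_add (hG : G.IsTree) {r v a : V} {j : ℕ} (hj : G.dist v a = j + 1)
    (h : G.dist r a = G.dist r v + (j + 1)) :
    G.dist v (stepToward G r a) = j ∧ G.dist r (stepToward G r a) = G.dist r v + j := by
  have hav : a ≠ v := by
    rintro rfl
    rw [SimpleGraph.dist_self] at hj
    omega
  obtain ⟨h1, h2⟩ := stepToward_spec hG.1 hav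
  have hr : G.dist r (stepToward G v a) + 1 = G.dist r a := by
    rcases hG.dist_eq_dist_add_one_of_adj r h1 with h | h
    · exact h.symm
    · have := hG.1.dist_triangle (u := r) (v := v) (w := stepToward G v a)
      omega
  rw [← hG.eq_stepToward h1 hr]
  omega

theorem iterate_stepToward_eq (hG : G.IsTree) {r v a : V} {j : ℕ} (hj : G.dist v a = j)
    (h : G.dist r a = G.dist r v + j) : (stepToward G r)^[j] a = v := by
  induction j generalizing a with
  | zero =>
    rw [Function.iterate_zero, id]
    exact (hG.1.dist_eq_zero_iff.1 hj).symm
  | succ j ih =>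
    rw [Function.iterate_succ_apply]
    obtain ⟨h1, h2⟩ := dist_stepToward_of_dist_add hG hj h
    exact ih h1 h2

theorem InBranch.iterate_stepToward (hG : G.IsTree) {z c : V} (hc : G.Adj z c) {j : ℕ} {a : V}
    (ha : InBranch G z c j a) : (stepToward G z)^[j] a = c :=
  iterate_stepToward_eq hG ha.1 (by
    rw [ha.2, SimpleGraph.dist_eq_one_iff_adj.2 hc, add_comm])

/-- Hence the minimum of the distances to the two ends of an edge is a level function once the edge
is deleted. -/
theorem dist_stepToward_of_adj (hG : G.IsTree) {u v w : V} (huv : G.Adj u v) (hwu : w ≠ u)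
    (hwv : w ≠ v) : G.dist u (stepToward G u w) + 1 = G.dist u w ∧
      G.dist v (stepToward G u w) + 1 = G.dist v w := by
  obtain ⟨h1, h2⟩ := stepToward_spec hG.1 hwu
  refine ⟨h2, ?_⟩
  rcases hG.dist_eq_dist_add_one_of_adj v h1 with h | h
  · exact h.symm
  · exfalso
    have hvu : G.dist v u = 1 := SimpleGraph.dist_eq_one_iff_adj.2 huv.symm
    have huv' : G.dist u v = 1 := SimpleGraph.dist_eq_one_iff_adj.2 huv
    have t1 := hG.1.dist_triangle (u := v) (v := u) (w := stepToward G u w)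
    obtain ⟨h3, h4⟩ := stepToward_spec hG.1 hwv
    have t2 := hG.1.dist_triangle (u := u) (v := v) (w := stepToward G v w)
    have t3 := hG.1.dist_triangle (u := u) (v := v) (w := w)
    rcases hG.dist_eq_dist_add_one_of_adj u h3 with h' | h'
    · have := hG.eq_stepToward h3 h'.symm
      rw [this] at h4
      omega
    · omega

/-- The parent map of the rooted forest that arises from a tree when the edge from `u` to `v` is
deleted, with roots `u` and `v`. -/
noncomputable def edgeParent (G : SimpleGraph V) (u v : V) : V → V :=
  attachRoot (stepToward G u) v v

theorem isLeveled_edgeParent (hG : G.IsTree) {u v : V} (huv : G.Adj u v) :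
    IsLeveled (edgeParent G u v) (fun w => min (G.dist u w) (G.dist v w)) := by
  classical
  have hroot : ∀ w, min (G.dist u w) (G.dist v w) = 0 → w = u ∨ w = v := fun w hw => by
    rcases min_choice (G.dist u w) (G.dist v w) with h | h
    · rw [h] at hw; exact Or.inl (hG.1.dist_eq_zero_iff.1 hw).symm
    · rw [h] at hw; exact Or.inr (hG.1.dist_eq_zero_iff.1 hw).symm
  refine ⟨fun w hw => ?_, fun w hw => ?_⟩
  · rcases hroot w hw with rfl | rfl
    · rw [edgeParent, attachRoot_of_ne huv.ne, stepToward_self]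
    · rw [edgeParent, attachRoot_self]
  · have hwu : w ≠ u := by rintro rfl; simp at hw
    have hwv : w ≠ v := by rintro rfl; simp at hw
    obtain ⟨h1, h2⟩ := dist_stepToward_of_adj hG huv hwu hwv
    rw [edgeParent, attachRoot_of_ne hwv]
    omega

theorem InBranch.iterate_edgeParent (hG : G.IsTree) {u v r s : V} (huv : G.Adj u v)
    (hrs : r = u ∧ s = v ∨ r = v ∧ s = u) {j : ℕ} {a : V}
    (ha : InBranch G r s j a) : (edgeParent G u v)^[j] a = s := by
  classical
  induction j generalizing a with
  | zero =>
    rw [Function.iterate_zero, id]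
    exact (hG.1.dist_eq_zero_iff.1 ha.1).symm
  | succ j ih =>
    rw [Function.iterate_succ_apply]
    have hd := ha.1
    have hd' := ha.2
    have h1 : a ≠ r := by rintro rfl; rw [SimpleGraph.dist_self] at hd'; omega
    have h2 : a ≠ s := by rintro rfl; rw [SimpleGraph.dist_self] at hd; omega
    have hau : a ≠ u := by rcases hrs with ⟨rfl, rfl⟩ | ⟨rfl, rfl⟩ <;> assumption
    have hav : a ≠ v := by rcases hrs with ⟨rfl, rfl⟩ | ⟨rfl, rfl⟩ <;> assumption
    obtain ⟨e1, e2⟩ := dist_stepToward_of_adj hG huv hau hav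
    refine ih ?_
    rw [edgeParent, attachRoot_of_ne hav]
    rcases hrs with ⟨rfl, rfl⟩ | ⟨rfl, rfl⟩
    · exact ⟨by omega, by omega⟩
    · exact ⟨by omega, by omega⟩

variable [Fintype V]

theorem WalkDominates.iterate {P : V → V} {lev : V → ℕ} (hP : IsLeveled P lev) {i : ℕ}
    (hch : ∀ v w c d, i ≤ lev v → lev v = lev w → v ≠ w → WalkDominates P v w →
      c ∈ forestChildren P v → d ∈ forestChildren P w → WalkDominates P c d)
    {v w : V} (hv : lev v = i) (hw : lev w = i) (hvw : v ≠ w) (h : WalkDominates P v w) (j : ℕ)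
    {a b : V} (ha : P^[j] a = v) (hb : P^[j] b = w) (hal : lev a = i + j) (hbl : lev b = i + j) :
    WalkDominates P a b := by
  induction j generalizing a b with
  | zero =>
    rw [Function.iterate_zero, id] at ha hb
    rwa [ha, hb]
  | succ j ih =>
    rw [Function.iterate_succ_apply] at ha hb
    have h1 := hP.up a (by omega)
    have h2 := hP.up b (by omega)
    refine hch (P a) (P b) a b (by omega) (by omega) ?_ (ih ha hb (by omega) (by omega)) ?_ ?_
    · intro e
      rw [e] at ha
      exact hvw (ha.symm.trans hb)
    · exact hP.mem_forestChildren.2 ⟨by omega, rfl⟩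
    · exact hP.mem_forestChildren.2 ⟨by omega, rfl⟩

open Classical in
theorem IsLeveled.degree_parGraph {P : V → V} {lev : V → ℕ} (hP : IsLeveled P lev) (v : V) :
    (parGraph P).degree v = (forestChildren P v).card + if lev v = 0 then 0 else 1 := by
  rw [_root_.degree_parGraph (fun v hv => hP.rank_lt (v := v) hv)]
  congr 1
  refine if_congr ⟨fun h => ?_, hP.root v⟩ rfl rfl
  by_contra h0
  have := hP.up v h0
  rw [h] at this
  omega

open Classical in
theorem IsLeveled.degree_parGraph_attachRoot {P : V → V} {lev : V → ℕ} (hP : IsLeveled P lev) {r s : V}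
    (hrs : r ≠ s) (h0 : ∀ v, lev v = 0 ↔ v = r ∨ v = s) (v : V) :
    (parGraph (attachRoot P s r)).degree v = (forestChildren P v).card + 1 := by
  have hr : lev r = 0 := (h0 r).2 (Or.inl rfl)
  have hs : lev s = 0 := (h0 s).2 (Or.inr rfl)
  obtain ⟨rank, hrank⟩ := hP.exists_rank_attachRoot hr hrs
  rw [_root_.degree_parGraph hrank]
  by_cases hv : v = r
  · subst hv
    obtain ⟨h1, h2⟩ := forestChildren_attachRoot_self (hP.root s hs) hrs
    rw [h2, card_insert_of_notMem h1, attachRoot_of_ne hrs, hP.root v hr, if_pos rfl]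
  · rw [forestChildren_attachRoot_of_ne (hP.root s hs) hv, if_neg]
    by_cases hvs : v = s
    · subst hvs; rw [attachRoot_self]; exact hrs
    · rw [attachRoot_of_ne hvs]
      intro h
      have h1 : lev v ≠ 0 := fun h' => ((h0 v).1 h').elim hv hvs
      have := hP.up v h1
      rw [h] at this
      omega

/-- Root at `z`. Maximality leaves no gain in the sorted rearrangement, so all product sums from
level 1 on are extremal and domination spreads from `c₁` and `c₂` through their branches. -/
theorem IsWalkMaximal.branchGE_of_adj_adj (hG : G.IsTree) (hmax : IsWalkMaximal G) {z c₁ c₂ : V}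
    (h₁ : G.Adj z c₁) (h₂ : G.Adj z c₂) (hne : c₁ ≠ c₂) :
    BranchGE G z c₁ z c₂ ∨ BranchGE G z c₂ z c₁ := by
  classical
  set P := stepToward G z with hPdef
  have hP : IsLeveled P (G.dist z) := isLeveled_stepToward hG.1 z
  have hz : ∀ v, G.dist z v = 0 ↔ v = z := fun v => by
    rw [hG.1.dist_eq_zero_iff, eq_comm]
  obtain ⟨inst, Q, hQ, hcard⟩ := hP.exists_isSortedForest
  have hPG : parGraph P = G := hG.parGraph_stepToward z
  obtain ⟨hle, hlt⟩ := numClosedWalks_rooted_le hP hQ hcard hz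
  rw [hPG] at hle hlt
  have hdeg : ∀ v, (parGraph Q).degree v = G.degree v := fun v => by
    have e1 := hQ.toIsLeveled.degree_parGraph v
    have e2 := hP.degree_parGraph v
    rw [hPG] at e2
    rw [e1, ← hcard, ← e2]
  have hQc : (parGraph Q).Connected :=
    connected_parGraph (fun v hv => hQ.toIsLeveled.rank_lt (v := v) hv) fun v hv => by
      rw [← hz]
      by_contra h0
      have := hQ.up v h0
      rw [hv] at this
      omega
  have heq : ∀ k, childWalks P k z = childWalks Q k z := hlt.resolve_left fun h =>
    hmax (parGraph Q) (hG.of_degree_eq hQc hdeg) hdeg ⟨hle, h⟩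
  have hset : levelSet (G.dist z) 0 = {z} := by ext v; simp [hz]
  have hE1 : ∀ k, ∑ v ∈ levelSet (G.dist z) 1, rootedWalks P k v =
      ∑ v ∈ levelSet (G.dist z) 1, rootedWalks Q k v := fun k => by
    have i1 := hP.sum_levelSet_sum_children 0 (rootedWalks P k)
    have i2 := hQ.sum_levelSet_sum_children 0 (rootedWalks Q k)
    rw [zero_add] at i1 i2
    rw [← i1, ← i2, hset, sum_singleton, sum_singleton]
    exact heq k
  have hEE := fun i (hi : 1 ≤ i) => sum_childWalks_mul_childWalks_eq hP hQ hcard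
    (sum_rootedWalks_eq_of_le hP hQ hcard hi hE1)
  have htot := fun i (hi : 1 ≤ i) v w hv hw =>
    walkDominates_total (i := i) (v := v) (w := w) hP hQ hcard (hEE i hi) hv hw
  have hlev : ∀ c, G.Adj z c → G.dist z c = 1 := fun c hc => SimpleGraph.dist_eq_one_iff_adj.2 hc
  have main : ∀ c d, G.Adj z c → G.Adj z d → c ≠ d → WalkDominates P c d → BranchGE G z c z d := by
    intro c d hc hd hcd hdom j a b ha hb
    have hal := ha.2
    have hbl := hb.2
    -- The final length 0 turns walk domination into a comparison of numbers of children.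
    have := hdom.iterate hP (fun v w c d hv hvw hne hdom hc hd =>
      hdom.children hP hQ hcard (hEE _ hv) (htot _ (by omega)) rfl hvw.symm hne hc hd)
      (hlev c hc) (hlev d hd) hcd j (ha.iterate_stepToward hG hc) (hb.iterate_stepToward hG hd)
      (by omega) (by omega) 0
    rw [childWalks_zero, childWalks_zero] at this
    have e1 := hP.degree_parGraph a
    have e2 := hP.degree_parGraph b
    rw [hPG, if_neg (by omega)] at e1 e2
    rw [e1, e2]
    omega
  rcases htot 1 le_rfl c₁ c₂ (hlev _ h₁) (hlev _ h₂) with h | h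
  · exact Or.inl (main c₁ c₂ h₁ h₂ hne h)
  · exact Or.inr (main c₂ c₁ h₂ h₁ hne.symm h)

/-- The same argument with the edge as root. Extremality on level 0, where the ends of the edge lie,
comes from equality of the edge terms. -/
theorem IsWalkMaximal.branchGE_of_adj (hG : G.IsTree) (hmax : IsWalkMaximal G) {u v : V}
    (huv : G.Adj u v) : BranchGE G u v v u ∨ BranchGE G v u u v := by
  classical
  set P := edgeParent G u v with hPdef
  set lev : V → ℕ := fun w => min (G.dist u w) (G.dist v w) with hlevdef
  have hP : IsLeveled P lev := isLeveled_edgeParent hG huv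
  have h0 : ∀ w, lev w = 0 ↔ w = u ∨ w = v := fun w => by
    rw [hlevdef]
    constructor
    · intro hw
      rcases min_choice (G.dist u w) (G.dist v w) with h | h
      · dsimp only at hw; rw [h] at hw; exact Or.inl (hG.1.dist_eq_zero_iff.1 hw).symm
      · dsimp only at hw; rw [h] at hw; exact Or.inr (hG.1.dist_eq_zero_iff.1 hw).symm
    · rintro (rfl | rfl) <;> simp
  have hu0 : lev u = 0 := (h0 u).2 (Or.inl rfl)
  have hv0 : lev v = 0 := (h0 v).2 (Or.inr rfl)
  obtain ⟨inst, Q, hQ, hcard⟩ := hP.exists_isSortedForest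
  -- Putting the deleted edge back restores the tree rooted at `u`.
  have hPG : parGraph (attachRoot P v u) = G := by
    have : attachRoot P v u = stepToward G u := by
      funext w
      by_cases hw : w = v
      · subst hw
        rw [attachRoot_self]
        refine hG.eq_stepToward huv.symm ?_
        rw [SimpleGraph.dist_self, SimpleGraph.dist_eq_one_iff_adj.2 huv]
      · rw [attachRoot_of_ne hw, hPdef, edgeParent, attachRoot_of_ne hw]
    rw [this, hG.parGraph_stepToward]
  obtain ⟨hle, hlt⟩ := numClosedWalks_edge_rooted_le hP hQ hcard huv.ne h0
  rw [hPG] at hle hlt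
  have hdeg : ∀ w, (parGraph (attachRoot Q v u)).degree w = G.degree w := fun w => by
    have e1 := hQ.toIsLeveled.degree_parGraph_attachRoot huv.ne h0 w
    have e2 := hP.degree_parGraph_attachRoot huv.ne h0 w
    rw [hPG] at e2
    rw [e1, ← hcard, ← e2]
  have hQc : (parGraph (attachRoot Q v u)).Connected := by
    obtain ⟨rank, hrank⟩ := hQ.toIsLeveled.exists_rank_attachRoot hu0 huv.ne
    refine connected_parGraph (r := u) hrank fun w hw => ?_
    by_cases hwv : w = v
    · subst hwv; rw [attachRoot_self] at hw; exact hw.symm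
    · rw [attachRoot_of_ne hwv] at hw
      by_contra hwu
      have := hQ.up w fun h => ((h0 w).1 h).elim hwu hwv
      rw [hw] at this
      omega
  obtain ⟨hsum, hEE0⟩ := hlt.resolve_left fun h =>
    hmax _ (hG.of_degree_eq hQc hdeg) hdeg ⟨hle, h⟩
  have hE1 : ∀ k, ∑ v ∈ levelSet lev 1, rootedWalks P k v =
      ∑ v ∈ levelSet lev 1, rootedWalks Q k v := fun k => by
    have i1 := hP.sum_levelSet_sum_children 0 (rootedWalks P k)
    have i2 := hQ.sum_levelSet_sum_children 0 (rootedWalks Q k)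
    rw [zero_add] at i1 i2
    rw [← i1, ← i2]
    exact hsum k
  have hEE : ∀ i k l, ∑ v ∈ levelSet lev i, childWalks P k v * childWalks P l v =
      ∑ v ∈ levelSet lev i, childWalks Q k v * childWalks Q l v := fun i => by
    rcases Nat.eq_zero_or_pos i with rfl | hi
    · exact hEE0
    · exact sum_childWalks_mul_childWalks_eq hP hQ hcard
        (sum_rootedWalks_eq_of_le hP hQ hcard hi hE1)
  have htot := fun i v w hv hw =>
    walkDominates_total (i := i) (v := v) (w := w) hP hQ hcard (hEE i) hv hw
  have main : ∀ r s, (r = u ∧ s = v ∨ r = v ∧ s = u) → WalkDominates P s r →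
      BranchGE G r s s r := by
    intro r s hrs hdom j a b ha hb
    have hne : s ≠ r := by
      rcases hrs with ⟨rfl, rfl⟩ | ⟨rfl, rfl⟩
      · exact huv.ne'
      · exact huv.ne
    have hs0 : lev s = 0 := by rcases hrs with ⟨rfl, rfl⟩ | ⟨rfl, rfl⟩ <;> assumption
    have hr0 : lev r = 0 := by rcases hrs with ⟨rfl, rfl⟩ | ⟨rfl, rfl⟩ <;> assumption
    have hal : lev a = 0 + j := by
      have := ha.1; have := ha.2
      rw [hlevdef]
      rcases hrs with ⟨rfl, rfl⟩ | ⟨rfl, rfl⟩ <;> dsimp only <;> omega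
    have hbl : lev b = 0 + j := by
      have := hb.1; have := hb.2
      rw [hlevdef]
      rcases hrs with ⟨rfl, rfl⟩ | ⟨rfl, rfl⟩ <;> dsimp only <;> omega
    have := hdom.iterate hP (fun v w c d _ hvw hne hdom hc hd =>
      hdom.children hP hQ hcard (hEE _) (htot _) rfl hvw.symm hne hc hd)
      hs0 hr0 hne j (ha.iterate_edgeParent hG huv hrs)
      (hb.iterate_edgeParent hG huv (by tauto)) hal hbl 0
    rw [childWalks_zero, childWalks_zero] at this
    have e1 := hP.degree_parGraph_attachRoot huv.ne h0 a
    have e2 := hP.degree_parGraph_attachRoot huv.ne h0 b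
    rw [hPG] at e1 e2
    rw [e1, e2]
    omega
  rcases htot 0 u v hu0 hv0 with h | h
  · exact Or.inr (main v u (Or.inr ⟨rfl, rfl⟩) h)
  · exact Or.inl (main u v (Or.inl ⟨rfl, rfl⟩) h)

end BranchComparison

/-! ### Finding the root of a greedy tree -/

section GreedyStructure

open Finset

variable {V : Type*} {G : SimpleGraph V}

/-- Seen from another neighbor `b` of `a`, the branch toward `r` lies in the branch toward `a`, one
step deeper. -/
theorem InBranch.lift (hG : G.IsTree) {a b r x : V} (hb : G.Adj a b) (hr : G.Adj a r) (hne : b ≠ r)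
    {t : ℕ} (hx : InBranch G a r t x) : InBranch G b a (t + 1) x := by
  refine ⟨hx.2, ?_⟩
  have h1 := hx.1
  have h2 := hx.2
  rcases hG.dist_eq_dist_add_one_of_adj x hb with h | h
  · refine absurd (hG.eq_of_adj_of_dist hb hr h.symm ?_) hne
    rw [G.dist_comm, h1, G.dist_comm, h2]
  · rw [G.dist_comm, h, G.dist_comm, h2]

theorem InBranch.step (hG : G.IsTree) {x y : V} (hxy : G.Adj x y) {j : ℕ} {b : V}
    (hb : InBranch G x y (j + 1) b) : InBranch G x y j (stepToward G x b) := by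
  have h1 : G.dist x y = 1 := SimpleGraph.dist_eq_one_iff_adj.2 hxy
  have h2 := hb.2
  obtain ⟨h3, h4⟩ := dist_stepToward_of_dist_add hG hb.1 (r := x) (by omega)
  exact ⟨h3, by omega⟩

theorem dist_iterate_stepToward (hG : G.IsTree) (r v : V) {t : ℕ} (ht : t ≤ G.dist r v) :
    G.dist r ((stepToward G r)^[t] v) + t = G.dist r v ∧ G.dist ((stepToward G r)^[t] v) v = t := by
  have h1 : G.dist r ((stepToward G r)^[t] v) + t = G.dist r v ∧
      G.dist ((stepToward G r)^[t] v) v ≤ t := by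
    induction t with
    | zero => simp
    | succ t ih =>
      obtain ⟨i1, i2⟩ := ih (by omega)
      rw [Function.iterate_succ_apply']
      set u := (stepToward G r)^[t] v
      have hu : u ≠ r := by
        intro e
        rw [e, SimpleGraph.dist_self] at i1
        omega
      obtain ⟨h1, h2⟩ := stepToward_spec hG.1 hu
      have := hG.1.dist_triangle (u := stepToward G r u) (v := u) (w := v)
      rw [SimpleGraph.dist_eq_one_iff_adj.2 h1.symm] at this
      omega
  have := hG.1.dist_triangle (u := r) (v := (stepToward G r)^[t] v) (w := v)
  omega

variable [Fintype V]

open Classical in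
theorem InBranch.two_le_degree (hG : G.IsTree) {x y : V} (hxy : G.Adj x y) {j : ℕ} {b : V}
    (hb : InBranch G x y (j + 1) b) : 2 ≤ G.degree (stepToward G x b) := by
  have hb' := hb.step hG hxy
  have hbx : b ≠ x := by rintro rfl; have := hb.2; rw [SimpleGraph.dist_self] at this; omega
  have hbx' : stepToward G x b ≠ x := fun h => by
    have := hb'.2
    rw [h, SimpleGraph.dist_self] at this
    omega
  obtain ⟨h1, h2⟩ := stepToward_spec hG.1 hbx
  obtain ⟨h3, h4⟩ := stepToward_spec hG.1 hbx'
  rw [← SimpleGraph.card_neighborFinset_eq_degree, Nat.succ_le_iff, one_lt_card]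
  refine ⟨b, by simpa using h1.symm, stepToward G x (stepToward G x b), by simpa using h3, ?_⟩
  intro e
  rw [← e] at h4
  omega

open Classical in
theorem InBranch.exists_succ (hG : G.IsTree) {x y : V} (hxy : G.Adj x y) {j : ℕ} {a : V}
    (ha : InBranch G x y j a) (hdeg : 2 ≤ G.degree a) : ∃ a', InBranch G x y (j + 1) a' := by
  rw [← SimpleGraph.card_neighborFinset_eq_degree, Nat.succ_le_iff] at hdeg
  obtain ⟨a', ha', hne⟩ := exists_mem_ne hdeg (stepToward G x a)
  rw [SimpleGraph.mem_neighborFinset] at ha'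
  have h1 : G.dist x y = 1 := SimpleGraph.dist_eq_one_iff_adj.2 hxy
  have h2 := ha.1
  have h3 := ha.2
  have hx : G.dist x a' = G.dist x a + 1 := by
    rcases hG.dist_eq_dist_add_one_of_adj x ha' with h | h
    · exact absurd (hG.eq_stepToward ha' h.symm) hne
    · exact h
  have t := hG.1.dist_triangle (u := x) (v := y) (w := a')
  refine ⟨a', ?_, by omega⟩
  rcases hG.dist_eq_dist_add_one_of_adj y ha' with h | h <;> omega

/-- A depth-`j` vertex of the smaller branch with a child has degree at least 2, which forces degree
at least 2, hence a child, in the larger branch. -/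
theorem BranchGE.nonempty (hG : G.IsTree) {x y x' y' : V} (hxy : G.Adj x y) (hxy' : G.Adj x' y')
    (h : BranchGE G x y x' y') {j : ℕ} {b : V} (hb : InBranch G x' y' j b) :
    ∃ a, InBranch G x y j a := by
  classical
  induction j generalizing b with
  | zero => exact ⟨y, SimpleGraph.dist_self, SimpleGraph.dist_eq_one_iff_adj.2 hxy⟩
  | succ j ih =>
    obtain ⟨a, ha⟩ := ih (hb.step hG hxy')
    exact ha.exists_succ hG hxy
      ((hb.two_le_degree hG hxy').trans (h j a _ ha (hb.step hG hxy')))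

theorem BranchGE.trans (hG : G.IsTree) {x y x' y' x'' y'' : V} (hxy' : G.Adj x' y')
    (hxy'' : G.Adj x'' y'') (h : BranchGE G x y x' y') (h' : BranchGE G x' y' x'' y'') :
    BranchGE G x y x'' y'' := by
  intro j a c ha hc
  obtain ⟨b, hb⟩ := h'.nonempty hG hxy' hxy'' hc
  exact (h' j b c hb hc).trans (h j a b ha hb)

/-- Branches that start in the same vertex are comparable, and so are the two branches along an
edge. -/
structure HasComparableBranches (G : SimpleGraph V) : Prop where
  adj_adj : ∀ {z c₁ c₂}, G.Adj z c₁ → G.Adj z c₂ → c₁ ≠ c₂ →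
    BranchGE G z c₁ z c₂ ∨ BranchGE G z c₂ z c₁
  adj : ∀ {u v}, G.Adj u v → BranchGE G u v v u ∨ BranchGE G v u u v

/-- Otherwise the branches from `a` toward `r` and toward `b` would each reach one step deeper than
the other, and the tree would be infinite. -/
theorem HasComparableBranches.propagate (hG : G.IsTree) (hc : HasComparableBranches G) {a r b : V}
    (hr : G.Adj a r) (hb : G.Adj a b) (hne : b ≠ r) (h : BranchGE G a r r a) :
    BranchGE G b a a b := by
  refine (hc.adj hb).resolve_left fun h' => ?_
  have key : ∀ t, (∃ x, InBranch G a r t x) ∨ ∃ x, InBranch G a b t x := by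
    intro t
    induction t with
    | zero => exact Or.inl ⟨r, SimpleGraph.dist_self, SimpleGraph.dist_eq_one_iff_adj.2 hr⟩
    | succ t ih =>
      rcases ih with ⟨x, hx⟩ | ⟨x, hx⟩
      · exact Or.inr (h'.nonempty hG hb hb.symm (hx.lift hG hb hr hne))
      · exact Or.inl (h.nonempty hG hr hr.symm (hx.lift hG hr hb hne.symm))
  have hbound : ∀ x, G.dist a x ≤ univ.sup fun x => G.dist a x := fun x =>
    le_sup (f := fun x => G.dist a x) (mem_univ x)
  rcases key (univ.sup fun x => G.dist a x) with ⟨x, hx⟩ | ⟨x, hx⟩ <;>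
  · have := hbound x
    have := hx.2
    omega

/-- If every vertex had an adjacent larger side, one could follow such edges without turning back,
and the set of vertices ahead would shrink forever. -/
theorem HasComparableBranches.exists_root (hG : G.IsTree) (hc : HasComparableBranches G) :
    ∃ r, ∀ a, G.Adj r a → BranchGE G a r r a := by
  classical
  by_contra hno
  push Not at hno
  have key : ∀ n r a, G.Adj r a → ¬ BranchGE G a r r a →
      (univ.filter fun w => G.dist a w < G.dist r w).card = n → False := by
    intro n
    induction n using Nat.strong_induction_on with
    | _ n ih =>
      intro r a hra hbad hn
      have hgood := (hc.adj hra).resolve_right hbad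
      obtain ⟨a', haa', hbad'⟩ := hno a
      have hne : a' ≠ r := by rintro rfl; exact hbad' hgood
      refine ih _ ?_ a a' haa' hbad' rfl
      rw [← hn]
      refine card_lt_card ((ssubset_iff_of_subset fun w hw => ?_).2 ⟨a, ?_, ?_⟩)
      · rw [mem_filter] at hw ⊢
        refine ⟨mem_univ _, ?_⟩
        rw [G.dist_comm, G.dist_comm (u := r)]
        rcases hG.dist_eq_dist_add_one_of_adj w hra with h | h
        · omega
        · refine absurd (hG.eq_of_adj_of_dist haa' hra.symm ?_ h.symm) hne
          have := hw.2
          rw [G.dist_comm, G.dist_comm (u := a)] at this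
          rcases hG.dist_eq_dist_add_one_of_adj w haa' with h' | h' <;> omega
      · simp [SimpleGraph.dist_self, SimpleGraph.dist_eq_one_iff_adj.2 hra]
      · simp
  obtain ⟨r⟩ := hG.1.nonempty
  obtain ⟨a, hra, hbad⟩ := hno r
  exact key _ r a hra hbad rfl

theorem HasComparableBranches.branchGE_of_root (hG : G.IsTree) (hc : HasComparableBranches G) {r : V}
    (hr : ∀ a, G.Adj r a → BranchGE G a r r a) {z c : V} (hzc : G.Adj z c)
    (hd : G.dist r c = G.dist r z + 1) : BranchGE G c z z c := by
  induction h : G.dist r z generalizing z c with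
  | zero =>
    rw [hG.1.dist_eq_zero_iff] at h
    subst h
    exact hr c hzc
  | succ n ih =>
    have hzr : z ≠ r := by rintro rfl; rw [SimpleGraph.dist_self] at h; omega
    obtain ⟨h1, h2⟩ := stepToward_spec hG.1 hzr
    refine hc.propagate hG h1 hzc ?_ (ih h1.symm h2.symm (by omega))
    rintro rfl
    omega

-- Let `c` be the last ancestor of `b` before the path meets the ancestors of `a`, with parent `z`.
-- Across the edge between `z` and `c`, both `a` and `b` sit at depth `t`, and the side of `z`
-- dominates.
open Classical in
theorem HasComparableBranches.degree_le_of_dist (hG : G.IsTree) (hc : HasComparableBranches G) {r : V}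
    (hr : ∀ a, G.Adj r a → BranchGE G a r r a) {a b : V} (hab : G.dist r b = G.dist r a + 1) :
    G.degree b ≤ G.degree a := by
  set P := stepToward G r with hP
  have hex : ∃ t, t ≤ G.dist r a ∧ P^[t] a = P^[t + 1] b := by
    refine ⟨G.dist r a, le_rfl, ?_⟩
    have h1 := (dist_iterate_stepToward hG r a le_rfl).1
    have h2 := (dist_iterate_stepToward hG r b hab.ge).1
    rw [← hP] at h1 h2
    have h1' := hG.1.dist_eq_zero_iff.1 (show G.dist r (P^[G.dist r a] a) = 0 by omega)
    have h2' := hG.1.dist_eq_zero_iff.1 (show G.dist r (P^[G.dist r a + 1] b) = 0 by omega)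
    rw [← h1', ← h2']
  obtain ⟨⟨ht, heq⟩, hmin⟩ := And.intro (Nat.find_spec hex) fun {m} => Nat.find_min hex (m := m)
  set t := Nat.find hex
  set c := P^[t] b with hcdef
  have hz : P^[t + 1] b = P c := Function.iterate_succ_apply' _ _ _
  obtain ⟨b1, b2⟩ := dist_iterate_stepToward hG r b (t := t) (by omega)
  obtain ⟨b3, b4⟩ := dist_iterate_stepToward hG r b (t := t + 1) (by omega)
  obtain ⟨a1, a2⟩ := dist_iterate_stepToward hG r a ht
  rw [← hP] at b1 b2 b3 b4 a1 a2
  rw [heq] at a1 a2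
  rw [hz] at a1 a2 b3 b4
  rw [← hcdef] at b1 b2
  have hcr : c ≠ r := by
    intro e
    rw [e, SimpleGraph.dist_self] at b1
    omega
  obtain ⟨h1, h2⟩ := stepToward_spec hG.1 hcr
  rw [← hP] at h1 h2
  refine hc.branchGE_of_root hG hr h1.symm h2.symm t a b ⟨a2, ?_⟩ ⟨b2, b4⟩
  rcases hG.dist_eq_dist_add_one_of_adj a h1 with h | h
  · rw [G.dist_comm, h, G.dist_comm, a2]
  -- If `a` were below `c`, the two lines of ancestors would already meet at `c`, contradicting
  -- minimality of `t`.
  · exfalso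
    rw [G.dist_comm (u := a), a2, G.dist_comm] at h
    have := iterate_stepToward_eq hG (r := r) (v := c) (a := a) (j := t - 1) (by omega) (by omega)
    refine hmin (m := t - 1) (by omega) ⟨by omega, ?_⟩
    rw [← hP] at this
    rw [this, hcdef]
    congr 1
    omega

end GreedyStructure

/-! ### Ordering the levels -/

section LevelOrder

open Finset

variable {V : Type*} [Fintype V] {G : SimpleGraph V}

open Classical in
/-- On the levels of the tree `G` with root `r`, the function `pos` orders the vertices by
non-increasing degree, and the blocks of children as their parents. -/
structure IsLevelOrder (G : SimpleGraph V) (r : V) (pos : V → ℕ) : Prop where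
  inj : ∀ v w, G.dist r v = G.dist r w → pos v = pos w → v = w
  mono : ∀ v w, G.dist r v = G.dist r w → v ≠ r → w ≠ r → pos v ≤ pos w →
    pos (stepToward G r v) ≤ pos (stepToward G r w)
  degree_le : ∀ v w, G.dist r v = G.dist r w → pos v ≤ pos w → G.degree w ≤ G.degree v

open Classical in
/-- At each depth, no degree of a descendant of `v` is smaller than one of a descendant of `w`. -/
def DescendantsGE (G : SimpleGraph V) (r v w : V) : Prop :=
  ∀ j a b, G.dist v a = j → G.dist r a = G.dist r v + j → G.dist w b = j →
    G.dist r b = G.dist r w + j → G.degree b ≤ G.degree a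

theorem BranchGE.descendantsGE (hG : G.IsTree) {r z c d : V} (hc : G.Adj z c) (hd : G.Adj z d)
    (hcr : G.dist r c = G.dist r z + 1) (hdr : G.dist r d = G.dist r z + 1)
    (h : BranchGE G z c z d) : DescendantsGE G r c d := by
  have key : ∀ e x j, G.Adj z e → G.dist r e = G.dist r z + 1 → G.dist e x = j →
      G.dist r x = G.dist r e + j → InBranch G z e j x := fun e x j he her hex hrx => by
    refine ⟨hex, ?_⟩
    have t1 := hG.1.dist_triangle (u := z) (v := e) (w := x)
    have t2 := hG.1.dist_triangle (u := r) (v := z) (w := x)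
    rw [SimpleGraph.dist_eq_one_iff_adj.2 he] at t1
    omega
  intro j a b h1 h2 h3 h4
  exact h j a b (key c a j hc hcr h1 h2) (key d b j hd hdr h3 h4)

/-- Descendants at depth `j` are descendants of the parent at depth `j + 1`. -/
theorem DescendantsGE.of_stepToward (hG : G.IsTree) {r v w : V} (hv : v ≠ r) (hw : w ≠ r)
    (h : DescendantsGE G r (stepToward G r v) (stepToward G r w)) : DescendantsGE G r v w := by
  have key : ∀ e x j, e ≠ r → G.dist e x = j → G.dist r x = G.dist r e + j →
      G.dist (stepToward G r e) x = j + 1 ∧ G.dist r x = G.dist r (stepToward G r e) + (j + 1) :=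
    fun e x j he hex hrx => by
      obtain ⟨h1, h2⟩ := stepToward_spec hG.1 he
      have t1 := hG.1.dist_triangle (u := stepToward G r e) (v := e) (w := x)
      have t2 := hG.1.dist_triangle (u := r) (v := stepToward G r e) (w := x)
      rw [SimpleGraph.dist_eq_one_iff_adj.2 h1.symm] at t1
      omega
  intro j a b h1 h2 h3 h4
  obtain ⟨i1, i2⟩ := key v a j hv h1 h2
  obtain ⟨i3, i4⟩ := key w b j hw h3 h4
  exact h (j + 1) a b i1 i2 i3 i4

open Classical in
/-- The number of siblings of `c` whose branches strictly dominate the one of `c`. -/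
noncomputable def siblingRank (G : SimpleGraph V) (r c : V) : ℕ :=
  (univ.filter fun x => (x ≠ r ∧ stepToward G r x = stepToward G r c) ∧
    BranchGE G (stepToward G r c) x (stepToward G r c) c ∧
    ¬ BranchGE G (stepToward G r c) c (stepToward G r c) x).card

/-- A ranking without ties that refines `siblingRank`. -/
noncomputable def siblingKey (G : SimpleGraph V) (r c : V) : ℕ :=
  siblingRank G r c * Fintype.card V + (Fintype.equivFin V c : ℕ)

/-- The position of `v` in the lexicographic order of paths from `r`, for the order `siblingKey` on
siblings. -/
noncomputable def levelPosAux (G : SimpleGraph V) (r : V) : ℕ → V → ℕ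
  | 0, _ => 0
  | t + 1, v => levelPosAux G r t (stepToward G r v) *
      ((Fintype.card V + 1) * Fintype.card V) + siblingKey G r v

/-- The position of `v` on its level. -/
noncomputable def levelPos (G : SimpleGraph V) (r v : V) : ℕ :=
  levelPosAux G r (G.dist r v) v

/-- Sibling keys are thus digits in the base used by `levelPosAux`, whose numerical order is then
lexicographic. -/
theorem siblingKey_lt (r c : V) :
    siblingKey G r c < (Fintype.card V + 1) * Fintype.card V := by
  have h1 : siblingRank G r c ≤ Fintype.card V := card_le_univ _
  have h2 := (Fintype.equivFin V c).2
  rw [siblingKey]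
  nlinarith

theorem siblingKey_injective (r : V) : Function.Injective (siblingKey G r) := fun c d h => by
  rw [siblingKey, siblingKey] at h
  have h' := congrArg (· % Fintype.card V) h
  simp only [Nat.mul_add_mod_self_right, Nat.mod_eq_of_lt (Fintype.equivFin V c).2,
    Nat.mod_eq_of_lt (Fintype.equivFin V d).2] at h'
  exact (Fintype.equivFin V).injective (Fin.ext h')

theorem levelPos_eq (hG : G.IsTree) {r v : V} (hv : v ≠ r) : levelPos G r v =
    levelPos G r (stepToward G r v) * ((Fintype.card V + 1) * Fintype.card V) + siblingKey G r v := by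
  rw [levelPos, levelPos, ← (stepToward_spec hG.1 hv).2, levelPosAux]

/-- If `w` strictly dominated `v`, every sibling strictly above `w` would be strictly above `v`, and
so would `w` itself, giving `w` the smaller rank. -/
theorem HasComparableBranches.branchGE_of_siblingKey_lt (hG : G.IsTree)
    (hc : HasComparableBranches G) {r v w : V} (hv : v ≠ r) (hw : w ≠ r)
    (hs : stepToward G r v = stepToward G r w) (h : siblingKey G r v < siblingKey G r w) :
    BranchGE G (stepToward G r v) v (stepToward G r v) w := by
  classical
  have hne : v ≠ w := by rintro rfl; exact lt_irrefl _ h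
  have hzv := (stepToward_spec hG.1 hv).1.symm
  have hzw := (stepToward_spec hG.1 hw).1.symm
  rw [← hs] at hzw
  set z := stepToward G r v with hz
  by_contra hno
  have hwv := (hc.adj_adj hzv hzw hne).resolve_left hno
  have hlt : siblingRank G r w < siblingRank G r v := by
    rw [siblingRank, siblingRank, ← hs, ← hz]
    refine card_lt_card ((ssubset_iff_of_subset fun x hx => ?_).2 ⟨w, ?_, ?_⟩)
    · rw [mem_filter] at hx ⊢
      obtain ⟨-, ⟨hxr, hxz⟩, h1, h2⟩ := hx
      have hzx := (stepToward_spec hG.1 hxr).1.symm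
      rw [hxz] at hzx
      exact ⟨mem_univ _, ⟨hxr, hxz⟩, h1.trans hG hzw hzv hwv,
        fun h3 => hno (h3.trans hG hzx hzw h1)⟩
    · exact mem_filter.2 ⟨mem_univ _, ⟨hw, hs.symm⟩, hwv, hno⟩
    · rw [mem_filter]
      rintro ⟨-, -, h1, h2⟩
      exact h2 h1
  have h3 := (Fintype.equivFin V v).2
  have h4 := (Fintype.equivFin V w).2
  rw [siblingKey, siblingKey] at h
  nlinarith

theorem levelPos_inj (hG : G.IsTree) {r v w : V} (hd : G.dist r v = G.dist r w)
    (h : levelPos G r v = levelPos G r w) : v = w := by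
  by_cases hv : v = r
  · subst hv
    rw [SimpleGraph.dist_self] at hd
    exact hG.1.dist_eq_zero_iff.1 hd.symm
  · have hw : w ≠ r := by
      rintro rfl
      rw [SimpleGraph.dist_self, hG.1.dist_eq_zero_iff] at hd
      exact hv hd.symm
    rw [levelPos_eq hG hv, levelPos_eq hG hw] at h
    have h' := congrArg (· % ((Fintype.card V + 1) * Fintype.card V)) h
    simp only [Nat.mul_add_mod_self_right, Nat.mod_eq_of_lt (siblingKey_lt _ _)] at h'
    exact siblingKey_injective r h'

theorem levelPos_mono (hG : G.IsTree) {r v w : V} (hv : v ≠ r) (hw : w ≠ r)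
    (h : levelPos G r v ≤ levelPos G r w) :
    levelPos G r (stepToward G r v) ≤ levelPos G r (stepToward G r w) := by
  by_contra hc
  push Not at hc
  rw [levelPos_eq hG hv, levelPos_eq hG hw] at h
  have := siblingKey_lt (G := G) r w
  nlinarith

/-- Siblings are compared by their keys; for different parents the comparison is inherited from the
parents. -/
theorem HasComparableBranches.descendantsGE_of_levelPos_lt (hG : G.IsTree)
    (hc : HasComparableBranches G) {r v w : V} (hd : G.dist r v = G.dist r w)
    (h : levelPos G r v < levelPos G r w) : DescendantsGE G r v w := by
  induction hn : G.dist r v generalizing v w with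
  | zero =>
    rw [← hG.1.dist_eq_zero_iff.1 hn, ← hG.1.dist_eq_zero_iff.1 (hd.symm.trans hn)] at h
    exact absurd h (lt_irrefl _)
  | succ n ih =>
    have hv : v ≠ r := by rintro rfl; rw [SimpleGraph.dist_self] at hn; omega
    have hw : w ≠ r := by rintro rfl; rw [SimpleGraph.dist_self] at hd; omega
    obtain ⟨h1, h2⟩ := stepToward_spec hG.1 hv
    obtain ⟨h3, h4⟩ := stepToward_spec hG.1 hw
    by_cases hs : stepToward G r v = stepToward G r w
    · rw [levelPos_eq hG hv, levelPos_eq hG hw, hs] at h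
      have := hc.branchGE_of_siblingKey_lt hG hv hw hs (by omega)
      rw [← hs] at h3 h4
      exact this.descendantsGE hG h1.symm h3.symm h2.symm h4.symm
    · refine DescendantsGE.of_stepToward hG hv hw (ih (by omega) ?_ (by omega))
      refine lt_of_le_of_ne (levelPos_mono hG hv hw h.le) fun e => hs (levelPos_inj hG (by omega) e)

theorem HasComparableBranches.isLevelOrder (hG : G.IsTree) (hc : HasComparableBranches G) (r : V) :
    IsLevelOrder G r (levelPos G r) where
  inj _ _ := levelPos_inj hG
  mono _ _ _ := levelPos_mono hG
  degree_le v w hd h := by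
    rcases h.eq_or_lt with h | h
    · rw [levelPos_inj hG hd h]
    · exact hc.descendantsGE_of_levelPos_lt hG hd h 0 v w SimpleGraph.dist_self rfl
        SimpleGraph.dist_self rfl

end LevelOrder

/-! ### From a level order to the level greedy forest -/

section LevelGreedyIso

open Finset

variable {V : Type*} [Fintype V] {G : SimpleGraph V} {r : V} {pos : V → ℕ}

/-- The number of vertices that precede `v` on its level. -/
noncomputable def levelIndex (G : SimpleGraph V) (r : V) (pos : V → ℕ) (v : V) : ℕ :=
  ((levelSet (G.dist r) (G.dist r v)).filter fun w => pos w < pos v).card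

theorem length_leveledDegreeSequence (G : SimpleGraph V) (r : V) (i : ℕ) :
    (leveledDegreeSequence G r i).length = (levelSet (G.dist r) i).card := by
  rw [leveledDegreeSequence, Multiset.length_sort, Multiset.card_map, card_val, levelSet]

open Classical in
theorem mem_leveledDegreeSequence {G : SimpleGraph V} {r : V} {i d : ℕ} :
    d ∈ leveledDegreeSequence G r i ↔ ∃ v, G.dist r v = i ∧ G.degree v = d := by
  simp [leveledDegreeSequence]

theorem levelIndex_lt (v : V) :
    levelIndex G r pos v < (levelSet (G.dist r) (G.dist r v)).card :=
  card_lt_card ((ssubset_iff_of_subset (filter_subset _ _)).2 ⟨v, by simp, by simp⟩)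

theorem levelIndex_lt_iff {v w : V} (hd : G.dist r v = G.dist r w) :
    levelIndex G r pos v < levelIndex G r pos w ↔ pos v < pos w := by
  have hlt : ∀ {v w : V}, G.dist r v = G.dist r w → pos v < pos w →
      levelIndex G r pos v < levelIndex G r pos w := fun {v w} hd h => by
    rw [levelIndex, levelIndex, hd]
    refine card_lt_card ((ssubset_iff_of_subset fun x hx => ?_).2 ⟨v, by simp [hd, h], by simp⟩)
    rw [mem_filter] at hx ⊢
    exact ⟨hx.1, hx.2.trans h⟩
  refine ⟨fun h => ?_, hlt hd⟩
  by_contra hc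
  rcases (not_lt.1 hc).eq_or_lt with he | hl
  · rw [levelIndex, levelIndex, hd, he] at h
    exact lt_irrefl _ h
  · exact absurd h (hlt hd.symm hl).not_gt

theorem levelIndex_le_iff {v w : V} (hd : G.dist r v = G.dist r w) :
    levelIndex G r pos v ≤ levelIndex G r pos w ↔ pos v ≤ pos w := by
  rw [← not_lt, ← not_lt, levelIndex_lt_iff hd.symm]

theorem IsLevelOrder.levelIndex_inj (h : IsLevelOrder G r pos) {v w : V}
    (hd : G.dist r v = G.dist r w) (he : levelIndex G r pos v = levelIndex G r pos w) : v = w :=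
  h.inj v w hd (le_antisymm ((levelIndex_le_iff hd).1 he.le) ((levelIndex_le_iff hd.symm).1 he.ge))

theorem IsLevelOrder.image_levelIndex (h : IsLevelOrder G r pos) (i : ℕ) :
    (levelSet (G.dist r) i).image (levelIndex G r pos) = range (levelSet (G.dist r) i).card := by
  refine eq_of_subset_of_card_le (fun m hm => ?_) ?_
  · obtain ⟨v, hv, rfl⟩ := mem_image.1 hm
    rw [mem_levelSet] at hv
    subst hv
    exact mem_range.2 (levelIndex_lt v)
  · rw [card_range, card_image_of_injOn]
    intro v hv w hw he
    rw [mem_coe, mem_levelSet] at hv hw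
    exact h.levelIndex_inj (hv.trans hw.symm) he

theorem IsLevelOrder.exists_levelIndex_eq (h : IsLevelOrder G r pos) {i m : ℕ}
    (hm : m < (levelSet (G.dist r) i).card) : ∃ v, G.dist r v = i ∧ levelIndex G r pos v = m := by
  rw [← mem_range, ← h.image_levelIndex, mem_image] at hm
  simpa using hm

open Classical in
/-- The vertex with index `m` on level `i`. -/
noncomputable def levelVertex (G : SimpleGraph V) (r : V) (pos : V → ℕ) (i m : ℕ) : V :=
  if h : ∃ v, G.dist r v = i ∧ levelIndex G r pos v = m then h.choose else r

theorem IsLevelOrder.levelVertex_spec (h : IsLevelOrder G r pos) {i m : ℕ}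
    (hm : m < (levelSet (G.dist r) i).card) : G.dist r (levelVertex G r pos i m) = i ∧
      levelIndex G r pos (levelVertex G r pos i m) = m := by
  have h' := h.exists_levelIndex_eq hm
  rw [levelVertex, dif_pos h']
  exact h'.choose_spec

-- Listing a level in the given order already yields a non-increasing list of its degrees, and the
-- sorted list is unique.
open Classical in
theorem IsLevelOrder.leveledDegreeSequence_eq (h : IsLevelOrder G r pos) (i : ℕ) :
    leveledDegreeSequence G r i = (List.range (levelSet (G.dist r) i).card).map
      fun m => G.degree (levelVertex G r pos i m) := by
  refine List.Perm.eq_of_pairwise' (r := fun a b => b ≤ a) ?_ ?_ ?_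
  · exact Multiset.pairwise_sort _ _
  · rw [List.pairwise_map]
    refine List.pairwise_lt_range.imp_of_mem fun {m n} hm hn hmn => ?_
    rw [List.mem_range] at hm hn
    obtain ⟨h1, h2⟩ := h.levelVertex_spec hm
    obtain ⟨h3, h4⟩ := h.levelVertex_spec hn
    refine h.degree_le _ _ (h1.trans h3.symm) ((levelIndex_le_iff (h1.trans h3.symm)).1 ?_)
    rw [h2, h4]
    exact hmn.le
  · rw [← Multiset.coe_eq_coe, leveledDegreeSequence, Multiset.sort_eq, ← Multiset.map_coe]
    have himg : (univ.filter fun v => G.dist r v = i) =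
        (range (levelSet (G.dist r) i).card).image (levelVertex G r pos i) := by
      ext v
      rw [mem_filter, mem_image]
      constructor
      · rintro ⟨-, rfl⟩
        obtain ⟨h1, h2⟩ := h.levelVertex_spec (levelIndex_lt (pos := pos) v)
        exact ⟨levelIndex G r pos v, mem_range.2 (levelIndex_lt v), h.levelIndex_inj h1 h2⟩
      · rintro ⟨m, hm, rfl⟩
        exact ⟨mem_univ _, (h.levelVertex_spec (mem_range.1 hm)).1⟩
    rw [himg, image_val_of_injOn, Multiset.map_map]
    · rfl
    · intro m hm n hn hmn
      rw [← (h.levelVertex_spec (mem_range.1 hm)).2, hmn, (h.levelVertex_spec (mem_range.1 hn)).2]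

theorem IsLevelOrder.childBlockStart_eq (hG : G.IsTree) (h : IsLevelOrder G r pos) {i j : ℕ}
    (hj : j ≤ (levelSet (G.dist r) i).card) :
    childBlockStart (leveledDegreeSequence G r) i j = ((levelSet (G.dist r) (i + 1)).filter fun c =>
      levelIndex G r pos (stepToward G r c) < j).card := by
  classical
  have hP := isLeveled_stepToward hG.1 r
  rw [childBlockStart, h.leveledDegreeSequence_eq, ← List.map_take, List.take_range, min_eq_left hj,
    List.map_map, card_eq_sum_card_fiberwise (f := fun c => levelIndex G r pos (stepToward G r c))
    (t := range j)]
  · have : ∀ f : ℕ → ℕ, ((List.range j).map f).sum = ∑ m ∈ range j, f m := fun f => rfl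
    rw [this]
    refine sum_congr rfl fun m hm => ?_
    have hmj := mem_range.1 hm
    obtain ⟨h1, h2⟩ := h.levelVertex_spec (hmj.trans_le hj)
    set u := levelVertex G r pos i m
    have hdeg := hP.degree_parGraph u
    rw [hG.parGraph_stepToward] at hdeg
    have hcard : numChildren i (G.degree u) = (forestChildren (stepToward G r) u).card := by
      rw [numChildren]
      split_ifs at hdeg ⊢ <;> omega
    simp only [Function.comp]
    rw [hcard]
    congr 1
    ext c
    simp only [mem_filter, mem_levelSet]
    rw [hP.mem_forestChildren]
    constructor
    · rintro ⟨hc0, hcu⟩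
      have := hP.up c hc0
      rw [hcu] at this ⊢
      exact ⟨⟨by omega, by omega⟩, h2⟩
    · rintro ⟨⟨hc, -⟩, he⟩
      have := hP.up c (by omega)
      exact ⟨by omega, h.levelIndex_inj (by omega) (he.trans h2.symm)⟩
  · intro c hc
    rw [mem_coe, mem_filter] at hc
    exact mem_coe.2 (mem_range.2 hc.2)

theorem childBlockStart_mono (D : ℕ → List ℕ) (i : ℕ) {j j' : ℕ} (h : j ≤ j') :
    childBlockStart D i j ≤ childBlockStart D i j' := by
  rw [childBlockStart, childBlockStart]
  exact ((List.take_sublist_take_left h).map _).sum_le_sum fun _ _ => Nat.zero_le _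

/-- The embedding of a tree with ordered levels into the level greedy forest. -/
noncomputable def levelGreedyMap (G : SimpleGraph V) (r : V) (pos : V → ℕ) (v : V) :
    Σ i : ℕ, Fin (leveledDegreeSequence G r i).length :=
  ⟨G.dist r v, levelIndex G r pos v, by
    rw [length_leveledDegreeSequence]; exact levelIndex_lt v⟩

/-- Blocks of children are ordered as their parents, so the block of a vertex starts after all
children of its predecessors. Blocks of different indices are disjoint, which gives the converse. -/
theorem IsLevelOrder.isGreedyChild_iff (hG : G.IsTree) (h : IsLevelOrder G r pos) {v c : V} :
    IsGreedyChild (leveledDegreeSequence G r) (levelGreedyMap G r pos v)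
      (levelGreedyMap G r pos c) ↔ c ∈ forestChildren (stepToward G r) v := by
  have hP := isLeveled_stepToward hG.1 r
  have hblock : ∀ c : V, G.dist r c ≠ 0 →
      childBlockStart (leveledDegreeSequence G r) (G.dist r (stepToward G r c))
        (levelIndex G r pos (stepToward G r c)) ≤ levelIndex G r pos c ∧
      levelIndex G r pos c < childBlockStart (leveledDegreeSequence G r)
        (G.dist r (stepToward G r c)) (levelIndex G r pos (stepToward G r c) + 1) := by
    intro c hc
    have hup := hP.up c hc
    have hne : ∀ x, G.dist r x = G.dist r c → x ≠ r := by
      rintro x hx rfl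
      rw [SimpleGraph.dist_self] at hx
      exact hc hx.symm
    have hlt := levelIndex_lt (G := G) (r := r) (pos := pos) (stepToward G r c)
    rw [h.childBlockStart_eq hG hlt.le, h.childBlockStart_eq hG hlt, hup]
    have hcmp : ∀ x, G.dist r x = G.dist r c →
        G.dist r (stepToward G r x) = G.dist r (stepToward G r c) := fun x hx => by
      have := hP.up x (by omega)
      omega
    constructor
    · refine card_le_card fun x hx => ?_
      simp only [mem_filter, mem_levelSet] at hx ⊢
      refine ⟨hx.1, ?_⟩
      rw [levelIndex_lt_iff (hcmp x hx.1)] at hx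
      by_contra hcon
      exact absurd hx.2 (h.mono c x hx.1.symm (hne c rfl) (hne x hx.1) (not_lt.1 hcon)).not_gt
    · refine card_lt_card ((ssubset_iff_of_subset fun x hx => ?_).2 ⟨c, ?_, by simp⟩)
      · simp only [mem_filter, mem_levelSet] at hx ⊢
        refine ⟨hx.1, Nat.lt_succ_iff.2 ((levelIndex_le_iff (hcmp x hx.1)).2 ?_)⟩
        exact h.mono x c hx.1 (hne x hx.1) (hne c rfl) hx.2.le
      · simp
  rw [hP.mem_forestChildren]
  constructor
  · rintro ⟨h1, h2, h3⟩
    dsimp only [levelGreedyMap] at h1 h2 h3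
    have hc0 : G.dist r c ≠ 0 := by omega
    have hup := hP.up c hc0
    obtain ⟨b1, b2⟩ := hblock c hc0
    have hd : G.dist r (stepToward G r c) = G.dist r v := by omega
    rw [hd] at b1 b2
    refine ⟨hc0, h.levelIndex_inj hd ?_⟩
    rcases lt_trichotomy (levelIndex G r pos (stepToward G r c)) (levelIndex G r pos v) with hl | he | hl
    · have := childBlockStart_mono (leveledDegreeSequence G r) (G.dist r v)
        (show levelIndex G r pos (stepToward G r c) + 1 ≤ levelIndex G r pos v from hl)
      omega
    · exact he
    · have := childBlockStart_mono (leveledDegreeSequence G r) (G.dist r v)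
        (show levelIndex G r pos v + 1 ≤ levelIndex G r pos (stepToward G r c) from hl)
      omega
  · rintro ⟨hc0, rfl⟩
    exact ⟨(hP.up c hc0).symm, hblock c hc0⟩

theorem IsLevelOrder.exists_iso (hG : G.IsTree) (h : IsLevelOrder G r pos) :
    ∃ e : G ≃g levelGreedyForest (leveledDegreeSequence G r), (e r).1 = 0 := by
  have hinj : Function.Injective (levelGreedyMap G r pos) := fun v w hvw => by
    have h1 : G.dist r v = G.dist r w := congrArg Sigma.fst hvw
    have h2 : levelIndex G r pos v = levelIndex G r pos w :=
      congrArg (fun x : Σ i : ℕ, Fin (leveledDegreeSequence G r i).length => (x.2 : ℕ)) hvw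
    exact h.levelIndex_inj h1 h2
  have hsurj : Function.Surjective (levelGreedyMap G r pos) := fun ⟨i, m, hm⟩ => by
    obtain ⟨v, rfl, rfl⟩ := h.exists_levelIndex_eq (by
      rwa [length_leveledDegreeSequence] at hm)
    exact ⟨v, rfl⟩
  refine ⟨⟨Equiv.ofBijective _ ⟨hinj, hsurj⟩, fun {v w} => ?_⟩, ?_⟩
  · change IsGreedyChild _ (levelGreedyMap G r pos v) (levelGreedyMap G r pos w) ∨
      IsGreedyChild _ (levelGreedyMap G r pos w) (levelGreedyMap G r pos v) ↔ _
    rw [h.isGreedyChild_iff hG, h.isGreedyChild_iff hG]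
    nth_rewrite 3 [← hG.parGraph_stepToward r]
    rw [parGraph_adj, or_comm]
  · exact SimpleGraph.dist_self

theorem HasComparableBranches.isGreedyTree (hG : G.IsTree) (hc : HasComparableBranches G) :
    IsGreedyTree G := by
  obtain ⟨r, hr⟩ := hc.exists_root hG
  refine ⟨hG, r, (hc.isLevelOrder hG r).exists_iso hG, fun i a ha b hb => ?_⟩
  obtain ⟨v, hv, rfl⟩ := mem_leveledDegreeSequence.1 ha
  obtain ⟨w, hw, rfl⟩ := mem_leveledDegreeSequence.1 hb
  exact hc.degree_le_of_dist hG hr (by omega)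

end LevelGreedyIso

/-! ### Uniqueness of the greedy tree -/

section GreedyUniqueness

open Finset

variable {V W : Type*} [Fintype V] [Fintype W]

/-- No degree on a level of `G` with root `r` is smaller than a degree on the next level. -/
def HasDecreasingLevels (G : SimpleGraph V) (r : V) : Prop :=
  ∀ i, ∀ a ∈ leveledDegreeSequence G r i, ∀ b ∈ leveledDegreeSequence G r (i + 1), b ≤ a

theorem HasDecreasingLevels.le_of_lt {G : SimpleGraph V} {r : V} (hG : G.IsTree)
    (h : HasDecreasingLevels G r) {i j : ℕ} (hij : i < j) {a b : ℕ}
    (ha : a ∈ leveledDegreeSequence G r i) (hb : b ∈ leveledDegreeSequence G r j) : b ≤ a := by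
  induction j, hij using Nat.le_induction generalizing b with
  | base => exact h i a ha b hb
  | succ j hij ih =>
    obtain ⟨w, hw, rfl⟩ := mem_leveledDegreeSequence.1 hb
    have hwr : w ≠ r := by rintro rfl; rw [SimpleGraph.dist_self] at hw; omega
    have hp := (stepToward_spec hG.1 hwr).2
    have hmem := mem_leveledDegreeSequence.2
      ⟨stepToward G r w, (by omega : G.dist r (stepToward G r w) = j), rfl⟩
    exact (h j _ hmem _ hb).trans (ih hmem)

/-- The degrees on the first `m` levels, in the order of the levels. -/
noncomputable def levelDegrees (G : SimpleGraph V) (r : V) (m : ℕ) : List ℕ :=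
  (List.range m).flatMap (leveledDegreeSequence G r)

theorem levelDegrees_succ (G : SimpleGraph V) (r : V) (m : ℕ) :
    levelDegrees G r (m + 1) = levelDegrees G r m ++ leveledDegreeSequence G r m := by
  simp [levelDegrees, List.range_succ]

theorem levelDegrees_prefix (G : SimpleGraph V) (r : V) {m n : ℕ} (h : m ≤ n) :
    levelDegrees G r m <+: levelDegrees G r n := by
  induction n, h using Nat.le_induction with
  | base => exact List.prefix_rfl
  | succ n _ ih =>
    rw [levelDegrees_succ]
    exact ih.trans (List.prefix_append _ _)

theorem HasDecreasingLevels.pairwise_levelDegrees {G : SimpleGraph V} {r : V} (hG : G.IsTree)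
    (h : HasDecreasingLevels G r) (m : ℕ) :
    (levelDegrees G r m).Pairwise fun a b => b ≤ a := by
  rw [levelDegrees, List.pairwise_flatMap]
  refine ⟨fun i _ => Multiset.pairwise_sort _ _, ?_⟩
  exact List.pairwise_lt_range.imp fun hij a ha b hb => h.le_of_lt hG hij ha hb

open Classical in
theorem coe_levelDegrees (G : SimpleGraph V) (r : V) (m : ℕ) :
    (levelDegrees G r m : Multiset ℕ) =
      (univ.filter fun v => G.dist r v < m).val.map fun v => G.degree v := by
  induction m with
  | zero => simp [levelDegrees]
  | succ m ih =>
    have hdisj : Disjoint (univ.filter fun v => G.dist r v < m)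
        (univ.filter fun v => G.dist r v = m) :=
      disjoint_filter.2 fun v _ h1 h2 => h1.ne h2
    have hun : (univ.filter fun v => G.dist r v < m + 1) =
        (univ.filter fun v => G.dist r v < m).disjUnion (univ.filter fun v => G.dist r v = m) hdisj := by
      ext v
      simp [le_iff_lt_or_eq]
    rw [levelDegrees_succ, ← Multiset.coe_add, ih, hun, disjUnion_val, Multiset.map_add,
      leveledDegreeSequence, Multiset.sort_eq]

theorem HasDegreeSequence.coe_levelDegrees {G : SimpleGraph V} {D : List ℕ}
    (hD : HasDegreeSequence G D) (r : V) : ∃ N, ∀ m, N ≤ m → (levelDegrees G r m : Multiset ℕ) = D := by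
  classical
  refine ⟨univ.sup (G.dist r) + 1, fun m hm => ?_⟩
  rw [_root_.coe_levelDegrees, filter_true_of_mem fun v hv => by
    have := le_sup (f := G.dist r) hv
    omega]
  exact hD

theorem length_leveledDegreeSequence_zero {G : SimpleGraph V} (hG : G.IsTree) (r : V) :
    (leveledDegreeSequence G r 0).length = 1 := by
  classical
  rw [length_leveledDegreeSequence, card_eq_one]
  refine ⟨r, ?_⟩
  ext v
  rw [mem_levelSet, hG.1.dist_eq_zero_iff, mem_singleton, eq_comm]

theorem length_leveledDegreeSequence_succ {G : SimpleGraph V} (hG : G.IsTree) (r : V) (i : ℕ) :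
    (leveledDegreeSequence G r (i + 1)).length =
      ((leveledDegreeSequence G r i).map (numChildren i)).sum := by
  classical
  have hP := isLeveled_stepToward hG.1 r
  rw [length_leveledDegreeSequence, card_eq_sum_ones, ← hP.sum_levelSet_sum_children,
    ← Multiset.sum_coe, ← Multiset.map_coe, leveledDegreeSequence, Multiset.sort_eq, Multiset.map_map]
  change _ = ∑ v ∈ univ.filter fun v => G.dist r v = i, numChildren i (G.degree v)
  refine sum_congr rfl fun v hv => ?_
  have hdeg := hP.degree_parGraph v
  rw [hG.parGraph_stepToward, mem_levelSet.1 hv] at hdeg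
  rw [← card_eq_sum_ones, numChildren]
  split_ifs at hdeg ⊢ <;> omega

/-- Reading the levels from the root lists the degrees in non-increasing order, so both lists equal
the sorted degree sequence. The cuts between levels agree too, since the degrees on one level
determine the size of the next. -/
theorem HasDecreasingLevels.leveledDegreeSequence_eq {G : SimpleGraph V} {H : SimpleGraph W} {r : V}
    {s : W} (hG : G.IsTree) (hH : H.IsTree) (hr : HasDecreasingLevels G r)
    (hs : HasDecreasingLevels H s) {D : List ℕ} (hGD : HasDegreeSequence G D)
    (hHD : HasDegreeSequence H D) : leveledDegreeSequence G r = leveledDegreeSequence H s := by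
  obtain ⟨M, hM⟩ := hGD.coe_levelDegrees r
  obtain ⟨N, hN⟩ := hHD.coe_levelDegrees s
  have heq : ∀ m, M ≤ m → N ≤ m → levelDegrees G r m = levelDegrees H s m := fun m h1 h2 =>
    List.Perm.eq_of_pairwise' (r := fun a b => b ≤ a) (hr.pairwise_levelDegrees hG m)
      (hs.pairwise_levelDegrees hH m) (Multiset.coe_eq_coe.1 ((hM m h1).trans (hN m h2).symm))
  have step : ∀ i, levelDegrees G r i = levelDegrees H s i →
      (leveledDegreeSequence G r i).length = (leveledDegreeSequence H s i).length →
      leveledDegreeSequence G r i = leveledDegreeSequence H s i ∧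
        levelDegrees G r (i + 1) = levelDegrees H s (i + 1) := fun i h1 h2 => by
    have hpre := levelDegrees_prefix G r (show i + 1 ≤ M + N + i + 1 by omega)
    rw [heq (M + N + i + 1) (by omega) (by omega)] at hpre
    have hlen : (levelDegrees G r (i + 1)).length = (levelDegrees H s (i + 1)).length := by
      rw [levelDegrees_succ, levelDegrees_succ, List.length_append, List.length_append, h1, h2]
    have hpre' := levelDegrees_prefix H s (show i + 1 ≤ M + N + i + 1 by omega)
    have h3 := (List.prefix_of_prefix_length_le hpre hpre' hlen.le).eq_of_length hlen
    refine ⟨?_, h3⟩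
    rw [levelDegrees_succ, levelDegrees_succ] at h3
    exact (List.append_inj' h3 h2).2
  have main : ∀ i, leveledDegreeSequence G r i = leveledDegreeSequence H s i ∧
      levelDegrees G r (i + 1) = levelDegrees H s (i + 1) := fun i => by
    induction i with
    | zero =>
      refine step 0 rfl ?_
      rw [length_leveledDegreeSequence_zero hG, length_leveledDegreeSequence_zero hH]
    | succ i ih =>
      refine step (i + 1) ih.2 ?_
      rw [length_leveledDegreeSequence_succ hG, length_leveledDegreeSequence_succ hH, ih.1]
  exact funext fun i => (main i).1

/-- A greedy tree is determined up to isomorphism by its degree sequence. -/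
theorem IsGreedyTree.nonempty_iso {G : SimpleGraph V} {H : SimpleGraph W} (hG : IsGreedyTree G)
    (hH : IsGreedyTree H) {D : List ℕ} (hGD : HasDegreeSequence G D) (hHD : HasDegreeSequence H D) :
    Nonempty (G ≃g H) := by
  obtain ⟨hGt, r, ⟨e, -⟩, hr⟩ := hG
  obtain ⟨hHt, s, ⟨f, -⟩, hs⟩ := hH
  rw [HasDecreasingLevels.leveledDegreeSequence_eq hGt hHt hr hs hGD hHD] at e
  exact ⟨e.trans f.symm⟩

end GreedyUniqueness

/-! ### Invariance under isomorphism -/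

section Isomorphism

open Finset

variable {V W : Type*} [Fintype V] [Fintype W] {G : SimpleGraph V} {H : SimpleGraph W}

theorem numClosedWalks_le_of_iso (e : G ≃g H) (k : ℕ) : numClosedWalks G k ≤ numClosedWalks H k := by
  classical
  rw [numClosedWalks, numClosedWalks, ← Equiv.sum_comp e.toEquiv]
  refine sum_le_sum fun v _ => ?_
  refine card_le_card_of_injOn (fun p => p.map e.toHom) (fun p hp => ?_)
    (SimpleGraph.Walk.map_injective_of_injective e.injective v v).injOn
  rw [mem_coe, SimpleGraph.mem_finsetWalkLength_iff] at hp
  exact mem_coe.2 (SimpleGraph.mem_finsetWalkLength_iff.2 ((SimpleGraph.Walk.length_map _ _).trans hp))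

theorem numClosedWalks_eq_of_iso (e : G ≃g H) (k : ℕ) : numClosedWalks G k = numClosedWalks H k :=
  (numClosedWalks_le_of_iso e k).antisymm (numClosedWalks_le_of_iso e.symm k)

end Isomorphism

/-! ### Maximal trees and the theorem -/

section Extremal

variable {V : Type*} [Fintype V] {G : SimpleGraph V}

theorem WalkLT.trans {H I : SimpleGraph V} (h₁ : WalkLT G H) (h₂ : WalkLT H I) : WalkLT G I := by
  obtain ⟨h1, K, h2⟩ := h₁
  exact ⟨fun k => (h1 k).trans (h₂.1 k), K, fun k hk he => (h2 k hk he).trans_le (h₂.1 k)⟩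

theorem WalkLT.irrefl : ¬ WalkLT G G := fun ⟨_, K, h⟩ =>
  lt_irrefl _ (h (2 * K) (by omega) (even_two_mul K))

theorem IsWalkMaximal.isGreedyTree (hG : G.IsTree) (hmax : IsWalkMaximal G) : IsGreedyTree G :=
  HasComparableBranches.isGreedyTree hG
    ⟨fun h₁ h₂ hne => hmax.branchGE_of_adj_adj hG h₁ h₂ hne, fun h => hmax.branchGE_of_adj hG h⟩

/-- A tree is greedy, or has fewer closed walks than a greedy tree with the same degree sequence. -/
theorem SimpleGraph.IsTree.exists_isGreedyTree (hG : G.IsTree) {D : List ℕ}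
    (hD : HasDegreeSequence G D) :
    ∃ H : SimpleGraph V, IsGreedyTree H ∧ HasDegreeSequence H D ∧ (G = H ∨ WalkLT G H) := by
  classical
  -- The reversed order makes the induction climb toward trees with more walks.
  let R : SimpleGraph V → SimpleGraph V → Prop := fun G H => WalkLT H G
  have : IsTrans _ R := ⟨fun _ _ _ h₁ h₂ => h₂.trans h₁⟩
  have : Std.Irrefl R := ⟨fun _ => WalkLT.irrefl⟩
  induction G using (Finite.wellFounded_of_trans_of_irrefl R).induction with
  | h G ih =>
  by_cases hmax : IsWalkMaximal G
  · exact ⟨G, hmax.isGreedyTree hG, hD, Or.inl rfl⟩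
  · rw [IsWalkMaximal] at hmax
    push Not at hmax
    obtain ⟨H, hH, hdeg, hlt⟩ := hmax
    have hHD : HasDegreeSequence H D := by
      rw [HasDegreeSequence, ← hD]
      exact Multiset.map_congr rfl fun v _ => hdeg v
    obtain ⟨I, hI, hID, h⟩ := ih H hlt hH hHD
    refine ⟨I, hI, hID, Or.inr ?_⟩
    rcases h with rfl | h
    · exact hlt
    · exact hlt.trans h

end Extremal

/-- The first three properties of `G` say that it is the greedy tree with degree sequence `D`. -/
theorem theorem3p6 (D : List ℕ)
    (hD : ∃ T₀ : SimpleGraph (Fin D.length), T₀.IsTree ∧ HasDegreeSequence T₀ D) :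
    ∃ G : SimpleGraph (Fin D.length),
      IsGreedyTree G ∧ HasDegreeSequence G D ∧
      (∀ (W : Type*) [Fintype W] (H : SimpleGraph W),
        IsGreedyTree H → HasDegreeSequence H D → Nonempty (H ≃g G)) ∧
      ∀ (V : Type*) [Fintype V] (T : SimpleGraph V), T.IsTree → HasDegreeSequence T D →
        (∀ k : ℕ,
          spectralMoment T k = (numClosedWalks T k : ℝ) ∧
          numClosedWalks T k ≤ numClosedWalks G k ∧
          (numClosedWalks G k : ℝ) = spectralMoment G k) ∧
        (¬ Nonempty (T ≃g G) →
          ∃ K : ℕ, ∀ k : ℕ, K ≤ k → Even k → numClosedWalks T k < numClosedWalks G k) := by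
  obtain ⟨T₀, hT₀, hT₀D⟩ := hD
  obtain ⟨G, hG, hGD, -⟩ := hT₀.exists_isGreedyTree hT₀D
  refine ⟨G, hG, hGD, fun W _ H hH hHD => hH.nonempty_iso hG hHD hGD, fun V _ T hT hTD => ?_⟩
  -- `H` lives on the vertices of `T`; uniqueness identifies it with `G`.
  obtain ⟨H, hH, hHD, h⟩ := hT.exists_isGreedyTree hTD
  obtain ⟨e⟩ := hH.nonempty_iso hG hHD hGD
  refine ⟨fun k => ⟨spectralMoment_eq_numClosedWalks T k, ?_,
    (spectralMoment_eq_numClosedWalks G k).symm⟩, fun hne => ?_⟩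
  · rw [← numClosedWalks_eq_of_iso e]
    rcases h with rfl | h
    · exact le_rfl
    · exact h.1 k
  · rcases h with rfl | h
    · exact absurd ⟨e⟩ hne
    · obtain ⟨K, hK⟩ := h.2
      refine ⟨K, fun k hk he => ?_⟩
      rw [← numClosedWalks_eq_of_iso e]
      exact hK k hk he
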